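/- **Growth process.** Let $\eta_0\in\{0,1\}^{\mathbb Z}$ be a (possibly random) particle configuration which almost surely has infinitely many particles to the left of the origin and infinitely many holes to the right of it. Replace the site $0$ by a pair of sites with a hole on the left and a particle on the right, i.e. let $\zeta(x)=\eta_0(x)$ for $x<0$, $\zeta(0)=0$, $\zeta(1)=1$, $\zeta(x)=\eta_0(x-1)$ for $x\ge 2$. Let $\gamma_0:\mathbb Z\to\mathbb Z^2$ be the path with $\gamma_0(0)=(0,0)$ and $\gamma_0(j)-\gamma_0(j-1)=(1-\zeta(j),-\zeta(j))$, and let $\Gamma_0=\{z\in\mathbb Z^2: z\le\gamma_0(j)\text{ for some }j\}$. For $k,m\ge1$ let $\alpha_k=\max\{m:(m,k)\in\Gamma_0\}$, $\beta_m=\max\{k:(m,k)\in\Gamma_0\}$, $A_k=(\alpha_k+1,k)$ and $B_m=(m,\beta_m+1)$. Let $(w(z))_{z\in\mathbb Z^2}$ be i.i.d. exponential random variables with mean $1$, independent of $\eta_0$. Let $T(a\to z)$ be the maximum of $\sum_{y\in\pi}w(y)$ over the up-right lattice paths $\pi$ from $a$ to $z$ ($0$ if there is none). For $z=(z_1,z_2)\notin\Gamma_0$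 put $G^1(z)=\max_{0<k\le z_2}T(A_k\to z)$, $G^2(z)=\max_{0<m\le z_1}T(B_m\to z)$ (empty maxima are $0$) and $G(z)=\max\{G^1(z),G^2(z)\}$; put $G(z)=0$ for $z\in\Gamma_0$. The growth process is $\Gamma_t=\{z:G(z)\le t\}$, with boundary $\gamma_t$. A site $z\notin\Gamma_0$ belongs to cluster 1 if $G^2(z)<G^1(z)$. The competition interface is the path $\phi_0=(0,0)$, with $\phi_{n+1}=\phi_n+(1,0)$ if $\phi_n+(1,1)$ belongs to cluster 1 and $\phi_{n+1}=\phi_n+(0,1)$ otherwise, and $\psi(t)=(I(t),J(t)):=\phi_n$ for $t\in[G(\phi_n),G(\phi_{n+1}))$. **Exclusion process with a second-class particle.** Let $\eta_0'$ be the configuration that differs from $\eta_0$ exactly at the origin, and let $(N_x)_{x\in\mathbb Z}$ be independent Poisson processes of intensity $1$, independent of $\eta_0$. Let $(\eta_t)$ and $(\eta'_t)$ be the totally asymmetric simple exclusion processes started from $\eta_0$ and $\eta'_0$ and driven by the same $(N_x)$: at each epoch of $N_x$, a particle at $x$ (if any) jumps to $x+1$ provided that $x+1$ is empty, and there are no other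 changes. Let $X(t)=\sum_x x\,\mathbf 1\{\eta_t(x)\ne\eta'_t(x)\}$ be the position of the second-class particle. **Proposition 2.2.** For every law of $\eta_0$ as above there is a coupling, i.e. a probability space carrying $\eta_0$, weights $(w(z))$ and Poisson processes $(N_x)$ with the above laws (the $w$'s and the $N$'s being in general dependent on each other), together with $(\eta_t)$ and $(\eta'_t)$ as above, under which almost surely, for all $t\ge0$: 1. $\eta_t$ and $\eta_t'$ differ exactly at the site $X(t)$, and $\psi(t)$ is well defined (there is exactly one $n$ with $G(\phi_n)\le t<G(\phi_{n+1})$); 2. $I(t)$ is the number of rightward jumps, and $J(t)$ the number of leftward jumps, of the second-class particle in $[0,t]$ (both are finite); 3. $X(t)=I(t)-J(t)$. -/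

import Mathlib

open MeasureTheory ProbabilityTheory Filter Topology

namespace ExclusionGrowth

noncomputable section

open scoped Classical

/-! ### Initial data -/

/-- Particle configurations on `ℤ`: `true` is a particle, `false` is a hole. -/
abbrev Config : Type := ℤ → Bool

/-- Infinitely many particles to the left of the origin and infinitely many holes to its right.
Equivalently, the initial interface has a (finite) corner at every height `k > 0` and in every
column `m > 0`. -/
def Admissible (η : Config) : Prop :=
  (∀ n : ℤ, ∃ x < n, η x = true) ∧ (∀ n : ℤ, ∃ x > n, η x = false)

/-- The configuration that differs from `η` exactly at the origin. -/
def flipOrigin (η : Config) : Config := Function.update η 0 (!η 0)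

/-- Replace the site `0` of `η` (the site of the second-class particle) by a pair of sites `0, 1`
with a hole on the left and a particle on the right. -/
def splitOrigin (η : Config) : Config := fun x =>
  if x < 0 then η x else if x = 0 then false else if x = 1 then true else η (x - 1)

/-- One step of the interface: down at a particle, right at a hole. -/
def interfaceStep (b : Bool) : ℤ × ℤ := if b then (0, -1) else (1, 0)

/-- The down-right path `γ₀` with `γ₀ 0 = (0, 0)` and
`γ₀ j - γ₀ (j - 1) = (1 - ζ j, - ζ j)` for all `j : ℤ`. -/
def interface (ζ : Config) (j : ℤ) : ℤ × ℤ :=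
  ∑ i ∈ Finset.Ioc 0 j, interfaceStep (ζ i) - ∑ i ∈ Finset.Ioc j 0, interfaceStep (ζ i)

/-- The initially occupied set `Γ₀`: all the sites weakly below and to the left of the interface
that corresponds to `η`. -/
def initialSet (η : Config) : Set (ℤ × ℤ) :=
  {z | ∃ j : ℤ, z ≤ interface (splitOrigin η) j}

/-! ### Last-passage percolation and the growth process

Here `Γ` is the initially occupied set and `w` is the field of weights. -/

/-- A step of a directed path. -/
def IsStep (a b : ℤ × ℤ) : Prop := b = a + (1, 0) ∨ b = a + (0, 1)

/-- Directed (up-right) paths from `a` to `b`, as lists of the visited sites. -/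
def directedPaths (a b : ℤ × ℤ) : Set (List (ℤ × ℤ)) :=
  {p | p.IsChain IsStep ∧ p.head? = some a ∧ p.getLast? = some b}

/-- Last-passage time `T(a → b)`, the maximum of the weight of a directed path from `a` to `b`
(a finite set of paths; the value is `0` if there is none). -/
def passageTime (w : ℤ × ℤ → ℝ) (a b : ℤ × ℤ) : ℝ :=
  sSup ((fun p : List (ℤ × ℤ) => (p.map w).sum) '' directedPaths a b)

/-- `α k`: the first coordinate of the rightmost site of `Γ` at height `k` (used for `k > 0`). -/
def alpha (Γ : Set (ℤ × ℤ)) (k : ℤ) : ℤ := sSup {m : ℤ | (m, k) ∈ Γ}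

/-- `β m`: the second coordinate of the highest site of `Γ` in column `m` (used for `m > 0`). -/
def beta (Γ : Set (ℤ × ℤ)) (m : ℤ) : ℤ := sSup {k : ℤ | (m, k) ∈ Γ}

/-- `G¹(z) = max_{0 < k ≤ z(2)} T(A_k → z)` with `A_k = (α k + 1, k)`; it is `0` if `z(2) ≤ 0`. -/
def G1 (Γ : Set (ℤ × ℤ)) (w : ℤ × ℤ → ℝ) (z : ℤ × ℤ) : ℝ :=
  sSup ((fun k : ℤ => passageTime w (alpha Γ k + 1, k) z) '' Set.Ioc 0 z.2)

/-- `G²(z) = max_{0 < m ≤ z(1)} T(B_m → z)` with `B_m = (m, β m + 1)`; it is `0` if `z(1) ≤ 0`. -/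
def G2 (Γ : Set (ℤ × ℤ)) (w : ℤ × ℤ → ℝ) (z : ℤ × ℤ) : ℝ :=
  sSup ((fun m : ℤ => passageTime w (m, beta Γ m + 1) z) '' Set.Ioc 0 z.1)

/-- The time at which `z` becomes occupied. The growth process at time `t` is
`Γ_t = {z | occupationTime Γ w z ≤ t}`, and `γ_t` is its boundary. -/
def occupationTime (Γ : Set (ℤ × ℤ)) (w : ℤ × ℤ → ℝ) (z : ℤ × ℤ) : ℝ :=
  if z ∈ Γ then 0 else max (G1 Γ w z) (G2 Γ w z)

/-- The sites that eventually join cluster 1. -/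
def cluster1 (Γ : Set (ℤ × ℤ)) (w : ℤ × ℤ → ℝ) : Set (ℤ × ℤ) :=
  {z | z ∉ Γ ∧ G2 Γ w z < G1 Γ w z}

/-- The competition interface `φ`: it starts at the origin and goes right from `φ n` if
`φ n + (1, 1)` joins cluster 1, and up otherwise (that is, almost surely, if `φ n + (1, 1)` joins
cluster 2). -/
def competitionInterface (Γ : Set (ℤ × ℤ)) (w : ℤ × ℤ → ℝ) : ℕ → ℤ × ℤ
  | 0 => (0, 0)
  | n + 1 =>
    if competitionInterface Γ w n + (1, 1) ∈ cluster1 Γ w then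
      competitionInterface Γ w n + (1, 0)
    else competitionInterface Γ w n + (0, 1)

/-- `n` is the index with `t ∈ [G(φ n), G(φ (n + 1)))`. -/
def IsIndexAt (Γ : Set (ℤ × ℤ)) (w : ℤ × ℤ → ℝ) (t : ℝ) (n : ℕ) : Prop :=
  t ∈ Set.Ico (occupationTime Γ w (competitionInterface Γ w n))
    (occupationTime Γ w (competitionInterface Γ w (n + 1)))

/-- `ψ(t) = (I(t), J(t)) = φ n` for `t ∈ [G(φ n), G(φ (n + 1)))`. -/
def psi (Γ : Set (ℤ × ℤ)) (w : ℤ × ℤ → ℝ) (t : ℝ) : ℤ × ℤ :=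
  if h : ∃ n, IsIndexAt Γ w t n then competitionInterface Γ w h.choose else (0, 0)

/-! ### Exclusion process -/

/-- The set of the epochs of the point process on `(0, ∞)` at the site `x`, whose successive
waiting times are `e (x, 0), e (x, 1), …`. If these are i.i.d. exponential with mean `1`, this is a
Poisson process of intensity `1`. -/
def epochs (e : ℤ × ℕ → ℝ) (x : ℤ) : Set ℝ :=
  Set.range fun n : ℕ => ∑ i ∈ Finset.range (n + 1), e (x, i)

/-- The configuration right after a time at which exactly the clocks of the sites in `A` ring, if
`ξ` is the configuration right before it: for `x ∈ A`, a particle at `x` jumps to `x + 1` if there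
is a hole at `x + 1`. (Two such jumps never involve a common site.) -/
def afterRing (A : Set ℤ) (ξ : Config) : Config := fun x =>
  if x ∈ A ∧ ξ x = true ∧ ξ (x + 1) = false then false
  else if x - 1 ∈ A ∧ ξ (x - 1) = true ∧ ξ x = false then true
  else ξ x

/-- `η : ℝ → Config` (at the times `t ≥ 0`) is the trajectory of the totally asymmetric simple
exclusion process started from `η₀` and driven by the sets of epochs `E x`, `x : ℤ`: every site has
a right-continuous trajectory with left limits, which changes only through the jumps at the
epochs. -/
structure IsTASEP (E : ℤ → Set ℝ) (η₀ : Config) (η : ℝ → Config) : Prop where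
  init : η 0 = η₀
  right_continuous : ∀ t : ℝ, 0 ≤ t → ∀ x : ℤ, ∀ᶠ s in 𝓝[>] t, η s x = η t x
  jump : ∀ t : ℝ, 0 < t → ∃ ξ : Config,
    (∀ x : ℤ, ∀ᶠ s in 𝓝[<] t, η s x = ξ x) ∧ η t = afterRing {x | t ∈ E x} ξ

/-- `X(t) = ∑ₓ x 1{η_t(x) ≠ η'_t(x)}`, the position of the second-class particle. -/
def discrepancy (η η' : ℝ → Config) (t : ℝ) : ℤ :=
  ∑ᶠ x : ℤ, if η t x ≠ η' t x then x else 0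

/-- The times in `[0, t]` at which the trajectory `X` jumps to the right. -/
def rightJumps (X : ℝ → ℤ) (t : ℝ) : Set ℝ :=
  {s | 0 < s ∧ s ≤ t ∧ ∃ y < X s, ∀ᶠ r in 𝓝[<] s, X r = y}

/-- The times in `[0, t]` at which the trajectory `X` jumps to the left. -/
def leftJumps (X : ℝ → ℤ) (t : ℝ) : Set ℝ :=
  {s | 0 < s ∧ s ≤ t ∧ ∃ y > X s, ∀ᶠ r in 𝓝[<] s, X r = y}

/-! ### The two random objects that are coupled -/

/-- The family `v` is i.i.d. exponential with mean `1`. -/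
structure IsIIDExp {Ω ι : Type} [MeasurableSpace Ω] (P : Measure Ω) (v : ι → Ω → ℝ) : Prop where
  law : ∀ i, HasLaw (v i) (expMeasure 1) P
  indep : iIndepFun v P

/-- `w` is the field of i.i.d. weights of the growth process whose initial set is given by the
random configuration `η₀` with law `μ`, independent of the weights. -/
structure IsGrowthModel {Ω : Type} [MeasurableSpace Ω] (P : Measure Ω) (μ : Measure Config)
    (η₀ : Ω → Config) (w : ℤ × ℤ → Ω → ℝ) : Prop where
  init_law : HasLaw η₀ μ P
  weights : IsIIDExp P w
  indep : IndepFun η₀ (fun ω z => w z ω) P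

/-- `(η, η')` is the basic coupling of two exclusion processes whose initial configurations `η₀`
(random with law `μ`) and `flipOrigin η₀` differ only at the origin: both use the same family of
independent rate-one Poisson clocks (with waiting times `e`), independent of `η₀`. -/
structure IsSecondClassExclusion {Ω : Type} [MeasurableSpace Ω] (P : Measure Ω)
    (μ : Measure Config) (η₀ : Ω → Config) (e : ℤ × ℕ → Ω → ℝ) (η η' : Ω → ℝ → Config) :
    Prop where
  init_law : HasLaw η₀ μ P
  clocks : IsIIDExp P e
  indep : IndepFun η₀ (fun ω i => e i ω) P
  measurable : ∀ t x, Measurable fun ω => η ω t x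
  measurable' : ∀ t x, Measurable fun ω => η' ω t x
  tasep : ∀ᵐ ω ∂P, IsTASEP (epochs fun i => e i ω) (η₀ ω) (η ω)
  tasep' : ∀ᵐ ω ∂P, IsTASEP (epochs fun i => e i ω) (flipOrigin (η₀ ω)) (η' ω)

end

end ExclusionGrowth

open ExclusionGrowth

/-! A coupling of the growth process with the exclusion process, built from the clocks.

**Construction.** The boundary of a growing set is a down-right path; its down-steps are particles
and its right-steps are holes, and adding a site at an inner corner moves a particle one step to the
right. Given the clocks of the exclusion process, let every site be added at the first ring of its
clock after both its parents are present. The clock of a site `z` is that of its diagonal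
`z.1 - z.2` if `z` joins cluster 1, and that of the diagonal `z.1 - z.2 - 1` otherwise, because the
boundary has one more site than the exclusion process: the second-class particle stands for a pair
hole-particle of the boundary. The weight of `z` is the time from the presence of its parents to the
ring. Which cluster `z` joins is known when its parents are present, so this is a recursion
(`clockTimes`), and it is the recursion of the last-passage times `(G¹, G²)` for the weights so
obtained (`isGrowth_G`).

**Law of the weights.** Two sites with the same clock lie on the same or on neighbouring diagonals,
hence are comparable (`comparable_of_siteClock`), so that each clock is used along an increasing
sequence of sites. If the sites are explored in an order in which parents come first, each new site
therefore looks at a clock only after the last time at which that clock has been used. By the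
stationarity of the Poisson process (`measurePreserving_residual`) the waiting time found there is
exponential and independent of everything explored before (`measurePreserving_ring`), and so
the weights are i.i.d. exponential (`map_clockWeight`). This holds for every fixed initial
configuration, which gives the independence of the weights and the initial configuration.

**The second-class particle.** The competition interface moves to that one of its two neighbours
that is added first (`competitionInterface_eq`); the sites to its upper left are those of
cluster 1 and the sites to its lower right are the others (`cluster_of_minPath`). At any time the
boundary passes through a right-step followed by a down-step at the current site of the interface.
Replacing this pair by one site of either type yields the two exclusion processes: the shift of the
clocks in cluster 2 is the shift of the indices on the right of the pair, and a clock at which no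
site is added moves no particle (`IsRingGrowth.jump`). So the two processes differ exactly at the
diagonal of the interface (`IsRingGrowth.second_class_particle`). -/

namespace ExclusionGrowth

noncomputable section

open scoped Classical

/-! ### Renewal sequences and their residuals -/

/-- The `n`-th arrival time of the point process with waiting times `a 0, a 1, …`. -/
def arrival (a : ℕ → ℝ) (n : ℕ) : ℝ := ∑ i ∈ Finset.range (n + 1), a i

/-- The index of the first arrival after time `u` (`0` if there is none). -/
def passIndex (u : ℝ) (a : ℕ → ℝ) : ℕ := sInf {n | u < arrival a n}

/-- The waiting times of the point process seen from time `u`: the time from `u` to the next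
arrival, followed by the later waiting times. -/
def residual (u : ℝ) (a : ℕ → ℝ) : ℕ → ℝ := fun n =>
  if n = 0 then arrival a (passIndex u a) - u else a (passIndex u a + n)

/-- Waiting times of a locally finite point process with distinct points that never stops. -/
structure IsRegular (a : ℕ → ℝ) : Prop where
  pos : ∀ n, 0 < a n
  unbounded : ∀ u, ∃ n, u < arrival a n

lemma arrival_succ (a : ℕ → ℝ) (n : ℕ) : arrival a (n + 1) = arrival a n + a (n + 1) := by
  simp [arrival, Finset.sum_range_succ]

lemma arrival_zero (a : ℕ → ℝ) : arrival a 0 = a 0 := by simp [arrival]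

lemma IsRegular.strictMono {a : ℕ → ℝ} (h : IsRegular a) : StrictMono (arrival a) :=
  strictMono_nat_of_lt_succ fun n => by rw [arrival_succ]; linarith [h.pos (n + 1)]

lemma IsRegular.lt_passIndex {a : ℕ → ℝ} (h : IsRegular a) (u : ℝ) :
    u < arrival a (passIndex u a) := Nat.sInf_mem (h.unbounded u)

lemma passIndex_le {a : ℕ → ℝ} {u : ℝ} {n : ℕ} (h : u < arrival a n) : passIndex u a ≤ n :=
  Nat.sInf_le h

lemma passIndex_eq {a : ℕ → ℝ} {u : ℝ} {n : ℕ} (h : u < arrival a n)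
    (h' : ∀ m < n, arrival a m ≤ u) : passIndex u a = n := by
  refine le_antisymm (passIndex_le h) ?_
  by_contra hlt
  push Not at hlt
  have : u < arrival a (passIndex u a) := Nat.sInf_mem (s := {n | u < arrival a n}) ⟨n, h⟩
  linarith [h' _ hlt]

lemma arrival_le_of_lt_passIndex {a : ℕ → ℝ} {u : ℝ} {m : ℕ} (h : m < passIndex u a) :
    arrival a m ≤ u := by
  by_contra hlt
  exact absurd (passIndex_le (not_le.1 hlt)) (by omega)

lemma residual_zero (u : ℝ) (a : ℕ → ℝ) :
    residual u a 0 = arrival a (passIndex u a) - u := by simp [residual]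

lemma residual_succ (u : ℝ) (a : ℕ → ℝ) (n : ℕ) :
    residual u a (n + 1) = a (passIndex u a + (n + 1)) := by simp [residual]

lemma arrival_residual (u : ℝ) (a : ℕ → ℝ) (n : ℕ) :
    arrival (residual u a) n = arrival a (passIndex u a + n) - u := by
  induction n with
  | zero => simp [arrival_zero, residual_zero]
  | succ n ih => rw [arrival_succ, ih, residual_succ, ← add_assoc, arrival_succ]; ring

lemma IsRegular.residual {a : ℕ → ℝ} (h : IsRegular a) (u : ℝ) : IsRegular (residual u a) where
  pos n := by
    cases n with
    | zero => rw [residual_zero]; linarith [h.lt_passIndex u]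
    | succ n => rw [residual_succ]; exact h.pos _
  unbounded v := by
    obtain ⟨n, hn⟩ := h.unbounded (v + u)
    refine ⟨n, ?_⟩
    rw [arrival_residual]
    linarith [h.strictMono.monotone (show n ≤ passIndex u a + n by omega)]

lemma passIndex_residual {a : ℕ → ℝ} (h : IsRegular a) (u : ℝ) {v : ℝ} (hv : 0 ≤ v) :
    passIndex u a + passIndex v (residual u a) = passIndex (u + v) a := by
  symm
  have h1 := (h.residual u).lt_passIndex v
  rw [arrival_residual] at h1
  refine passIndex_eq (by linarith) fun m hm => ?_
  rcases lt_or_ge m (passIndex u a) with h2 | h2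
  · linarith [arrival_le_of_lt_passIndex h2]
  · obtain ⟨k, rfl⟩ := Nat.exists_eq_add_of_le h2
    have := arrival_le_of_lt_passIndex (show k < passIndex v (ExclusionGrowth.residual u a) by omega)
    rw [arrival_residual] at this
    linarith

lemma residual_residual {a : ℕ → ℝ} (h : IsRegular a) (u : ℝ) {v : ℝ} (hv : 0 ≤ v) :
    residual v (residual u a) = residual (u + v) a := by
  funext n
  have := passIndex_residual h u hv
  cases n with
  | zero => rw [residual_zero, residual_zero, arrival_residual, this]; ring
  | succ n =>
    rw [residual_succ, residual_succ, ← this, ← add_assoc, residual_succ]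
    congr 1
    omega

/-- From the next arrival after `u` on, one sees the waiting times after that arrival. -/
lemma residual_arrival {a : ℕ → ℝ} (h : IsRegular a) (u : ℝ) :
    residual (u + residual u a 0) a = fun n => residual u a (n + 1) := by
  have h0 : u + residual u a 0 = arrival a (passIndex u a) := by rw [residual_zero]; ring
  have h1 : passIndex (u + residual u a 0) a = passIndex u a + 1 := by
    rw [h0]
    refine passIndex_eq (h.strictMono (by omega)) fun m hm => h.strictMono.monotone (by omega)
  funext n
  cases n with
  | zero => rw [residual_zero, h1, residual_succ, arrival_succ, h0]; simp
  | succ n => rw [residual_succ, h1, residual_succ]; congr 1; omega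

lemma residual_of_lt {a : ℕ → ℝ} {u : ℝ} (h : u < a 0) :
    residual u a = fun n => if n = 0 then a 0 - u else a n := by
  have h1 : passIndex u a = 0 := passIndex_eq (by rwa [arrival_zero]) (by simp)
  funext n
  cases n with
  | zero => simp [residual_zero, h1, arrival_zero]
  | succ n => simp [residual_succ, h1]

lemma residual_zero_time {a : ℕ → ℝ} (h : IsRegular a) : residual 0 a = a := by
  rw [residual_of_lt (h.pos 0)]
  funext n
  cases n <;> simp

lemma arrival_succ' (a : ℕ → ℝ) (n : ℕ) :
    arrival a (n + 1) = a 0 + arrival (fun i => a (i + 1)) n := by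
  simp only [arrival]
  rw [Finset.sum_range_succ']
  ring

lemma residual_of_le {a : ℕ → ℝ} {u : ℝ} (h : a 0 ≤ u) (hn : ∃ n, u < arrival a n) :
    residual u a = residual (u - a 0) (fun n => a (n + 1)) := by
  have key : passIndex u a = passIndex (u - a 0) (fun n => a (n + 1)) + 1 := by
    have hn' : ∃ n, u - a 0 < arrival (fun n => a (n + 1)) n := by
      obtain ⟨n, hn⟩ := hn
      cases n with
      | zero => rw [arrival_zero] at hn; linarith
      | succ n => exact ⟨n, by rw [arrival_succ'] at hn; linarith⟩
    have hm : u - a 0 < arrival (fun n => a (n + 1)) (passIndex (u - a 0) (fun n => a (n + 1))) :=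
      Nat.sInf_mem (s := {n | _ < arrival _ n}) hn'
    refine passIndex_eq (by rw [arrival_succ']; linarith) fun m hm => ?_
    cases m with
    | zero => rwa [arrival_zero]
    | succ m =>
      rw [arrival_succ']
      linarith [arrival_le_of_lt_passIndex (show m < _ from Nat.lt_of_succ_lt_succ hm)]
  funext n
  cases n with
  | zero => rw [residual_zero, residual_zero, key, arrival_succ']; ring
  | succ n => rw [residual_succ, residual_succ, key]; congr 1; omega

/-! ### Measurability of residuals -/

lemma measurable_sInf_nat {Ω : Type*} [MeasurableSpace Ω] {p : Ω → ℕ → Prop}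
    (hp : ∀ n, MeasurableSet {ω | p ω n}) : Measurable fun ω => sInf {n | p ω n} := by
  refine measurable_to_countable' fun k => ?_
  have : (fun ω => sInf {n | p ω n}) ⁻¹' {k} =
      ({ω | p ω k} ∩ ⋂ j : ℕ, ⋂ _ : j < k, {ω | p ω j}ᶜ) ∪
        ({ω | k = 0} ∩ ⋂ j : ℕ, {ω | p ω j}ᶜ) := by
    ext ω
    simp only [Set.mem_preimage, Set.mem_singleton_iff, Set.mem_union, Set.mem_inter_iff,
      Set.mem_iInter, Set.mem_compl_iff, Set.mem_ofPred_eq]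
    constructor
    · rintro rfl
      by_cases h : {n | p ω n}.Nonempty
      · exact Or.inl ⟨Nat.sInf_mem h, fun j hj => Nat.notMem_of_lt_sInf hj⟩
      · rw [Set.not_nonempty_iff_eq_empty] at h
        refine Or.inr ⟨by rw [h]; simp, fun j hj => ?_⟩
        have : j ∈ {n | p ω n} := hj
        simp [h] at this
    · rintro (⟨h1, h2⟩ | ⟨rfl, h2⟩)
      · refine le_antisymm (Nat.sInf_le h1) ?_
        by_contra hlt
        exact h2 _ (not_le.1 hlt) (Nat.sInf_mem (s := {n | p ω n}) ⟨k, h1⟩)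
      · rw [show {n | p ω n} = ∅ by ext j; simpa using h2 j]; simp
  rw [this]
  refine ((hp k).inter (MeasurableSet.iInter fun j => MeasurableSet.iInter fun _ =>
    (hp j).compl)).union ((MeasurableSet.const _).inter (MeasurableSet.iInter fun j =>
      (hp j).compl))

lemma measurable_eval_countable {Ω ι β : Type*} [MeasurableSpace Ω] [MeasurableSpace β]
    [Countable ι] [MeasurableSpace ι] [MeasurableSingletonClass ι]
    {a : Ω → ι → β} {c : Ω → ι} (ha : Measurable a) (hc : Measurable c) :
    Measurable fun ω => a ω (c ω) := by
  have h : Measurable fun p : (ι → β) × ι => p.1 p.2 :=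
    measurable_from_prod_countable_left fun i => measurable_pi_apply i
  exact h.comp (ha.prodMk hc)

@[fun_prop]
lemma measurable_arrival (n : ℕ) : Measurable fun a : ℕ → ℝ => arrival a n := by
  unfold arrival; fun_prop

lemma measurable_residual : Measurable fun p : ℝ × (ℕ → ℝ) => residual p.1 p.2 := by
  have hk : Measurable fun p : ℝ × (ℕ → ℝ) => passIndex p.1 p.2 :=
    measurable_sInf_nat fun n =>
      measurableSet_lt measurable_fst ((measurable_arrival n).comp measurable_snd)
  refine measurable_pi_lambda _ fun n => ?_
  cases n with
  | zero =>
    simp only [residual_zero]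
    have : Measurable fun p : ℝ × (ℕ → ℝ) => (fun n => arrival p.2 n) (passIndex p.1 p.2) :=
      measurable_eval_countable
        (measurable_pi_lambda _ fun n => (measurable_arrival n).comp measurable_snd) hk
    exact this.sub measurable_fst
  | succ n =>
    simp only [residual_succ]
    exact measurable_eval_countable measurable_snd (hk.add_const _)

/-! ### Memorylessness and the stationarity of the Poisson process -/

instance : IsProbabilityMeasure (expMeasure 1) := isProbabilityMeasure_expMeasure one_pos

lemma expMeasure_one_eq :
    expMeasure 1 = (volume : Measure ℝ).withDensity (exponentialPDF 1) := rfl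

instance : NullSingletonClass (expMeasure 1) := by
  rw [expMeasure_one_eq]; infer_instance

lemma measurable_exponentialPDF : Measurable (exponentialPDF 1) :=
  (measurable_exponentialPDFReal 1).ennreal_ofReal

lemma ae_pos_expMeasure : ∀ᵐ x ∂expMeasure 1, 0 < x := by
  have h : ∀ᵐ x ∂expMeasure 1, 0 ≤ x := by
    rw [expMeasure_one_eq, ae_withDensity_iff measurable_exponentialPDF]
    refine ae_of_all _ fun x hx => ?_
    by_contra hneg
    exact hx (exponentialPDF_of_neg (not_le.1 hneg))
  have h0 : ∀ᵐ x ∂expMeasure 1, x ≠ 0 := by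
    rw [ae_iff]
    simp
  filter_upwards [h, h0] with x h1 h2 using lt_of_le_of_ne h1 h2.symm

/-- The memoryless property of the exponential law. -/
lemma lintegral_expMeasure_shift {u : ℝ} (hu : 0 ≤ u) {g : ℝ → ENNReal} (hg : Measurable g) :
    ∫⁻ x in Set.Ioi u, g (x - u) ∂expMeasure 1 =
      ENNReal.ofReal (Real.exp (-u)) * ∫⁻ x, g x ∂expMeasure 1 := by
  have h1 : ∫⁻ x, g x ∂expMeasure 1 = ∫⁻ x in Set.Ioi 0, g x ∂expMeasure 1 := by
    rw [← setLIntegral_univ]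
    refine setLIntegral_congr ?_
    filter_upwards [ae_pos_expMeasure] with x hx
    exact propext ⟨fun _ => hx, fun _ => trivial⟩
  rw [h1, expMeasure_one_eq, restrict_withDensity measurableSet_Ioi,
    restrict_withDensity measurableSet_Ioi,
    lintegral_withDensity_eq_lintegral_mul _ measurable_exponentialPDF (by fun_prop),
    lintegral_withDensity_eq_lintegral_mul _ measurable_exponentialPDF (by fun_prop),
    ← lintegral_const_mul _ (measurable_exponentialPDF.mul hg),
    ← lintegral_indicator measurableSet_Ioi, ← lintegral_indicator measurableSet_Ioi,
    ← lintegral_add_right_eq_self _ u]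
  congr 1
  funext x
  by_cases hx : 0 < x
  · rw [Set.indicator_of_mem (show x + u ∈ Set.Ioi u by simpa using hx),
      Set.indicator_of_mem (show x ∈ Set.Ioi 0 from hx)]
    simp only [Pi.mul_apply, add_sub_cancel_right]
    rw [exponentialPDF_of_nonneg hx.le, exponentialPDF_of_nonneg (by linarith : 0 ≤ x + u),
      ← mul_assoc, ← ENNReal.ofReal_mul (Real.exp_pos _).le]
    congr 2
    simp only [one_mul]
    rw [← Real.exp_add]
    congr 1
    ring
  · rw [Set.indicator_of_notMem (show x + u ∉ Set.Ioi u by simpa using hx),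
      Set.indicator_of_notMem (show x ∉ Set.Ioi 0 from hx)]

/-- The law of a family of independent exponential variables with mean `1`. -/
abbrev expProduct (ι : Type*) : Measure (ι → ℝ) := Measure.infinitePi fun _ : ι => expMeasure 1

/-- Prepend a term to a sequence. -/
def seqCons (x : ℝ) (b : ℕ → ℝ) : ℕ → ℝ := fun n => if n = 0 then x else b (n - 1)

@[simp] lemma seqCons_zero (x : ℝ) (b : ℕ → ℝ) : seqCons x b 0 = x := by simp [seqCons]

@[simp] lemma seqCons_succ (x : ℝ) (b : ℕ → ℝ) (n : ℕ) : seqCons x b (n + 1) = b n := by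
  simp [seqCons]

@[fun_prop]
lemma measurable_seqCons : Measurable fun p : ℝ × (ℕ → ℝ) => seqCons p.1 p.2 := by
  refine measurable_pi_lambda _ fun n => ?_
  cases n with
  | zero => simpa using measurable_fst
  | succ n => simp only [seqCons_succ]; fun_prop

lemma measurePreserving_seqCons :
    MeasurePreserving (fun p : ℝ × (ℕ → ℝ) => seqCons p.1 p.2)
      ((expMeasure 1).prod (expProduct ℕ)) (expProduct ℕ) where
  measurable := measurable_seqCons
  map_eq := by
    refine Measure.eq_infinitePi _ fun s t ht => ?_
    rw [Measure.map_apply measurable_seqCons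
      (MeasurableSet.pi s.countable_toSet fun i _ => ht i)]
    have : (fun p : ℝ × (ℕ → ℝ) => seqCons p.1 p.2) ⁻¹' Set.pi s t =
        (if 0 ∈ s then t 0 else Set.univ) ×ˢ
          Set.pi ((s.erase 0).image (fun n => n - 1) : Finset ℕ) (fun n => t (n + 1)) := by
      ext ⟨x, b⟩
      simp only [Set.mem_preimage, Set.mem_pi, Finset.mem_coe, Set.mem_prod, Finset.mem_image,
        Finset.mem_erase]
      constructor
      · refine fun h => ⟨?_, ?_⟩
        · split_ifs with h0
          · simpa using h 0 h0
          · trivial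
        · rintro _ ⟨n, ⟨hn, hns⟩, rfl⟩
          obtain ⟨m, rfl⟩ := Nat.exists_eq_succ_of_ne_zero hn
          simpa using h _ hns
      · rintro ⟨h1, h2⟩ n hn
        cases n with
        | zero => simpa [hn] using h1
        | succ n => simpa using h2 n ⟨n + 1, ⟨by simp, hn⟩, by simp⟩
    rw [this, Measure.prod_prod, Measure.infinitePi_pi _ fun i _ => ht _,
      Finset.prod_image]
    · by_cases h0 : 0 ∈ s
      · rw [if_pos h0, ← Finset.mul_prod_erase s _ h0]
        congr 1
        refine Finset.prod_congr rfl fun n hn => ?_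
        rw [Nat.sub_add_cancel (Nat.pos_of_ne_zero (Finset.ne_of_mem_erase hn))]
      · rw [if_neg h0, measure_univ, one_mul, Finset.erase_eq_of_notMem h0]
        refine Finset.prod_congr rfl fun n hn => ?_
        rw [Nat.sub_add_cancel (Nat.pos_of_ne_zero (ne_of_mem_of_not_mem hn h0))]
    · intro n hn m hm h
      have := (Finset.mem_erase.1 hn).1
      have := (Finset.mem_erase.1 hm).1
      dsimp at h
      omega

lemma measurePreserving_head_tail :
    MeasurePreserving (fun a : ℕ → ℝ => (a 0, fun n => a (n + 1)))
      (expProduct ℕ) ((expMeasure 1).prod (expProduct ℕ)) := by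
  have hm : Measurable (fun a : ℕ → ℝ => (a 0, fun n => a (n + 1))) := by fun_prop
  refine ⟨hm, ?_⟩
  conv_lhs => rw [← measurePreserving_seqCons.map_eq, Measure.map_map hm measurable_seqCons]
  have : (fun a : ℕ → ℝ => (a 0, fun n => a (n + 1))) ∘ (fun p : ℝ × (ℕ → ℝ) => seqCons p.1 p.2)
      = id := by
    funext p
    simp
  rw [this, Measure.map_id]

lemma expProduct_nat_apply {C : Set (ℕ → ℝ)} (hC : MeasurableSet C) :
    expProduct ℕ C = ∫⁻ x, expProduct ℕ {b | seqCons x b ∈ C} ∂expMeasure 1 := by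
  rw [← measurePreserving_seqCons.measure_preimage hC.nullMeasurableSet,
    Measure.prod_apply (measurable_seqCons hC)]
  rfl

/-- For almost every realization of independent exponential variables, the sums along a sequence
of distinct indices diverge. -/
lemma ae_tendsto_sum {ι : Type*} {J : ℕ → ι} (hJ : Function.Injective J) :
    ∀ᵐ h ∂expProduct ι, Tendsto (fun n => ∑ i ∈ Finset.range n, h (J i)) atTop atTop := by
  -- the strong law of large numbers for the truncated variables `min (max x 0) 1`
  let τ : ℝ → ℝ := fun x => min (max x 0) 1
  have hτ : Measurable τ := by fun_prop
  have hτ0 : ∀ x, 0 ≤ τ x := fun x => le_min (le_max_right _ _) zero_le_one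
  have hτ1 : ∀ x, τ x ≤ 1 := fun x => min_le_right _ _
  have hint : ∀ i, Integrable (fun h : ι → ℝ => τ (h (J i))) (expProduct ι) := fun i =>
    Integrable.of_bound
      (hτ.comp (measurable_pi_apply _)).aestronglyMeasurable 1 (ae_of_all _ fun h => by
      rw [Real.norm_eq_abs, abs_of_nonneg (hτ0 _)]; exact hτ1 _)
  have hpos : ∀ᵐ h ∂expProduct ι, ∀ i, 0 < h (J i) := by
    rw [ae_all_iff]
    intro i
    exact (measurePreserving_eval_infinitePi _ (J i)).quasiMeasurePreserving.ae ae_pos_expMeasure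
  have hlim := strong_law_ae_real (μ := expProduct ι) (fun i h => τ (h (J i))) (hint 0)
    (fun i j hij => ?_) (fun i => ?_)
  · have hm : 0 < ∫ h, τ (h (J 0)) ∂expProduct ι := by
      rw [integral_pos_iff_support_of_nonneg (fun h => hτ0 _) (hint 0)]
      have : ∀ᵐ h ∂expProduct ι, h ∈ Function.support fun h : ι → ℝ => τ (h (J 0)) := by
        filter_upwards [hpos] with h hh
        exact (lt_min (lt_max_of_lt_left (hh 0)) one_pos).ne'
      have h1 := (mem_ae_iff_prob_eq_one
        (((hτ.comp (measurable_pi_apply (J 0))) (measurableSet_singleton 0)).compl)).1 this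
      exact h1 ▸ one_pos
    filter_upwards [hlim, hpos] with h h1 h2
    have h3 : Tendsto (fun n : ℕ => (∑ i ∈ Finset.range n, τ (h (J i)))) atTop atTop := by
      have := h1.pos_mul_atTop hm tendsto_natCast_atTop_atTop
      refine this.congr' ?_
      filter_upwards [eventually_gt_atTop 0] with n hn
      have : (n : ℝ) ≠ 0 := by positivity
      field_simp
    refine tendsto_atTop_mono (fun n => Finset.sum_le_sum fun i _ => ?_) h3
    have := h2 i
    simp only [τ]
    rw [max_eq_left this.le]
    exact min_le_left _ _
  · have := (iIndepFun_infinitePi (P := fun _ : ι => expMeasure 1) (X := fun _ => τ)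
      (fun _ => hτ)).indepFun (hJ.ne hij)
    exact this
  · refine ⟨(hτ.comp (measurable_pi_apply _)).aemeasurable,
      (hτ.comp (measurable_pi_apply _)).aemeasurable, ?_⟩
    have key : ∀ j : ι, (expProduct ι).map (fun h => τ (h j)) = (expMeasure 1).map τ := fun j => by
      rw [← (measurePreserving_eval_infinitePi (fun _ : ι => expMeasure 1) j).map_eq,
        Measure.map_map hτ (by fun_prop)]
      rfl
    rw [key, key]

lemma ae_isRegular : ∀ᵐ a ∂expProduct ℕ, IsRegular a := by
  have hpos : ∀ᵐ a ∂expProduct ℕ, ∀ n, 0 < a n := by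
    rw [ae_all_iff]
    intro i
    exact (measurePreserving_eval_infinitePi _ i).quasiMeasurePreserving.ae ae_pos_expMeasure
  filter_upwards [hpos, ae_tendsto_sum (J := (id : ℕ → ℕ)) Function.injective_id] with a h1 h2
  refine ⟨h1, fun u => ?_⟩
  obtain ⟨n, hn⟩ := ((h2.comp (tendsto_add_atTop_nat 1)).eventually_gt_atTop u).exists
  exact ⟨n, hn⟩

lemma measurableSet_passed (n : ℕ) (u : ℝ) :
    MeasurableSet {a : ℕ → ℝ | ∃ j < n, u < arrival a j} := by
  have : {a : ℕ → ℝ | ∃ j < n, u < arrival a j} =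
      ⋃ j : ℕ, ⋃ _ : j < n, {a | u < arrival a j} := by ext; simp
  rw [this]
  exact MeasurableSet.iUnion fun j => MeasurableSet.iUnion fun _ =>
    measurableSet_lt measurable_const (measurable_arrival j)

lemma measurable_residual_right (u : ℝ) : Measurable (residual u) :=
  measurable_residual.comp (measurable_const.prodMk measurable_id)

/-- On the event that one of the first `n` arrivals comes after `u`, the residual waiting times
at `u` have the law of the original ones. The recursion in `n` conditions on the first arrival. -/
lemma measure_residual_passed {B : Set (ℕ → ℝ)} (hB : MeasurableSet B) (n : ℕ) :
    ∀ u : ℝ, 0 ≤ u → expProduct ℕ {a | (∃ j < n, u < arrival a j) ∧ residual u a ∈ B} =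
      expProduct ℕ {a | ∃ j < n, u < arrival a j} * expProduct ℕ B := by
  have hms : ∀ (n : ℕ) (u : ℝ) (C : Set (ℕ → ℝ)), MeasurableSet C →
      MeasurableSet {a | (∃ j < n, u < arrival a j) ∧ residual u a ∈ C} := fun n u C hC =>
    (measurableSet_passed n u).inter (measurable_residual_right u hC)
  induction n with
  | zero => intro u _; simp
  | succ n ih =>
    intro u hu
    -- the recursion, with a general set `C` in place of `B`
    have hrec : ∀ C : Set (ℕ → ℝ), MeasurableSet C →
        expProduct ℕ {a | (∃ j < n + 1, u < arrival a j) ∧ residual u a ∈ C} =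
          ENNReal.ofReal (Real.exp (-u)) * expProduct ℕ C +
          (∫⁻ x in Set.Iic u, expProduct ℕ
            {a | (∃ j < n, u - x < arrival a j) ∧ residual (u - x) a ∈ C} ∂(expMeasure 1)) := by
      intro C hC
      have h1 : ∀ x b, seqCons x b ∈ {a | (∃ j < n + 1, u < arrival a j) ∧ residual u a ∈ C} ↔
          if u < x then seqCons (x - u) b ∈ C
          else b ∈ {a | (∃ j < n, u - x < arrival a j) ∧ residual (u - x) a ∈ C} := by
        intro x b
        split_ifs with hx
        · have : residual u (seqCons x b) = seqCons (x - u) b := by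
            rw [residual_of_lt (by simpa using hx)]
            funext k
            cases k <;> simp
          simp only [Set.mem_ofPred_eq, this]
          exact ⟨fun h => h.2, fun h => ⟨⟨0, by omega, by simpa [arrival_zero] using hx⟩, h⟩⟩
        · have hiff : (∃ j < n + 1, u < arrival (seqCons x b) j) ↔
              ∃ j < n, u - x < arrival b j := by
            constructor
            · rintro ⟨j, hj, hlt⟩
              cases j with
              | zero => exact absurd (by simpa [arrival_zero] using hlt) hx
              | succ j =>
                rw [arrival_succ'] at hlt
                simp only [seqCons_zero, seqCons_succ] at hlt
                exact ⟨j, by omega, by linarith⟩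
            · rintro ⟨j, hj, hlt⟩
              refine ⟨j + 1, by omega, ?_⟩
              rw [arrival_succ']
              simp only [seqCons_zero, seqCons_succ]
              linarith
          simp only [Set.mem_ofPred_eq]
          constructor
          · rintro ⟨h2, h3⟩
            refine ⟨hiff.1 h2, ?_⟩
            obtain ⟨j, -, hj⟩ := h2
            rw [residual_of_le (by simpa using hx) ⟨j, hj⟩] at h3
            simpa using h3
          · rintro ⟨h2, h3⟩
            have h4 := hiff.2 h2
            refine ⟨h4, ?_⟩
            obtain ⟨j, -, hj⟩ := h4
            rw [residual_of_le (by simpa using hx) ⟨j, hj⟩]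
            simpa using h3
      rw [expProduct_nat_apply (hms (n + 1) u C hC),
        ← lintegral_add_compl _ (measurableSet_Ioi (a := u)), Set.compl_Ioi]
      congr 1
      · have hmeas : Measurable fun y : ℝ => expProduct ℕ {b | seqCons y b ∈ C} :=
          measurable_measure_prodMk_left (measurable_seqCons hC)
        rw [expProduct_nat_apply hC, ← lintegral_expMeasure_shift hu hmeas]
        refine setLIntegral_congr_fun measurableSet_Ioi fun x hx => ?_
        congr 1
        ext b
        have := h1 x b
        rw [if_pos (show u < x from hx)] at this
        exact this
      · refine setLIntegral_congr_fun measurableSet_Iic fun x hx => ?_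
        congr 1
        ext b
        have := h1 x b
        rw [if_neg (not_lt.2 hx)] at this
        exact this
    have hB' := hrec B hB
    have hU := hrec Set.univ MeasurableSet.univ
    simp only [Set.mem_univ, and_true, measure_univ, mul_one] at hU
    rw [hB', hU, add_mul, ← lintegral_mul_const']
    · congr 1
      refine setLIntegral_congr_fun measurableSet_Iic fun x hx => ?_
      exact ih (u - x) (by simpa using hx)
    · exact measure_ne_top _ _

/-- A Poisson process seen from a time `u ≥ 0` is again a Poisson process. -/
lemma measurePreserving_residual {u : ℝ} (hu : 0 ≤ u) :
    MeasurePreserving (residual u) (expProduct ℕ) (expProduct ℕ) := by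
  refine ⟨measurable_residual_right u, ?_⟩
  ext B hB
  rw [Measure.map_apply (measurable_residual_right u) hB]
  have hmono : ∀ C : Set (ℕ → ℝ),
      Monotone fun n : ℕ => {a | (∃ j < n, u < arrival a j) ∧ residual u a ∈ C} := by
    rintro C n m hnm a ⟨⟨j, hj, h⟩, h'⟩
    exact ⟨⟨j, hj.trans_le hnm, h⟩, h'⟩
  have hU : ∀ C : Set (ℕ → ℝ), expProduct ℕ
      (⋃ n : ℕ, {a | (∃ j < n, u < arrival a j) ∧ residual u a ∈ C}) =
        expProduct ℕ (residual u ⁻¹' C) := by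
    intro C
    refine measure_congr ?_
    filter_upwards [ae_isRegular] with a ha
    refine propext ?_
    change a ∈ (⋃ n : ℕ, _) ↔ a ∈ residual u ⁻¹' C
    simp only [Set.mem_iUnion, Set.mem_ofPred_eq, Set.mem_preimage]
    refine ⟨fun ⟨n, h⟩ => h.2, fun h => ?_⟩
    obtain ⟨n, hn⟩ := ha.unbounded u
    exact ⟨n + 1, ⟨n, by omega, hn⟩, h⟩
  have h1 := tendsto_measure_iUnion_atTop (μ := expProduct ℕ) (hmono B)
  have h2 := tendsto_measure_iUnion_atTop (μ := expProduct ℕ) (hmono Set.univ)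
  rw [hU] at h1 h2
  have h3 := ENNReal.Tendsto.mul_const (b := expProduct ℕ B) h2 (Or.inr (measure_ne_top _ _))
  simp only [Set.preimage_univ, measure_univ, one_mul] at h3
  refine tendsto_nhds_unique h1 (h3.congr fun n => ?_)
  have := measure_residual_passed hB n u hu
  simpa using this.symm

/-! ### Product measures: resampling one coordinate -/

/-- Replacing one coordinate of an i.i.d. family by an independent copy does not change its law. -/
lemma measurePreserving_update {ι β : Type*} [DecidableEq ι] [MeasurableSpace β] (m : Measure β)
    [IsProbabilityMeasure m] (i : ι) :
    MeasurePreserving (fun p : (ι → β) × β => Function.update p.1 i p.2)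
      ((Measure.infinitePi fun _ : ι => m).prod m) (Measure.infinitePi fun _ : ι => m) where
  measurable := by fun_prop
  map_eq := by
    refine Measure.eq_infinitePi _ fun s t ht => ?_
    rw [Measure.map_apply (by fun_prop) (MeasurableSet.pi s.countable_toSet fun i _ => ht i)]
    have : (fun p : (ι → β) × β => Function.update p.1 i p.2) ⁻¹' Set.pi s t =
        Set.pi (s.erase i : Finset ι) t ×ˢ (if i ∈ s then t i else Set.univ) := by
      ext ⟨a, b⟩
      simp only [Set.mem_preimage, Set.mem_pi, Finset.mem_coe, Set.mem_prod, Finset.mem_erase]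
      constructor
      · refine fun h => ⟨fun j hj => ?_, ?_⟩
        · simpa [hj.1] using h j hj.2
        · split_ifs with hi
          · simpa using h i hi
          · trivial
      · rintro ⟨h1, h2⟩ j hj
        by_cases hji : j = i
        · subst hji
          simpa [hj] using h2
        · simpa [hji] using h1 j ⟨hji, hj⟩
    rw [this, Measure.prod_prod, Measure.infinitePi_pi _ fun i _ => ht _]
    by_cases hi : i ∈ s
    · rw [if_pos hi, Finset.prod_erase_mul s _ hi]
    · rw [if_neg hi, measure_univ, mul_one, Finset.erase_eq_of_notMem hi]

/-- The law of the family of the waiting times of independent Poisson clocks at the sites. -/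
abbrev clockMeasure : Measure (ℤ → ℕ → ℝ) := Measure.infinitePi fun _ : ℤ => expProduct ℕ

lemma measurePreserving_next {u : ℝ} (hu : 0 ≤ u) :
    MeasurePreserving (fun b : ℕ → ℝ => (residual u b 0, fun n => residual u b (n + 1)))
      (expProduct ℕ) ((expMeasure 1).prod (expProduct ℕ)) :=
  measurePreserving_head_tail.comp (measurePreserving_residual hu)

/-- Waiting at the clock `c` from time `u` for the next ring: the waiting time is exponential and
independent of the clocks after that, which are again independent Poisson clocks. -/
lemma measurePreserving_ring (c : ℤ) {u : ℝ} (hu : 0 ≤ u) :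
    MeasurePreserving (fun a : ℤ → ℕ → ℝ =>
        (residual u (a c) 0, Function.update a c fun n => residual u (a c) (n + 1)))
      clockMeasure ((expMeasure 1).prod clockMeasure) := by
  have hr := measurable_residual_right u
  have hr0 : Measurable fun b : ℕ → ℝ => residual u b 0 := (measurable_pi_apply 0).comp hr
  have hrs : Measurable fun b : ℕ → ℝ => fun n => residual u b (n + 1) :=
    measurable_pi_lambda _ fun n => (measurable_pi_apply (n + 1)).comp hr
  have hm : Measurable fun a : ℤ → ℕ → ℝ =>
      (residual u (a c) 0, Function.update a c fun n => residual u (a c) (n + 1)) := by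
    refine (hr0.comp (measurable_pi_apply c)).prodMk ?_
    exact measurable_update'.comp (measurable_id.prodMk (hrs.comp (measurable_pi_apply c)))
  refine ⟨hm, ?_⟩
  have hU : MeasurePreserving _ _ clockMeasure :=
    measurePreserving_update (ι := ℤ) (expProduct ℕ) c
  -- split off the coordinate `c`, apply the one-clock statement, and put the coordinate back
  have h1 := (MeasurePreserving.id clockMeasure).prod (measurePreserving_next hu)
  have h2 : MeasurePreserving
      (fun p : (ℤ → ℕ → ℝ) × (ℝ × (ℕ → ℝ)) => (p.2.1, (p.1, p.2.2)))
      (clockMeasure.prod ((expMeasure 1).prod (expProduct ℕ)))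
      ((expMeasure 1).prod (clockMeasure.prod (expProduct ℕ))) := by
    have e1 := MeasurePreserving.symm _
      (measurePreserving_prodAssoc clockMeasure (expMeasure 1) (expProduct ℕ))
    have e2 := (Measure.measurePreserving_swap (μ := clockMeasure) (ν := expMeasure 1)).prod
      (MeasurePreserving.id (expProduct ℕ))
    have e3 := measurePreserving_prodAssoc (expMeasure 1) clockMeasure (expProduct ℕ)
    exact e3.comp (e2.comp e1)
  have h3 := (MeasurePreserving.id (expMeasure 1)).prod hU
  have h4 := h3.comp (h2.comp h1)
  conv_lhs => rw [← hU.map_eq, Measure.map_map hm hU.measurable]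
  rw [← h4.map_eq]
  congr 1
  funext p
  simp

/-! ### Almost sure properties of the clocks -/

lemma ae_clock_isRegular : ∀ᵐ a ∂clockMeasure, ∀ x, IsRegular (a x) := by
  rw [ae_all_iff]
  intro x
  exact (measurePreserving_eval_infinitePi _ x).quasiMeasurePreserving.ae ae_isRegular

lemma measure_arrival_eq (n : ℕ) (s : ℝ) : expProduct ℕ {b | arrival b n = s} = 0 := by
  have hm : MeasurableSet {b : ℕ → ℝ | arrival b n = s} :=
    (measurable_arrival n) (measurableSet_singleton s)
  rw [← measurePreserving_seqCons.measure_preimage hm.nullMeasurableSet,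
    Measure.prod_apply_symm (measurable_seqCons hm)]
  refine lintegral_eq_zero_of_ae_eq_zero (ae_of_all _ fun b => ?_)
  -- for given later waiting times, the first one is determined by the arrival time
  refine measure_mono_null (t := {s - (arrival (seqCons 0 b) n)}) (fun x hx => ?_)
    (measure_singleton _)
  have h1 : arrival (seqCons x b) n = s := hx
  have h2 : ∀ y, arrival (seqCons y b) n = y + ∑ i ∈ Finset.range n, b i := fun y => by
    simp only [arrival]
    rw [Finset.sum_range_succ']
    simp [add_comm]
  rw [h2] at h1
  rw [Set.mem_singleton_iff, h2]
  linarith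

lemma ae_clock_distinct : ∀ᵐ a ∂clockMeasure, ∀ x y, x ≠ y → ∀ n m,
    arrival (a x) n ≠ arrival (a y) m := by
  simp only [ae_all_iff]
  intro x y hxy n m
  have hU : MeasurePreserving _ _ clockMeasure :=
    measurePreserving_update (ι := ℤ) (expProduct ℕ) x
  have hmeas : MeasurableSet {a : ℤ → ℕ → ℝ | arrival (a x) n ≠ arrival (a y) m} :=
    (measurableSet_eq_fun ((measurable_arrival n).comp (measurable_pi_apply x))
      ((measurable_arrival m).comp (measurable_pi_apply y))).compl
  rw [← hU.map_eq, ae_map_iff hU.measurable.aemeasurable hmeas]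
  refine Measure.ae_prod_iff_ae_ae (hU.measurable hmeas) |>.2 (ae_of_all _ fun a => ?_)
  have h0 : ∀ᵐ b ∂expProduct ℕ, arrival b n ≠ arrival (a y) m := by
    rw [ae_iff]
    simpa using measure_arrival_eq n (arrival (a y) m)
  filter_upwards [h0] with b hb
  simpa [Function.update_of_ne hxy.symm] using hb

/-! ### The growth recursion -/

/-- The initial sets of growth processes: down-sets with a corner at the origin and with a finite
boundary in every row and every column. -/
structure IsCornerSet (Γ : Set (ℤ × ℤ)) : Prop where
  down : ∀ {z z' : ℤ × ℤ}, z ≤ z' → z' ∈ Γ → z ∈ Γ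
  zero_mem : ((0, 0) : ℤ × ℤ) ∈ Γ
  right_notMem : ((1, 0) : ℤ × ℤ) ∉ Γ
  up_notMem : ((0, 1) : ℤ × ℤ) ∉ Γ
  row : ∀ y : ℤ, ∃ x : ℤ, (x, y) ∈ Γ
  col : ∀ x : ℤ, ∃ y : ℤ, (x, y) ∈ Γ

/-- The left neighbour of a site. -/
def leftOf (z : ℤ × ℤ) : ℤ × ℤ := (z.1 - 1, z.2)

/-- The lower neighbour of a site. -/
def belowOf (z : ℤ × ℤ) : ℤ × ℤ := (z.1, z.2 - 1)

/-- The componentwise maximum of `s` over the two neighbours that have to be occupied before `z`. -/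
def parentMax (s : ℤ × ℤ → ℝ × ℝ) (z : ℤ × ℤ) : ℝ × ℝ :=
  (max (s (leftOf z)).1 (s (belowOf z)).1, max (s (leftOf z)).2 (s (belowOf z)).2)

/-- Whether `z` joins cluster 1, in terms of the maxima `m` of `(G¹, G²)` over its parents. -/
def JoinsFirst (z : ℤ × ℤ) (m : ℝ × ℝ) : Prop := 0 < z.2 ∧ (z.1 ≤ 0 ∨ m.2 < m.1)

/-- The clock whose ring adds `z`. In cluster 1, left of the second-class particle, it is the
clock of the diagonal of `z`; in cluster 2, right of it, the pair of sites that stands for the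
second-class particle shifts the clocks by one. -/
def clockOf (z : ℤ × ℤ) (m : ℝ × ℝ) : ℤ :=
  if JoinsFirst z m then z.1 - z.2 else z.1 - z.2 - 1

/-- One step of the recursion for `(G¹, G²)`, when `f z c M` is the time that it takes to add `z`
after the time `M` at which both its parents are present, if its clock is `c`. -/
def growStep (f : ℤ × ℤ → ℤ → ℝ → ℝ) (z : ℤ × ℤ) (m : ℝ × ℝ) : ℝ × ℝ :=
  (if 0 < z.2 then m.1 + f z (clockOf z m) (max m.1 m.2) else 0,
    if 0 < z.1 then m.2 + f z (clockOf z m) (max m.1 m.2) else 0)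

/-- The recursion for `(G¹, G²)`, cut off after `n` steps. -/
def grow (Γ : Set (ℤ × ℤ)) (f : ℤ × ℤ → ℤ → ℝ → ℝ) : ℕ → ℤ × ℤ → ℝ × ℝ
  | 0, _ => (0, 0)
  | n + 1, z => if z ∈ Γ then (0, 0) else growStep f z (parentMax (grow Γ f n) z)

/-- A distance at which both the row and the column of `z` have entered `Γ`. -/
def depth (Γ : Set (ℤ × ℤ)) (z : ℤ × ℤ) : ℕ :=
  sInf {n : ℕ | (z.1 - n, z.2) ∈ Γ ∧ (z.1, z.2 - n) ∈ Γ}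

/-- The pair `(G¹, G²)` for the waiting times `f`. -/
def growTimes (Γ : Set (ℤ × ℤ)) (f : ℤ × ℤ → ℤ → ℝ → ℝ) (z : ℤ × ℤ) : ℝ × ℝ :=
  grow Γ f (2 * depth Γ z) z

/-- `s` solves the recursion for `(G¹, G²)`. -/
structure IsGrowth (Γ : Set (ℤ × ℤ)) (f : ℤ × ℤ → ℤ → ℝ → ℝ) (s : ℤ × ℤ → ℝ × ℝ) : Prop where
  mem : ∀ z ∈ Γ, s z = (0, 0)
  notMem : ∀ z ∉ Γ, s z = growStep f z (parentMax s z)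

lemma parentMax_congr {s s' : ℤ × ℤ → ℝ × ℝ} {z : ℤ × ℤ} (h1 : s (leftOf z) = s' (leftOf z))
    (h2 : s (belowOf z) = s' (belowOf z)) : parentMax s z = parentMax s' z := by
  simp [parentMax, h1, h2]

namespace IsCornerSet

variable {Γ : Set (ℤ × ℤ)}

lemma exists_nat (h : IsCornerSet Γ) (z : ℤ × ℤ) :
    ∃ n : ℕ, (z.1 - n, z.2) ∈ Γ ∧ (z.1, z.2 - n) ∈ Γ := by
  obtain ⟨x, hx⟩ := h.row z.2
  obtain ⟨y, hy⟩ := h.col z.1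
  refine ⟨(z.1 - x).toNat + (z.2 - y).toNat, h.down ?_ hx, h.down ?_ hy⟩ <;>
  · rw [Prod.mk_le_mk]
    constructor <;> push_cast <;> omega

lemma depth_spec (h : IsCornerSet Γ) (z : ℤ × ℤ) :
    (z.1 - depth Γ z, z.2) ∈ Γ ∧ (z.1, z.2 - depth Γ z) ∈ Γ :=
  Nat.sInf_mem (s := {n : ℕ | (z.1 - n, z.2) ∈ Γ ∧ (z.1, z.2 - n) ∈ Γ}) (h.exists_nat z)

lemma site_induction (h : IsCornerSet Γ) {P : ℤ × ℤ → Prop} (mem : ∀ z ∈ Γ, P z)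
    (step : ∀ z ∉ Γ, P (leftOf z) → P (belowOf z) → P z) (z : ℤ × ℤ) : P z := by
  have key : ∀ k a b : ℕ, a + b ≤ k → ∀ z : ℤ × ℤ, (z.1 - a, z.2) ∈ Γ → (z.1, z.2 - b) ∈ Γ →
      P z := by
    intro k
    induction k with
    | zero =>
      intro a b hab z h1 _
      obtain rfl : a = 0 := by omega
      exact mem z (by simpa using h1)
    | succ k ih =>
      intro a b hab z h1 h2
      by_cases hz : z ∈ Γ
      · exact mem z hz
      have ha : a ≠ 0 := by rintro rfl; exact hz (by simpa using h1)
      have hb : b ≠ 0 := by rintro rfl; exact hz (by simpa using h2)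
      refine step z hz (ih (a - 1) b (by omega) _ (h.down ?_ h1) (h.down ?_ h2))
        (ih a (b - 1) (by omega) _ (h.down ?_ h1) (h.down ?_ h2)) <;>
      · simp only [leftOf, belowOf, Prod.mk_le_mk]
        omega
  obtain ⟨n, h1, h2⟩ := h.exists_nat z
  exact key _ n n le_rfl z h1 h2

lemma grow_eq (h : IsCornerSet Γ) (f : ℤ × ℤ → ℤ → ℝ → ℝ) :
    ∀ k a b : ℕ, a + b ≤ k → ∀ z : ℤ × ℤ, (z.1 - a, z.2) ∈ Γ → (z.1, z.2 - b) ∈ Γ →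
      ∀ n m : ℕ, a + b ≤ n → a + b ≤ m → grow Γ f n z = grow Γ f m z := by
  have hmem : ∀ z ∈ Γ, ∀ n, grow Γ f n z = (0, 0) := by
    intro z hz n
    cases n with
    | zero => rfl
    | succ n => simp [grow, hz]
  intro k
  induction k with
  | zero =>
    intro a b hab z h1 _ n m _ _
    obtain rfl : a = 0 := by omega
    rw [hmem z (by simpa using h1), hmem z (by simpa using h1)]
  | succ k ih =>
    intro a b hab z h1 h2 n m hn hm
    by_cases hz : z ∈ Γ
    · rw [hmem z hz, hmem z hz]
    have ha : a ≠ 0 := by rintro rfl; exact hz (by simpa using h1)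
    have hb : b ≠ 0 := by rintro rfl; exact hz (by simpa using h2)
    obtain ⟨n, rfl⟩ := Nat.exists_eq_succ_of_ne_zero (show n ≠ 0 by omega)
    obtain ⟨m, rfl⟩ := Nat.exists_eq_succ_of_ne_zero (show m ≠ 0 by omega)
    simp only [grow, hz, if_false]
    congr 1
    refine parentMax_congr (ih (a - 1) b (by omega) _ (h.down ?_ h1) (h.down ?_ h2) _ _
      (by omega) (by omega)) (ih a (b - 1) (by omega) _ (h.down ?_ h1) (h.down ?_ h2) _ _
      (by omega) (by omega)) <;>
    · simp only [leftOf, belowOf, Prod.mk_le_mk]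
      omega

lemma isGrowth_growTimes (h : IsCornerSet Γ) (f : ℤ × ℤ → ℤ → ℝ → ℝ) :
    IsGrowth Γ f (growTimes Γ f) where
  mem z hz := by
    unfold growTimes
    cases 2 * depth Γ z with
    | zero => rfl
    | succ n => simp [grow, hz]
  notMem z hz := by
    have hd := h.depth_spec z
    have hd0 : depth Γ z ≠ 0 := fun h0 => hz (by rw [h0] at hd; simpa using hd.1)
    -- both parents are determined after as many steps as are used at `z`
    have key : ∀ z' : ℤ × ℤ, z' = leftOf z ∨ z' = belowOf z →
        grow Γ f (2 * depth Γ z - 1) z' = growTimes Γ f z' := by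
      intro z' hz'
      have h1 : (z'.1 - (depth Γ z : ℕ), z'.2) ∈ Γ := by
        refine h.down ?_ hd.1
        rcases hz' with rfl | rfl <;> simp [leftOf, belowOf]
      have h2 : (z'.1, z'.2 - (depth Γ z : ℕ)) ∈ Γ := by
        refine h.down ?_ hd.2
        rcases hz' with rfl | rfl <;> simp [leftOf, belowOf]
      have hle : depth Γ z' ≤ depth Γ z := Nat.sInf_le ⟨h1, h2⟩
      have hd' := h.depth_spec z'
      rw [growTimes, h.grow_eq f _ _ _ le_rfl z' hd'.1 hd'.2 (2 * depth Γ z')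
        (2 * depth Γ z) (by omega) (by omega)]
      rcases hz' with rfl | rfl
      · refine h.grow_eq f _ (depth Γ z - 1) (depth Γ z) le_rfl _ (h.down ?_ hd.1)
          (h.down ?_ hd.2) _ _ (by omega) (by omega) <;>
        · simp only [leftOf, Prod.mk_le_mk]
          omega
      · refine h.grow_eq f _ (depth Γ z) (depth Γ z - 1) le_rfl _ (h.down ?_ hd.1)
          (h.down ?_ hd.2) _ _ (by omega) (by omega) <;>
        · simp only [belowOf, Prod.mk_le_mk]
          omega
    rw [growTimes, show 2 * depth Γ z = (2 * depth Γ z - 1) + 1 by omega]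
    simp only [grow, hz, if_false]
    congr 1
    exact parentMax_congr (key _ (Or.inl rfl)) (key _ (Or.inr rfl))

lemma pos_of_notMem (h : IsCornerSet Γ) {z : ℤ × ℤ} (hz : z ∉ Γ) : 0 < z.1 ∨ 0 < z.2 := by
  by_contra hcon
  push Not at hcon
  exact hz (h.down (Prod.mk_le_mk.2 hcon) h.zero_mem)

lemma notMem_of_right (h : IsCornerSet Γ) {z : ℤ × ℤ} (h1 : 0 < z.1) (h2 : 0 ≤ z.2) : z ∉ Γ :=
  fun hz => h.right_notMem (h.down (Prod.mk_le_mk.2 ⟨h1, h2⟩) hz)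

lemma notMem_of_up (h : IsCornerSet Γ) {z : ℤ × ℤ} (h1 : 0 ≤ z.1) (h2 : 0 < z.2) : z ∉ Γ :=
  fun hz => h.up_notMem (h.down (Prod.mk_le_mk.2 ⟨h1, h2⟩) hz)

end IsCornerSet

/-- The time at which a site is added, from the pair `(G¹, G²)`. -/
def totalTime (s : ℤ × ℤ → ℝ × ℝ) (z : ℤ × ℤ) : ℝ := max (s z).1 (s z).2

/-- The clock whose ring adds `z`. -/
def siteClock (s : ℤ × ℤ → ℝ × ℝ) (z : ℤ × ℤ) : ℤ := clockOf z (parentMax s z)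

/-- The time at which both parents of `z` are present. -/
def startTime (s : ℤ × ℤ → ℝ × ℝ) (z : ℤ × ℤ) : ℝ := max (parentMax s z).1 (parentMax s z).2

lemma startTime_eq (s : ℤ × ℤ → ℝ × ℝ) (z : ℤ × ℤ) :
    startTime s z = max (totalTime s (leftOf z)) (totalTime s (belowOf z)) :=
  max_max_max_comm _ _ _ _

/-- The growth recursion with weights: `s` solves it with the positive waiting times `w`. -/
structure IsWeightedGrowth (Γ : Set (ℤ × ℤ)) (w : ℤ × ℤ → ℝ) (s : ℤ × ℤ → ℝ × ℝ) : Prop where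
  corner : IsCornerSet Γ
  growth : IsGrowth Γ (fun z _ _ => w z) s
  pos : ∀ z ∉ Γ, 0 < w z

namespace IsWeightedGrowth

variable {Γ : Set (ℤ × ℤ)} {w : ℤ × ℤ → ℝ} {s : ℤ × ℤ → ℝ × ℝ}

lemma nonneg (h : IsWeightedGrowth Γ w s) (z : ℤ × ℤ) : 0 ≤ (s z).1 ∧ 0 ≤ (s z).2 := by
  refine h.corner.site_induction (P := fun z => 0 ≤ (s z).1 ∧ 0 ≤ (s z).2) ?_ ?_ z
  · intro z hz; simp [h.growth.mem z hz]
  · intro z hz h1 h2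
    rw [h.growth.notMem z hz]
    have := (h.pos z hz).le
    have h3 : 0 ≤ (parentMax s z).1 := le_max_of_le_left h1.1
    have h4 : 0 ≤ (parentMax s z).2 := le_max_of_le_left h1.2
    constructor
    · simp only [growStep]; split_ifs <;> linarith
    · simp only [growStep]; split_ifs <;> linarith

lemma fst_eq_zero (h : IsWeightedGrowth Γ w s) {z : ℤ × ℤ} (hz : z.2 ≤ 0) : (s z).1 = 0 := by
  by_cases hΓ : z ∈ Γ
  · simp [h.growth.mem z hΓ]
  · rw [h.growth.notMem z hΓ]; simp [growStep, not_lt.2 hz]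

lemma snd_eq_zero (h : IsWeightedGrowth Γ w s) {z : ℤ × ℤ} (hz : z.1 ≤ 0) : (s z).2 = 0 := by
  by_cases hΓ : z ∈ Γ
  · simp [h.growth.mem z hΓ]
  · rw [h.growth.notMem z hΓ]; simp [growStep, not_lt.2 hz]

lemma totalTime_mem (h : IsWeightedGrowth Γ w s) {z : ℤ × ℤ} (hz : z ∈ Γ) : totalTime s z = 0 := by
  simp [totalTime, h.growth.mem z hz]

lemma totalTime_nonneg (h : IsWeightedGrowth Γ w s) (z : ℤ × ℤ) : 0 ≤ totalTime s z :=
  le_max_of_le_left (h.nonneg z).1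

lemma totalTime_eq (h : IsWeightedGrowth Γ w s) {z : ℤ × ℤ} (hz : z ∉ Γ) :
    totalTime s z = startTime s z + w z := by
  have hw := h.pos z hz
  rw [totalTime, h.growth.notMem z hz, startTime]
  have h3 : 0 ≤ (parentMax s z).1 := le_max_of_le_left (h.nonneg _).1
  have h4 : 0 ≤ (parentMax s z).2 := le_max_of_le_left (h.nonneg _).2
  simp only [growStep]
  by_cases h1 : 0 < z.1
  · by_cases h2 : 0 < z.2
    · simp only [h1, h2, if_true]
      exact max_add_add_right _ _ _
    · have : (parentMax s z).1 = 0 := by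
        simp only [parentMax]
        rw [h.fst_eq_zero (by simp only [leftOf]; omega),
          h.fst_eq_zero (by simp only [belowOf]; omega), max_self]
      simp only [h1, h2, if_true, if_false, this]
      rw [max_eq_right h4, max_eq_right (by linarith)]
  · have h2 : 0 < z.2 := (h.corner.pos_of_notMem hz).resolve_left h1
    have : (parentMax s z).2 = 0 := by
      simp only [parentMax]
      rw [h.snd_eq_zero (by simp only [leftOf]; omega),
        h.snd_eq_zero (by simp only [belowOf]; omega), max_self]
    simp only [h1, h2, if_true, if_false, this]
    rw [max_eq_left h3, max_eq_left (by linarith)]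

lemma startTime_lt (h : IsWeightedGrowth Γ w s) {z : ℤ × ℤ} (hz : z ∉ Γ) :
    startTime s z < totalTime s z := by
  rw [h.totalTime_eq hz]; linarith [h.pos z hz]

lemma left_lt (h : IsWeightedGrowth Γ w s) {z : ℤ × ℤ} (hz : z ∉ Γ) :
    totalTime s (leftOf z) < totalTime s z :=
  lt_of_le_of_lt (by rw [startTime_eq]; exact le_max_left _ _) (h.startTime_lt hz)

lemma below_lt (h : IsWeightedGrowth Γ w s) {z : ℤ × ℤ} (hz : z ∉ Γ) :
    totalTime s (belowOf z) < totalTime s z :=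
  lt_of_le_of_lt (by rw [startTime_eq]; exact le_max_right _ _) (h.startTime_lt hz)

lemma mono (h : IsWeightedGrowth Γ w s) {z z' : ℤ × ℤ} (hzz : z ≤ z') :
    totalTime s z ≤ totalTime s z' := by
  have hl : ∀ z, totalTime s (leftOf z) ≤ totalTime s z := fun z => by
    by_cases hz : z ∈ Γ
    · rw [h.totalTime_mem hz, h.totalTime_mem (h.corner.down (by simp [leftOf, Prod.le_def]) hz)]
    · exact (h.left_lt hz).le
  have hb : ∀ z, totalTime s (belowOf z) ≤ totalTime s z := fun z => by
    by_cases hz : z ∈ Γ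
    · rw [h.totalTime_mem hz, h.totalTime_mem (h.corner.down (by simp [belowOf, Prod.le_def]) hz)]
    · exact (h.below_lt hz).le
  have h1 : ∀ (n : ℕ) (x y : ℤ), totalTime s (x, y) ≤ totalTime s (x + n, y) := by
    intro n x y
    induction n with
    | zero => simp
    | succ n ih =>
      refine ih.trans ?_
      have := hl (x + (n + 1 : ℕ), y)
      simpa [leftOf, ← add_assoc] using this
  have h2 : ∀ (n : ℕ) (x y : ℤ), totalTime s (x, y) ≤ totalTime s (x, y + n) := by
    intro n x y
    induction n with
    | zero => simp
    | succ n ih =>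
      refine ih.trans ?_
      have := hb (x, y + (n + 1 : ℕ))
      simpa [belowOf, ← add_assoc] using this
  obtain ⟨x, y⟩ := z
  obtain ⟨x', y'⟩ := z'
  obtain ⟨hx, hy⟩ := Prod.mk_le_mk.1 hzz
  obtain ⟨n, rfl⟩ := Int.le.dest hx
  obtain ⟨m, rfl⟩ := Int.le.dest hy
  exact (h1 n x y).trans (h2 m _ _)

lemma le_startTime (h : IsWeightedGrowth Γ w s) {z z' : ℤ × ℤ} (hzz : z ≤ z') (hne : z ≠ z') :
    totalTime s z ≤ startTime s z' := by
  rw [startTime_eq]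
  obtain ⟨x, y⟩ := z
  obtain ⟨x', y'⟩ := z'
  obtain ⟨hx, hy⟩ := Prod.mk_le_mk.1 hzz
  by_cases hxx : x = x'
  · have : y ≠ y' := fun hyy => hne (by rw [hxx, hyy])
    exact le_max_of_le_right (h.mono (by simp only [belowOf, Prod.mk_le_mk]; omega))
  · exact le_max_of_le_left (h.mono (by simp only [leftOf, Prod.mk_le_mk]; omega))

lemma joinsFirst_iff (h : IsWeightedGrowth Γ w s) {z : ℤ × ℤ} (hz : z ∉ Γ) :
    JoinsFirst z (parentMax s z) ↔ (s z).2 < (s z).1 := by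
  have hw := h.pos z hz
  have h3 : 0 ≤ (parentMax s z).1 := le_max_of_le_left (h.nonneg _).1
  by_cases h2 : 0 < z.2
  · by_cases h1 : 0 < z.1
    · rw [h.growth.notMem z hz]
      simp [JoinsFirst, growStep, h1, h2, not_le.2 h1]
    · have h4 := h.snd_eq_zero (not_lt.1 h1)
      refine iff_of_true ⟨h2, Or.inl (not_lt.1 h1)⟩ ?_
      rw [h4, h.growth.notMem z hz]
      simp only [growStep, h2, if_true]
      linarith
  · refine iff_of_false (fun hj => h2 hj.1) ?_
    rw [h.fst_eq_zero (not_lt.1 h2)]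
    exact not_lt.2 (h.nonneg z).2

end IsWeightedGrowth

/-- Sites with the same clock lie on the same or on neighbouring diagonals, and are therefore
comparable. -/
lemma comparable_of_siteClock {s : ℤ × ℤ → ℝ × ℝ} {z z' : ℤ × ℤ}
    (hc : siteClock s z = siteClock s z') : z ≤ z' ∨ z' ≤ z := by
  obtain ⟨x, y⟩ := z
  obtain ⟨x', y'⟩ := z'
  simp only [siteClock, clockOf] at hc
  simp only [Prod.mk_le_mk]
  split_ifs at hc <;> omega


/-! ### Measurability of the growth recursion -/

section Measurability

variable {Ω : Type*} [MeasurableSpace Ω]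

lemma measurable_parentMax {s : Ω → ℤ × ℤ → ℝ × ℝ} (hs : ∀ z, Measurable fun ω => s ω z)
    (z : ℤ × ℤ) : Measurable fun ω => parentMax (s ω) z :=
  ((hs _).fst.max (hs _).fst).prodMk ((hs _).snd.max (hs _).snd)

lemma measurable_clockOf {m : Ω → ℝ × ℝ} (hm : Measurable m) (z : ℤ × ℤ) :
    Measurable fun ω => clockOf z (m ω) := by
  refine Measurable.ite ?_ measurable_const measurable_const
  exact (MeasurableSet.const _).inter
    ((MeasurableSet.const _).union (measurableSet_lt hm.snd hm.fst))

lemma measurable_siteClock {s : Ω → ℤ × ℤ → ℝ × ℝ} (hs : ∀ z, Measurable fun ω => s ω z)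
    (z : ℤ × ℤ) : Measurable fun ω => siteClock (s ω) z :=
  measurable_clockOf (measurable_parentMax hs z) z

lemma measurable_startTime {s : Ω → ℤ × ℤ → ℝ × ℝ} (hs : ∀ z, Measurable fun ω => s ω z)
    (z : ℤ × ℤ) : Measurable fun ω => startTime (s ω) z :=
  (measurable_parentMax hs z).fst.max (measurable_parentMax hs z).snd

lemma measurable_totalTime {s : Ω → ℤ × ℤ → ℝ × ℝ} (hs : ∀ z, Measurable fun ω => s ω z)
    (z : ℤ × ℤ) : Measurable fun ω => totalTime (s ω) z :=
  (hs z).fst.max (hs z).snd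

/-- Random waiting times that are measurable also at random clocks and starting times. -/
def MeasurableWait (f : Ω → ℤ × ℤ → ℤ → ℝ → ℝ) : Prop :=
  ∀ z (c : Ω → ℤ) (M : Ω → ℝ), Measurable c → Measurable M →
    Measurable fun ω => f ω z (c ω) (M ω)

lemma measurable_grow {Γ : Ω → Set (ℤ × ℤ)} (hΓ : ∀ z, MeasurableSet {ω | z ∈ Γ ω})
    {f : Ω → ℤ × ℤ → ℤ → ℝ → ℝ} (hf : MeasurableWait f) (n : ℕ) :
    ∀ z, Measurable fun ω => grow (Γ ω) (f ω) n z := by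
  induction n with
  | zero => intro z; exact measurable_const
  | succ n ih =>
    intro z
    refine Measurable.ite (hΓ z) measurable_const ?_
    have hm := measurable_parentMax ih z
    have h1 := hf z _ _ (measurable_clockOf hm z) (hm.fst.max hm.snd)
    exact (Measurable.ite (MeasurableSet.const _) (hm.fst.add h1) measurable_const).prodMk
      (Measurable.ite (MeasurableSet.const _) (hm.snd.add h1) measurable_const)

lemma measurable_growTimes {Γ : Ω → Set (ℤ × ℤ)} (hΓ : ∀ z, MeasurableSet {ω | z ∈ Γ ω})
    {f : Ω → ℤ × ℤ → ℤ → ℝ → ℝ} (hf : MeasurableWait f) (z : ℤ × ℤ) :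
    Measurable fun ω => growTimes (Γ ω) (f ω) z := by
  have hd : Measurable fun ω => depth (Γ ω) z :=
    measurable_sInf_nat fun n => (hΓ _).inter (hΓ _)
  exact measurable_eval_countable (a := fun ω n => grow (Γ ω) (f ω) (2 * n) z)
    (measurable_pi_lambda _ fun n => measurable_grow hΓ hf _ z) hd

end Measurability

/-! ### Growth driven by clocks -/

/-- The waiting time for the next ring of the clock. -/
def clockWait (a : ℤ → ℕ → ℝ) : ℤ × ℤ → ℤ → ℝ → ℝ := fun _ c M => residual M (a c) 0

/-- The pair `(G¹, G²)` of the growth process in which every site is added at the first ring of its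
clock after its parents are present. -/
def clockTimes (Γ : Set (ℤ × ℤ)) (a : ℤ → ℕ → ℝ) : ℤ × ℤ → ℝ × ℝ := growTimes Γ (clockWait a)

/-- The pair `(G¹, G²)` of the growth process with the weights `h`. -/
def weightTimes (Γ : Set (ℤ × ℤ)) (h : ℤ × ℤ → ℝ) : ℤ × ℤ → ℝ × ℝ :=
  growTimes Γ fun z _ _ => h z

/-- The weights that the clocks `a` induce off `Γ`; on `Γ`, where no clock is involved, the
weights are taken from the auxiliary family `h`. -/
def clockWeight (Γ : Set (ℤ × ℤ)) (h : ℤ × ℤ → ℝ) (a : ℤ → ℕ → ℝ) (z : ℤ × ℤ) : ℝ :=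
  if z ∈ Γ then h z else
    residual (startTime (clockTimes Γ a) z) (a (siteClock (clockTimes Γ a) z)) 0

lemma measurableWait_clockWait {Ω : Type*} [MeasurableSpace Ω] {a : Ω → ℤ → ℕ → ℝ}
    (ha : Measurable a) : MeasurableWait fun ω => clockWait (a ω) := fun _ _ _ hc hM =>
  (measurable_pi_apply 0).comp
    (measurable_residual.comp (hM.prodMk (measurable_eval_countable ha hc)))

lemma measurableWait_weight {Ω : Type*} [MeasurableSpace Ω] {h : Ω → ℤ × ℤ → ℝ}
    (hh : Measurable h) : MeasurableWait fun ω => fun z (_ : ℤ) (_ : ℝ) => h ω z :=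
  fun z _ _ _ _ => (measurable_pi_apply z).comp hh

lemma measurable_clockTimes {Ω : Type*} [MeasurableSpace Ω] {Γ : Ω → Set (ℤ × ℤ)}
    (hΓ : ∀ z, MeasurableSet {ω | z ∈ Γ ω}) {a : Ω → ℤ → ℕ → ℝ} (ha : Measurable a) (z : ℤ × ℤ) :
    Measurable fun ω => clockTimes (Γ ω) (a ω) z :=
  measurable_growTimes hΓ (measurableWait_clockWait ha) z

lemma measurable_clockWeight {Ω : Type*} [MeasurableSpace Ω] {Γ : Ω → Set (ℤ × ℤ)}
    (hΓ : ∀ z, MeasurableSet {ω | z ∈ Γ ω}) {a : Ω → ℤ → ℕ → ℝ} (ha : Measurable a)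
    {h : Ω → ℤ × ℤ → ℝ} (hh : Measurable h) (z : ℤ × ℤ) :
    Measurable fun ω => clockWeight (Γ ω) (h ω) (a ω) z := by
  refine Measurable.ite (hΓ z) ((measurable_pi_apply z).comp hh) ?_
  have hs := measurable_clockTimes hΓ ha
  exact measurableWait_clockWait ha z _ _ (measurable_siteClock hs z) (measurable_startTime hs z)

lemma isWeightedGrowth_clockTimes {Γ : Set (ℤ × ℤ)} (hΓ : IsCornerSet Γ) (h : ℤ × ℤ → ℝ)
    {a : ℤ → ℕ → ℝ} (ha : ∀ x, IsRegular (a x)) :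
    IsWeightedGrowth Γ (clockWeight Γ h a) (clockTimes Γ a) where
  corner := hΓ
  growth := by
    have hg := hΓ.isGrowth_growTimes (clockWait a)
    refine ⟨hg.mem, fun z hz => (hg.notMem z hz).trans ?_⟩
    simp only [growStep, clockWeight, if_neg hz]
    rfl
  pos z hz := by
    simp only [clockWeight, if_neg hz]
    exact ((ha _).residual _).pos 0

/-- A solution of the recursion is determined on a set of sites by the waiting times there, if
the set contains the parents of its sites. -/
lemma growth_congr {Γ : Set (ℤ × ℤ)} (hΓ : IsCornerSet Γ) {f f' : ℤ × ℤ → ℤ → ℝ → ℝ}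
    {s s' : ℤ × ℤ → ℝ × ℝ} (hs : IsGrowth Γ f s) (hs' : IsGrowth Γ f' s') {A : Set (ℤ × ℤ)}
    (hA : ∀ z ∈ A, (leftOf z ∈ Γ ∨ leftOf z ∈ A) ∧ (belowOf z ∈ Γ ∨ belowOf z ∈ A))
    (hf : ∀ z ∈ A, z ∉ Γ → f z (siteClock s z) (startTime s z) =
      f' z (siteClock s z) (startTime s z)) (z : ℤ × ℤ) (hz : z ∈ Γ ∨ z ∈ A) : s z = s' z := by
  revert hz
  refine hΓ.site_induction (P := fun z => z ∈ Γ ∨ z ∈ A → s z = s' z) ?_ ?_ z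
  · intro z hz _
    rw [hs.mem z hz, hs'.mem z hz]
  · intro z hz h1 h2 hzA
    have hzA : z ∈ A := hzA.resolve_left hz
    have hp : parentMax s z = parentMax s' z :=
      parentMax_congr (h1 (hA z hzA).1) (h2 (hA z hzA).2)
    have := hf z hzA hz
    rw [hs.notMem z hz, hs'.notMem z hz, ← hp]
    simp only [siteClock, startTime] at this
    simp only [growStep, this]

/-! ### The law of the induced weights -/

/-- The time up to which the clock `x` has been explored, after the sites in `A`. -/
def exploredTime (A : Finset (ℤ × ℤ)) (s : ℤ × ℤ → ℝ × ℝ) (x : ℤ) : ℝ :=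
  A.fold max 0 fun z => if siteClock s z = x then totalTime s z else 0

/-- The exploration after the sites in `A`: the weights found there (and the auxiliary weights
elsewhere), together with the unexplored parts of the clocks. Each clock is known up to the last
time at which it has been used, and the rest of it is a fresh Poisson process. -/
def explore (Γ : Set (ℤ × ℤ)) (A : Finset (ℤ × ℤ)) (p : (ℤ × ℤ → ℝ) × (ℤ → ℕ → ℝ)) :
    (ℤ × ℤ → ℝ) × (ℤ → ℕ → ℝ) :=
  (fun z => if z ∈ A then clockWeight Γ p.1 p.2 z else p.1 z,
    fun x => residual (exploredTime A (clockTimes Γ p.2) x) (p.2 x))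

/-- How long the unexplored part of the clock of `z` has to run until the parents of `z` are
present, as a function of the weights on the set `A` of the explored sites. -/
def waitBefore (Γ : Set (ℤ × ℤ)) (A : Finset (ℤ × ℤ)) (z : ℤ × ℤ) (h : ℤ × ℤ → ℝ) : ℝ :=
  max 0 (startTime (weightTimes Γ h) z -
    exploredTime A (weightTimes Γ h) (siteClock (weightTimes Γ h) z))

/-- The exploration of one more site `z` after those in `A`. -/
def exploreStep (Γ : Set (ℤ × ℤ)) (A : Finset (ℤ × ℤ)) (z : ℤ × ℤ)
    (p : (ℤ × ℤ → ℝ) × (ℤ → ℕ → ℝ)) : (ℤ × ℤ → ℝ) × (ℤ → ℕ → ℝ) :=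
  (Function.update p.1 z
      (residual (waitBefore Γ A z p.1) (p.2 (siteClock (weightTimes Γ p.1) z)) 0),
    Function.update p.2 (siteClock (weightTimes Γ p.1) z) fun n =>
      residual (waitBefore Γ A z p.1) (p.2 (siteClock (weightTimes Γ p.1) z)) (n + 1))

lemma measurable_exploredTime {Ω : Type*} [MeasurableSpace Ω] {s : Ω → ℤ × ℤ → ℝ × ℝ}
    (hs : ∀ z, Measurable fun ω => s ω z) {c : Ω → ℤ} (hc : Measurable c)
    (A : Finset (ℤ × ℤ)) : Measurable fun ω => exploredTime A (s ω) (c ω) := by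
  unfold exploredTime
  induction A using Finset.induction_on with
  | empty => simp
  | insert z A hz ih =>
    simp only [Finset.fold_insert hz]
    exact (Measurable.ite (measurableSet_eq_fun (measurable_siteClock hs z) hc)
      (measurable_totalTime hs z) measurable_const).max ih

lemma measurePreserving_exploreStep (Γ : Set (ℤ × ℤ)) (A : Finset (ℤ × ℤ)) (z : ℤ × ℤ) :
    MeasurePreserving (exploreStep Γ A z) ((expProduct (ℤ × ℤ)).prod clockMeasure)
      ((expProduct (ℤ × ℤ)).prod clockMeasure) := by
  have hs : ∀ z, Measurable fun h : ℤ × ℤ → ℝ => weightTimes Γ h z := fun z =>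
    measurable_growTimes (fun _ => MeasurableSet.const _) (measurableWait_weight measurable_id) z
  have hc := measurable_siteClock hs z
  have hu : Measurable (waitBefore Γ A z) :=
    measurable_const.max ((measurable_startTime hs z).sub (measurable_exploredTime hs hc A))
  have hr : Measurable fun p : (ℤ × ℤ → ℝ) × (ℤ → ℕ → ℝ) =>
      residual (waitBefore Γ A z p.1) (p.2 (siteClock (weightTimes Γ p.1) z)) :=
    measurable_residual.comp ((hu.comp measurable_fst).prodMk
      (measurable_eval_countable measurable_snd (hc.comp measurable_fst)))
  have hg : Measurable (Function.uncurry fun (h : ℤ × ℤ → ℝ) (a : ℤ → ℕ → ℝ) =>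
      (residual (waitBefore Γ A z h) (a (siteClock (weightTimes Γ h) z)) 0,
        Function.update a (siteClock (weightTimes Γ h) z) fun n =>
          residual (waitBefore Γ A z h) (a (siteClock (weightTimes Γ h) z)) (n + 1))) := by
    refine ((measurable_pi_apply 0).comp hr).prodMk (measurable_pi_lambda _ fun x => ?_)
    simp only [Function.update_apply]
    refine Measurable.ite (measurableSet_eq_fun measurable_const (hc.comp measurable_fst)) ?_
      ((measurable_pi_apply x).comp measurable_snd)
    exact measurable_pi_lambda _ fun n => (measurable_pi_apply (n + 1)).comp hr
  have h1 := (MeasurePreserving.id (expProduct (ℤ × ℤ))).skew_product hg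
    (ae_of_all _ fun h => (measurePreserving_ring (siteClock (weightTimes Γ h) z)
      (le_max_left 0 _ : 0 ≤ waitBefore Γ A z h)).map_eq)
  have hU : MeasurePreserving _ _ (expProduct (ℤ × ℤ)) :=
    measurePreserving_update (ι := ℤ × ℤ) (expMeasure 1) z
  have h2 := MeasurePreserving.symm _
    (measurePreserving_prodAssoc (expProduct (ℤ × ℤ)) (expMeasure 1) clockMeasure)
  exact (hU.prod (MeasurePreserving.id clockMeasure)).comp (h2.comp h1)

/-- Finite sets of sites off `Γ` that contain the parents of their members. -/
def IsAncestral (Γ : Set (ℤ × ℤ)) (A : Finset (ℤ × ℤ)) : Prop :=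
  ∀ z ∈ A, z ∉ Γ ∧ (leftOf z ∈ Γ ∨ leftOf z ∈ A) ∧ (belowOf z ∈ Γ ∨ belowOf z ∈ A)

lemma IsAncestral.union {Γ : Set (ℤ × ℤ)} {A B : Finset (ℤ × ℤ)} (hA : IsAncestral Γ A)
    (hB : IsAncestral Γ B) : IsAncestral Γ (A ∪ B) := by
  intro z hz
  simp only [Finset.mem_union] at hz ⊢
  rcases hz with hz | hz
  · obtain ⟨h0, h1, h2⟩ := hA z hz
    tauto
  · obtain ⟨h0, h1, h2⟩ := hB z hz
    tauto

lemma exists_isAncestral {Γ : Set (ℤ × ℤ)} (hΓ : IsCornerSet Γ) (S : Finset (ℤ × ℤ)) :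
    ∃ A, IsAncestral Γ A ∧ ∀ z ∈ S, z ∈ Γ ∨ z ∈ A := by
  have h1 : ∀ z, ∃ A, IsAncestral Γ A ∧ (z ∈ Γ ∨ z ∈ A) := by
    refine hΓ.site_induction ?_ ?_
    · exact fun z hz => ⟨∅, by simp [IsAncestral], Or.inl hz⟩
    · rintro z hz ⟨A, hA, hA'⟩ ⟨B, hB, hB'⟩
      refine ⟨insert z (A ∪ B), ?_, Or.inr (Finset.mem_insert_self _ _)⟩
      intro z' hz'
      rcases Finset.mem_insert.1 hz' with rfl | hz'
      · simp only [Finset.mem_insert, Finset.mem_union]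
        tauto
      · obtain ⟨h0, h1, h2⟩ := hA.union hB z' hz'
        simp only [Finset.mem_insert]
        tauto
  induction S using Finset.induction_on with
  | empty => exact ⟨∅, by simp [IsAncestral], by simp⟩
  | insert z S hz ih =>
    obtain ⟨A, hA, hA'⟩ := ih
    obtain ⟨B, hB, hB'⟩ := h1 z
    refine ⟨A ∪ B, hA.union hB, fun z' hz' => ?_⟩
    rw [Finset.mem_union]
    rcases Finset.mem_insert.1 hz' with rfl | hz'
    · tauto
    · have := hA' z' hz'
      tauto

lemma exploredTime_le {A : Finset (ℤ × ℤ)} {s : ℤ × ℤ → ℝ × ℝ} {x : ℤ} {T : ℝ} (hT : 0 ≤ T)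
    (h : ∀ z ∈ A, siteClock s z = x → totalTime s z ≤ T) : exploredTime A s x ≤ T := by
  refine (Finset.fold_max_le _).2 ⟨hT, fun z hz => ?_⟩
  split_ifs with hx
  · exact h z hz hx
  · exact hT

/-- Exploring a site that is not below any explored one, when its parents are explored. -/
lemma explore_insert {Γ : Set (ℤ × ℤ)} (hΓ : IsCornerSet Γ) {A : Finset (ℤ × ℤ)}
    (hA : IsAncestral Γ A) {z : ℤ × ℤ} (hz : IsAncestral Γ (insert z A))
    (hmax : ∀ z' ∈ A, ¬ z ≤ z') {h : ℤ × ℤ → ℝ} {a : ℤ → ℕ → ℝ} (ha : ∀ x, IsRegular (a x)) :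
    explore Γ (insert z A) (h, a) = exploreStep Γ A z (explore Γ A (h, a)) := by
  have hzA : z ∉ A := fun hzA => hmax z hzA le_rfl
  obtain ⟨hzΓ, hleft, hbelow⟩ := hz z (Finset.mem_insert_self _ _)
  have hg := isWeightedGrowth_clockTimes hΓ h ha
  set s := clockTimes Γ a with hs
  set h' := (explore Γ A (h, a)).1 with hh'
  -- the weights found so far determine the growth process on the explored sites
  have hss : ∀ z', z' ∈ Γ ∨ z' ∈ A → s z' = weightTimes Γ h' z' := by
    refine growth_congr hΓ hg.growth (hΓ.isGrowth_growTimes _) (A := ↑A)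
      (fun z' hz' => (hA z' hz').2) fun z' hz' _ => ?_
    have : z' ∈ A := hz'
    simp [hh', explore, this]
  have hpm : ∀ z', (leftOf z' ∈ Γ ∨ leftOf z' ∈ A) → (belowOf z' ∈ Γ ∨ belowOf z' ∈ A) →
      parentMax (weightTimes Γ h') z' = parentMax s z' := fun z' h1 h2 =>
    parentMax_congr (hss _ h1).symm (hss _ h2).symm
  have hleft : leftOf z ∈ Γ ∨ leftOf z ∈ A := by
    refine hleft.imp_right fun h1 => (Finset.mem_insert.1 h1).resolve_left fun h2 => ?_
    have := congrArg Prod.fst h2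
    simp [leftOf] at this
  have hbelow : belowOf z ∈ Γ ∨ belowOf z ∈ A := by
    refine hbelow.imp_right fun h1 => (Finset.mem_insert.1 h1).resolve_left fun h2 => ?_
    have := congrArg Prod.snd h2
    simp [belowOf] at this
  have hpz := hpm z hleft hbelow
  have hclock : siteClock (weightTimes Γ h') z = siteClock s z := by simp [siteClock, hpz]
  have hstart : startTime (weightTimes Γ h') z = startTime s z := by simp [startTime, hpz]
  have hexp : ∀ x, exploredTime A (weightTimes Γ h') x = exploredTime A s x := by
    intro x
    refine Finset.fold_congr fun z' hz' => ?_
    obtain ⟨-, h1, h2⟩ := hA z' hz'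
    simp [siteClock, hpm z' h1 h2, totalTime, hss z' (Or.inr hz')]
  have hstart0 : 0 ≤ startTime s z := by
    rw [startTime_eq]; exact le_max_of_le_left (hg.totalTime_nonneg _)
  have hle : exploredTime A s (siteClock s z) ≤ startTime s z := by
    refine exploredTime_le hstart0 fun z' hz' hc => ?_
    refine hg.le_startTime ((comparable_of_siteClock hc).resolve_right (hmax z' hz')) ?_
    exact ne_of_mem_of_not_mem hz' hzA
  have hwait : waitBefore Γ A z h' = startTime s z - exploredTime A s (siteClock s z) := by
    rw [waitBefore, hstart, hclock, hexp, max_eq_right (by linarith)]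
  have hres : residual (waitBefore Γ A z h') ((explore Γ A (h, a)).2 (siteClock s z)) =
      residual (startTime s z) (a (siteClock s z)) := by
    rw [hwait]
    simp only [explore]
    rw [residual_residual (ha _) _ (by linarith)]
    congr 1
    ring
  have htotal : totalTime s z = startTime s z + residual (startTime s z) (a (siteClock s z)) 0 := by
    rw [hg.totalTime_eq hzΓ]; simp [clockWeight, hzΓ, hs]
  unfold exploreStep
  rw [← hh', hclock, hres]
  refine Prod.ext (funext fun z' => ?_) (funext fun x => ?_)
  · by_cases hzz : z' = z
    · subst hzz
      simp [explore, clockWeight, hzΓ, ← hs]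
    · simp [explore, hh', hzz]
  · by_cases hx : x = siteClock s z
    · subst hx
      dsimp only
      rw [Function.update_self, ← residual_arrival (ha _), ← htotal]
      simp only [explore, exploredTime, Finset.fold_insert hzA, ← hs, if_true]
      rw [max_eq_left]
      exact hle.trans (hg.startTime_lt hzΓ).le
    · dsimp only
      rw [Function.update_of_ne hx]
      simp only [explore, exploredTime, Finset.fold_insert hzA, ← hs]
      rw [if_neg (Ne.symm hx), max_eq_right]
      exact (Finset.le_fold_max _).2 (Or.inl le_rfl)

/-- The exploration preserves the law: the weights found are fresh, and so are the unexplored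
parts of the clocks. -/
lemma exists_measurePreserving_explore {Γ : Set (ℤ × ℤ)} (hΓ : IsCornerSet Γ)
    (A : Finset (ℤ × ℤ)) (hA : IsAncestral Γ A) :
    ∃ F, MeasurePreserving F ((expProduct (ℤ × ℤ)).prod clockMeasure)
        ((expProduct (ℤ × ℤ)).prod clockMeasure) ∧
      ∀ᵐ p ∂(expProduct (ℤ × ℤ)).prod clockMeasure, F p = explore Γ A p := by
  have hreg : ∀ᵐ p ∂(expProduct (ℤ × ℤ)).prod clockMeasure, ∀ x, IsRegular (p.2 x) :=
    Measure.quasiMeasurePreserving_snd.ae ae_clock_isRegular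
  induction A using Finset.strongInduction with
  | H A ih =>
    rcases A.eq_empty_or_nonempty with rfl | hne
    · refine ⟨id, MeasurePreserving.id _, ?_⟩
      filter_upwards [hreg] with p hp
      refine Prod.ext (by simp [explore]) (funext fun x => ?_)
      simp [explore, exploredTime, residual_zero_time (hp x)]
    · obtain ⟨z, hzA, hz⟩ := A.exists_maximal hne
      have hmax : ∀ z' ∈ A.erase z, ¬ z ≤ z' := fun z' hz' hle =>
        Finset.ne_of_mem_erase hz' (le_antisymm (hz (Finset.mem_of_mem_erase hz') hle) hle)
      have hA' : IsAncestral Γ (A.erase z) := by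
        intro z' hz'
        obtain ⟨h0, h1, h2⟩ := hA z' (Finset.mem_of_mem_erase hz')
        refine ⟨h0, h1.imp_right fun h => Finset.mem_erase.2 ⟨fun he => ?_, h⟩,
          h2.imp_right fun h => Finset.mem_erase.2 ⟨fun he => ?_, h⟩⟩
        · exact hmax z' hz' (he ▸ by simp [leftOf, Prod.le_def])
        · exact hmax z' hz' (he ▸ by simp [belowOf, Prod.le_def])
      obtain ⟨F, hF, hFA⟩ := ih _ (Finset.erase_ssubset hzA) hA'
      refine ⟨_, (measurePreserving_exploreStep Γ (A.erase z) z).comp hF, ?_⟩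
      filter_upwards [hreg, hFA] with p hp hpA
      have := explore_insert hΓ hA' (z := z) (by rwa [Finset.insert_erase hzA]) hmax (h := p.1) hp
      rw [Finset.insert_erase hzA] at this
      rw [Function.comp, hpA]
      exact this.symm

/-- The weights induced by the clocks are i.i.d. exponential. -/
lemma map_clockWeight {Γ : Set (ℤ × ℤ)} (hΓ : IsCornerSet Γ) :
    ((expProduct (ℤ × ℤ)).prod clockMeasure).map (fun p => clockWeight Γ p.1 p.2) =
      expProduct (ℤ × ℤ) := by
  have hm : Measurable fun p : (ℤ × ℤ → ℝ) × (ℤ → ℕ → ℝ) => clockWeight Γ p.1 p.2 :=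
    measurable_pi_lambda _ fun z =>
      measurable_clockWeight (fun _ => MeasurableSet.const _) measurable_snd measurable_fst z
  refine Measure.eq_infinitePi _ fun S t ht => ?_
  have hpi : MeasurableSet (Set.pi (S : Set (ℤ × ℤ)) t) :=
    MeasurableSet.pi S.countable_toSet fun i _ => ht i
  rw [Measure.map_apply hm hpi]
  obtain ⟨A, hA, hSA⟩ := exists_isAncestral hΓ S
  obtain ⟨F, hF, hFA⟩ := exists_measurePreserving_explore hΓ A hA
  have h1 : MeasurePreserving (fun p => (F p).1) ((expProduct (ℤ × ℤ)).prod clockMeasure)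
      (expProduct (ℤ × ℤ)) := measurePreserving_fst.comp hF
  rw [← Measure.infinitePi_pi (fun _ : ℤ × ℤ => expMeasure 1) fun i _ => ht i,
    ← h1.measure_preimage hpi.nullMeasurableSet]
  refine measure_congr ?_
  filter_upwards [hFA] with p hp
  refine propext (forall₂_congr fun z hz => ?_)
  have : (F p).1 z = clockWeight Γ p.1 p.2 z := by
    rw [hp]
    rcases hSA z hz with h2 | h2
    · simp [explore, clockWeight, h2]
    · simp [explore, h2]
  dsimp only
  rw [this]

/-! ### Last-passage times satisfy the growth recursion -/

lemma isStep_iff {a b : ℤ × ℤ} : IsStep a b ↔ a = leftOf b ∨ a = belowOf b := by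
  obtain ⟨x, y⟩ := a
  obtain ⟨x', y'⟩ := b
  simp only [IsStep, leftOf, belowOf, Prod.mk_add_mk, Prod.mk.injEq]
  omega

lemma leftOf_le (z : ℤ × ℤ) : leftOf z ≤ z := by simp [leftOf, Prod.le_def]

lemma belowOf_le (z : ℤ × ℤ) : belowOf z ≤ z := by simp [belowOf, Prod.le_def]

lemma le_leftOf_or_le_belowOf {a z : ℤ × ℤ} (h : a ≤ z) (hne : a ≠ z) :
    a ≤ leftOf z ∨ a ≤ belowOf z := by
  obtain ⟨x, y⟩ := a
  obtain ⟨x', y'⟩ := z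
  simp only [leftOf, belowOf, Prod.mk_le_mk, ne_eq, Prod.mk.injEq] at *
  omega

lemma append_mem_directedPaths {a y z : ℤ × ℤ} {q : List (ℤ × ℤ)} (hq : q ∈ directedPaths a y)
    (hy : IsStep y z) : q ++ [z] ∈ directedPaths a z := by
  obtain ⟨h1, h2, h3⟩ := hq
  refine ⟨List.isChain_append.2 ⟨h1, List.isChain_singleton _, ?_⟩, ?_, by simp⟩
  · intro x hx x' hx'
    rw [h3] at hx
    simp only [Option.mem_def, Option.some.injEq, List.head?_cons] at hx hx'
    rwa [← hx, ← hx']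
  · rw [List.head?_append, h2]
    rfl

lemma mem_directedPaths_cases {a z : ℤ × ℤ} {p : List (ℤ × ℤ)} (hp : p ∈ directedPaths a z) :
    (a = z ∧ p = [z]) ∨ ∃ q, p = q ++ [z] ∧
      (q ∈ directedPaths a (leftOf z) ∨ q ∈ directedPaths a (belowOf z)) := by
  obtain ⟨h1, h2, h3⟩ := hp
  obtain ⟨q, rfl⟩ : ∃ q, p = q ++ [z] := ⟨p.dropLast, by
    rw [List.dropLast_append_getLast? z h3]⟩
  rcases List.eq_nil_or_concat q with rfl | ⟨r, y, hq⟩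
  · left
    simpa [eq_comm] using h2
  · right
    rw [List.concat_eq_append] at hq
    subst hq
    refine ⟨r ++ [y], rfl, ?_⟩
    obtain ⟨h4, -, h5⟩ := List.isChain_append.1 h1
    have hy : IsStep y z := h5 y (by simp) z (by simp)
    have h6 : r ++ [y] ∈ directedPaths a y := by
      refine ⟨h4, ?_, by simp⟩
      rw [List.head?_append_of_ne_nil _ (by simp)] at h2
      exact h2
    rcases isStep_iff.1 hy with rfl | rfl
    · exact Or.inl h6
    · exact Or.inr h6

lemma le_of_mem_directedPaths {a z : ℤ × ℤ} {p : List (ℤ × ℤ)} (hp : p ∈ directedPaths a z) :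
    a ≤ z := by
  induction p using List.reverseRecOn generalizing z with
  | nil => simp [directedPaths] at hp
  | append_singleton p y ih =>
    rcases mem_directedPaths_cases hp with ⟨h, -⟩ | ⟨q, h, hq⟩
    · exact h.le
    · obtain ⟨rfl, -⟩ := List.append_inj' h rfl
      rcases hq with hq | hq
      · exact (ih hq).trans (leftOf_le z)
      · exact (ih hq).trans (belowOf_le z)

/-- Induction on the sites `z ≥ a`. -/
lemma induction_above {a : ℤ × ℤ} {P : ℤ × ℤ → Prop}
    (step : ∀ z, a ≤ z → (a ≤ leftOf z → P (leftOf z)) → (a ≤ belowOf z → P (belowOf z)) → P z)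
    (z : ℤ × ℤ) (hz : a ≤ z) : P z := by
  have key : ∀ n : ℕ, ∀ z : ℤ × ℤ, a ≤ z → (z.1 - a.1) + (z.2 - a.2) < n → P z := by
    intro n
    induction n with
    | zero =>
      intro z hz h
      have := hz.1
      have := hz.2
      push_cast at h
      omega
    | succ n ih =>
      intro z hz h
      push_cast at h
      refine step z hz (fun h' => ih _ h' ?_) (fun h' => ih _ h' ?_)
      · simp only [leftOf]; omega
      · simp only [belowOf]; omega
  exact key ((z.1 - a.1) + (z.2 - a.2) + 1).toNat z hz (by omega)

lemma directedPaths_nonempty {a z : ℤ × ℤ} (h : a ≤ z) : (directedPaths a z).Nonempty := by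
  refine induction_above (P := fun z => (directedPaths a z).Nonempty) ?_ z h
  intro z hz h1 h2
  by_cases hne : a = z
  · subst hne
    exact ⟨[a], by simp [directedPaths]⟩
  rcases le_leftOf_or_le_belowOf hz hne with h3 | h3
  · obtain ⟨q, hq⟩ := h1 h3
    exact ⟨_, append_mem_directedPaths hq (isStep_iff.2 (Or.inl rfl))⟩
  · obtain ⟨q, hq⟩ := h2 h3
    exact ⟨_, append_mem_directedPaths hq (isStep_iff.2 (Or.inr rfl))⟩

lemma finite_directedPaths (a z : ℤ × ℤ) : (directedPaths a z).Finite := by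
  have hempty : ∀ z, ¬ a ≤ z → (directedPaths a z).Finite := fun z hz => by
    have : directedPaths a z = ∅ :=
      Set.eq_empty_of_forall_notMem fun p hp => hz (le_of_mem_directedPaths hp)
    simp [this]
  by_cases h : a ≤ z
  swap
  · exact hempty z h
  refine induction_above (P := fun z => (directedPaths a z).Finite) ?_ z h
  intro z hz h1 h2
  have h1' : (directedPaths a (leftOf z)).Finite := by
    by_cases h : a ≤ leftOf z
    exacts [h1 h, hempty _ h]
  have h2' : (directedPaths a (belowOf z)).Finite := by
    by_cases h : a ≤ belowOf z
    exacts [h2 h, hempty _ h]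
  refine (((h1'.union h2').image (fun q => q ++ [z])).union (Set.finite_singleton [z])).subset ?_
  intro p hp
  rcases mem_directedPaths_cases hp with ⟨-, rfl⟩ | ⟨q, rfl, hq⟩
  · exact Or.inr rfl
  · exact Or.inl ⟨q, hq, rfl⟩

section PassageTime

variable {w : ℤ × ℤ → ℝ}

lemma passageTime_of_not_le {a z : ℤ × ℤ} (h : ¬ a ≤ z) : passageTime w a z = 0 := by
  have : directedPaths a z = ∅ :=
    Set.eq_empty_of_forall_notMem fun p hp => h (le_of_mem_directedPaths hp)
  simp [passageTime, this]

lemma sum_le_passageTime {a z : ℤ × ℤ} {p : List (ℤ × ℤ)} (hp : p ∈ directedPaths a z) :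
    (p.map w).sum ≤ passageTime w a z :=
  le_csSup ((finite_directedPaths a z).image _).bddAbove ⟨p, hp, rfl⟩

lemma exists_sum_eq_passageTime {a z : ℤ × ℤ} (h : a ≤ z) :
    ∃ p ∈ directedPaths a z, (p.map w).sum = passageTime w a z :=
  ((directedPaths_nonempty h).image _).csSup_mem ((finite_directedPaths a z).image _)

lemma passageTime_nonneg (hw : ∀ z, 0 ≤ w z) (a z : ℤ × ℤ) : 0 ≤ passageTime w a z := by
  refine Real.sSup_nonneg ?_
  rintro _ ⟨p, -, rfl⟩
  refine List.sum_nonneg fun x hx => ?_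
  obtain ⟨y, -, rfl⟩ := List.mem_map.1 hx
  exact hw y

lemma add_passageTime_le {a y z : ℤ × ℤ} (hay : a ≤ y) (hy : IsStep y z) :
    w z + passageTime w a y ≤ passageTime w a z := by
  obtain ⟨p, hp, hp'⟩ := exists_sum_eq_passageTime (w := w) hay
  have := sum_le_passageTime (w := w) (append_mem_directedPaths hp hy)
  simp only [List.map_append, List.sum_append, List.map_cons, List.map_nil, List.sum_singleton]
    at this
  linarith

lemma le_passageTime (hw : ∀ z, 0 ≤ w z) {a z : ℤ × ℤ} (h : a ≤ z) : w z ≤ passageTime w a z := by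
  by_cases hne : a = z
  · subst hne
    have : [a] ∈ directedPaths a a := by simp [directedPaths]
    simpa using sum_le_passageTime (w := w) this
  · rcases le_leftOf_or_le_belowOf h hne with h3 | h3
    · have := add_passageTime_le (w := w) h3 (isStep_iff.2 (Or.inl rfl))
      linarith [passageTime_nonneg hw a (leftOf z)]
    · have := add_passageTime_le (w := w) h3 (isStep_iff.2 (Or.inr rfl))
      linarith [passageTime_nonneg hw a (belowOf z)]

lemma passageTime_le (hw : ∀ z, 0 ≤ w z) {a z : ℤ × ℤ} :
    passageTime w a z ≤
      w z + max (passageTime w a (leftOf z)) (passageTime w a (belowOf z)) := by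
  have hmax : 0 ≤ max (passageTime w a (leftOf z)) (passageTime w a (belowOf z)) :=
    le_max_of_le_left (passageTime_nonneg hw _ _)
  refine Real.sSup_le ?_ (add_nonneg (hw z) hmax)
  rintro _ ⟨p, hp, rfl⟩
  rcases mem_directedPaths_cases hp with ⟨-, rfl⟩ | ⟨q, rfl, hq⟩
  · simpa using hmax
  · simp only [List.map_append, List.sum_append, List.map_cons, List.map_nil, List.sum_singleton]
    rw [add_comm]
    gcongr
    rcases hq with hq | hq
    · exact le_max_of_le_left (sum_le_passageTime hq)
    · exact le_max_of_le_right (sum_le_passageTime hq)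

/-- The recursion for the last-passage time from a finite set of starting points, of which those
in `K₁` and `K₂` are relevant for the two parents. -/
lemma sSup_passageTime (hw : ∀ z, 0 ≤ w z) {z : ℤ × ℤ} (st : ℤ → ℤ × ℤ) {K K₁ K₂ : Set ℤ}
    (hK : K.Finite) (h₁ : K₁ ⊆ K) (h₂ : K₂ ⊆ K)
    (h₁' : ∀ k ∈ K, k ∉ K₁ → ¬ st k ≤ leftOf z) (h₂' : ∀ k ∈ K, k ∉ K₂ → ¬ st k ≤ belowOf z)
    (hz : ∃ k ∈ K, st k ≤ z) :
    sSup ((fun k => passageTime w (st k) z) '' K) =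
      max (sSup ((fun k => passageTime w (st k) (leftOf z)) '' K₁))
        (sSup ((fun k => passageTime w (st k) (belowOf z)) '' K₂)) + w z := by
  have hle : ∀ {L : Set ℤ} (_ : L ⊆ K) (y : ℤ × ℤ), ∀ k ∈ L, passageTime w (st k) y ≤
      sSup ((fun k => passageTime w (st k) y) '' L) := fun hL y k hk =>
    le_csSup ((hK.subset hL).image _).bddAbove ⟨k, hk, rfl⟩
  have hnonneg : ∀ (L : Set ℤ) (y : ℤ × ℤ),
      0 ≤ sSup ((fun k => passageTime w (st k) y) '' L) := fun L y => by
    refine Real.sSup_nonneg ?_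
    rintro _ ⟨k, -, rfl⟩
    exact passageTime_nonneg hw _ _
  have hwz : w z ≤ sSup ((fun k => passageTime w (st k) z) '' K) := by
    obtain ⟨k, hk, hkz⟩ := hz
    exact (le_passageTime hw hkz).trans (hle subset_rfl z k hk)
  have hlow : ∀ {L : Set ℤ} (_ : L ⊆ K) (y : ℤ × ℤ), IsStep y z →
      sSup ((fun k => passageTime w (st k) y) '' L) + w z ≤
        sSup ((fun k => passageTime w (st k) z) '' K) := by
    intro L hL y hy
    rw [← le_sub_iff_add_le]
    refine Real.sSup_le ?_ (by linarith)
    rintro _ ⟨k, hk, rfl⟩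
    by_cases hky : st k ≤ y
    · have := add_passageTime_le (w := w) hky hy
      have := hle subset_rfl z k (hL hk)
      dsimp only
      linarith
    · dsimp only
      rw [passageTime_of_not_le hky]
      linarith
  refine le_antisymm ?_ ?_
  · refine Real.sSup_le ?_ (add_nonneg (le_max_of_le_left (hnonneg _ _)) (hw z))
    rintro _ ⟨k, hk, rfl⟩
    refine (passageTime_le hw).trans ?_
    rw [add_comm]
    gcongr
    · by_cases hk1 : k ∈ K₁
      · exact hle h₁ _ k hk1
      · rw [passageTime_of_not_le (h₁' k hk hk1)]
        exact hnonneg _ _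
    · by_cases hk2 : k ∈ K₂
      · exact hle h₂ _ k hk2
      · rw [passageTime_of_not_le (h₂' k hk hk2)]
        exact hnonneg _ _
  · rw [← max_add_add_right]
    exact max_le (hlow h₁ _ (isStep_iff.2 (Or.inl rfl))) (hlow h₂ _ (isStep_iff.2 (Or.inr rfl)))

end PassageTime

section Corners

variable {Γ : Set (ℤ × ℤ)}

lemma alpha_lt_iff (hΓ : IsCornerSet Γ) {k : ℤ} (hk : 0 < k) (x : ℤ) :
    alpha Γ k < x ↔ (x, k) ∉ Γ := by
  have hb : BddAbove {m : ℤ | (m, k) ∈ Γ} :=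
    ⟨0, fun m hm => by by_contra h; exact hΓ.notMem_of_up (by simp; omega) hk hm⟩
  have hmem : alpha Γ k ∈ {m : ℤ | (m, k) ∈ Γ} := Int.csSup_mem (hΓ.row k) hb
  refine ⟨fun h hx => absurd (le_csSup hb hx) (not_le.2 h), fun h => ?_⟩
  by_contra hle
  exact h (hΓ.down (Prod.mk_le_mk.2 ⟨not_lt.1 hle, le_rfl⟩) hmem)

lemma beta_lt_iff (hΓ : IsCornerSet Γ) {m : ℤ} (hm : 0 < m) (y : ℤ) :
    beta Γ m < y ↔ (m, y) ∉ Γ := by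
  have hb : BddAbove {k : ℤ | (m, k) ∈ Γ} :=
    ⟨0, fun k hk => by by_contra h; exact hΓ.notMem_of_right hm (by simp; omega) hk⟩
  have hmem : beta Γ m ∈ {k : ℤ | (m, k) ∈ Γ} := Int.csSup_mem (hΓ.col m) hb
  refine ⟨fun h hx => absurd (le_csSup hb hx) (not_le.2 h), fun h => ?_⟩
  by_contra hle
  exact h (hΓ.down (Prod.mk_le_mk.2 ⟨le_rfl, not_lt.1 hle⟩) hmem)

lemma sSup_image_eq_zero {f : ℤ → ℝ} {K : Set ℤ} (h : ∀ k ∈ K, f k = 0) : sSup (f '' K) = 0 :=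
  le_antisymm (Real.sSup_le (by rintro _ ⟨k, hk, rfl⟩; exact (h k hk).le) le_rfl)
    (Real.sSup_nonneg (by rintro _ ⟨k, hk, rfl⟩; exact (h k hk).ge))

/-- `(G¹, G²)` solves the growth recursion. -/
lemma isGrowth_G (hΓ : IsCornerSet Γ) {w : ℤ × ℤ → ℝ} (hw : ∀ z, 0 ≤ w z) :
    IsGrowth Γ (fun z _ _ => w z) fun z => (G1 Γ w z, G2 Γ w z) where
  mem z hz := by
    refine Prod.ext (sSup_image_eq_zero fun k hk => passageTime_of_not_le fun hle => ?_)
      (sSup_image_eq_zero fun m hm => passageTime_of_not_le fun hle => ?_)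
    · exact (alpha_lt_iff hΓ hk.1 _).1 (lt_add_one _) (hΓ.down hle hz)
    · exact (beta_lt_iff hΓ hm.1 _).1 (lt_add_one _) (hΓ.down hle hz)
  notMem z hz := by
    refine Prod.ext ?_ ?_
    · simp only [growStep]
      split_ifs with h2
      · refine sSup_passageTime hw (fun k => (alpha Γ k + 1, k)) (Set.finite_Ioc _ _)
          subset_rfl (Set.Ioc_subset_Ioc_right (by simp [belowOf])) (fun k hk hk' => absurd hk hk')
          (fun k hk hk' hle => hk' ⟨hk.1, hle.2⟩) ⟨z.2, ⟨h2, le_rfl⟩, ?_⟩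
        exact Prod.mk_le_mk.2 ⟨(alpha_lt_iff hΓ h2 z.1).2 hz, le_rfl⟩
      · simp [G1, Set.Ioc_eq_empty h2]
    · simp only [growStep]
      split_ifs with h1
      · refine sSup_passageTime hw (fun m => (m, beta Γ m + 1)) (Set.finite_Ioc _ _)
          (Set.Ioc_subset_Ioc_right (by simp [leftOf])) subset_rfl
          (fun k hk hk' hle => hk' ⟨hk.1, hle.1⟩) (fun k hk hk' => absurd hk hk')
          ⟨z.1, ⟨h1, le_rfl⟩, ?_⟩
        exact Prod.mk_le_mk.2 ⟨le_rfl, (beta_lt_iff hΓ h1 z.2).2 hz⟩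
      · simp [G2, Set.Ioc_eq_empty h1]

end Corners

namespace IsWeightedGrowth

variable {Γ : Set (ℤ × ℤ)} {w : ℤ × ℤ → ℝ} {s : ℤ × ℤ → ℝ × ℝ}

lemma eq_G (h : IsWeightedGrowth Γ w s) (hw : ∀ z, 0 ≤ w z) (z : ℤ × ℤ) :
    s z = (G1 Γ w z, G2 Γ w z) :=
  growth_congr h.corner h.growth (isGrowth_G h.corner hw) (A := Set.univ) (by simp)
    (fun _ _ _ => rfl) z (Or.inr trivial)

lemma occupationTime_eq (h : IsWeightedGrowth Γ w s) (hw : ∀ z, 0 ≤ w z) (z : ℤ × ℤ) :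
    occupationTime Γ w z = totalTime s z := by
  unfold occupationTime
  split_ifs with hz
  · exact (h.totalTime_mem hz).symm
  · rw [totalTime, h.eq_G hw]

end IsWeightedGrowth

/-! ### The competition interface follows the minimal neighbour -/

/-- The path from the origin that moves right or up, to the neighbour that is occupied first. -/
def minPath (G : ℤ × ℤ → ℝ) : ℕ → ℤ × ℤ
  | 0 => (0, 0)
  | n + 1 => if G (minPath G n + (1, 0)) < G (minPath G n + (0, 1)) then minPath G n + (1, 0)
      else minPath G n + (0, 1)

lemma minPath_nonneg (G : ℤ × ℤ → ℝ) (n : ℕ) : 0 ≤ (minPath G n).1 ∧ 0 ≤ (minPath G n).2 := by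
  induction n with
  | zero => simp [minPath]
  | succ n ih =>
    simp only [minPath]
    split_ifs <;> simp <;> omega

lemma minPath_sum (G : ℤ × ℤ → ℝ) (n : ℕ) : (minPath G n).1 + (minPath G n).2 = n := by
  induction n with
  | zero => simp [minPath]
  | succ n ih =>
    simp only [minPath]
    split_ifs <;> simp <;> omega

lemma minPath_succ_time (G : ℤ × ℤ → ℝ) (n : ℕ) : G (minPath G (n + 1)) =
    min (G (minPath G n + (1, 0))) (G (minPath G n + (0, 1))) := by
  simp only [minPath]
  split_ifs with h
  · exact (min_eq_left h.le).symm
  · exact (min_eq_right (not_lt.1 h)).symm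

namespace IsWeightedGrowth

variable {Γ : Set (ℤ × ℤ)} {w : ℤ × ℤ → ℝ} {s : ℤ × ℤ → ℝ × ℝ}

/-- The sites above the path so far belong to cluster 1, and those to the right of it do not. -/
lemma cluster_of_minPath (h : IsWeightedGrowth Γ w s) (n : ℕ) :
    (∀ z ∉ Γ, z.1 ≤ (minPath (totalTime s) n).1 → (minPath (totalTime s) n).2 < z.2 →
      (s z).2 < (s z).1) ∧
    (∀ z ∉ Γ, (minPath (totalTime s) n).1 < z.1 → z.2 ≤ (minPath (totalTime s) n).2 →
      (s z).1 ≤ (s z).2) := by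
  induction n with
  | zero =>
    refine ⟨fun z hz h1 h2 => (h.joinsFirst_iff hz).1 ⟨h2, Or.inl h1⟩, fun z hz h1 h2 => ?_⟩
    exact not_lt.1 fun hlt => absurd ((h.joinsFirst_iff hz).2 hlt).1 (not_lt.2 h2)
  | succ n ih =>
    obtain ⟨ih1, ih2⟩ := ih
    have hnn := minPath_nonneg (totalTime s) n
    simp only [minPath]
    set φ := minPath (totalTime s) n
    obtain ⟨x, y⟩ := φ
    simp only [Prod.mk_add_mk, add_zero] at ih1 ih2 hnn ⊢
    have haΓ : (x, y + 1) ∉ Γ := h.corner.notMem_of_up hnn.1 (by simp; omega)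
    have hbΓ : (x + 1, y) ∉ Γ := h.corner.notMem_of_right (by simp; omega) hnn.2
    have ha := ih1 (x, y + 1) haΓ le_rfl (by simp)
    have hb := ih2 (x + 1, y) hbΓ (by simp) le_rfl
    have hGa : totalTime s (x, y + 1) = (s (x, y + 1)).1 := max_eq_left ha.le
    have hGb : totalTime s (x + 1, y) = (s (x + 1, y)).2 := max_eq_right hb
    rw [hGa, hGb]
    split_ifs with hlt
    · refine ⟨?_, fun z hz h1 h2 => ih2 z hz (by simp at h1; omega) h2⟩
      -- the new sites are those of the column `x + 1`
      have key : ∀ k : ℕ, (s (x + 1, y + 1 + k)).2 < (s (x + 1, y + 1 + k)).1 := by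
        intro k
        have hΓ : (x + 1, y + 1 + (k : ℤ)) ∉ Γ :=
          h.corner.notMem_of_up (by simp; omega) (by simp; omega)
        refine (h.joinsFirst_iff hΓ).1 ⟨by simp; omega, Or.inr ?_⟩
        induction k with
        | zero =>
          simp only [parentMax, leftOf, belowOf]
          simp only [Nat.cast_zero, add_zero, add_sub_cancel_right]
          exact lt_max_of_lt_left (max_lt ha hlt)
        | succ k ihk =>
          have hΓ' : (x + 1, y + 1 + (k : ℤ)) ∉ Γ :=
            h.corner.notMem_of_up (by simp; omega) (by simp; omega)
          have h1 : (s (x + 1, y + 1 + (k : ℤ))).2 < (s (x + 1, y + 1 + (k : ℤ))).1 :=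
            (h.joinsFirst_iff hΓ').1 ⟨by simp; omega, Or.inr (ihk hΓ')⟩
          have h2 := ih1 (x, y + 1 + ((k : ℤ) + 1))
            (h.corner.notMem_of_up hnn.1 (by simp; omega)) le_rfl (by simp; omega)
          simp only [parentMax, leftOf, belowOf]
          rw [show y + 1 + ((k + 1 : ℕ) : ℤ) - 1 = y + 1 + (k : ℤ) by push_cast; ring]
          simp only [add_sub_cancel_right, Nat.cast_add, Nat.cast_one]
          exact max_lt_max h2 h1
      intro z hz h1 h2
      simp only at h1 h2
      by_cases hx : z.1 ≤ x
      · exact ih1 z hz hx h2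
      · have := key (z.2 - (y + 1)).toNat
        rw [show (x + 1, y + 1 + ((z.2 - (y + 1)).toNat : ℤ)) = z from
          Prod.ext (by simp; omega) (by simp; omega)] at this
        exact this
    · refine ⟨fun z hz h1 h2 => ih1 z hz h1 (by simp at h2; omega), ?_⟩
      -- the new sites are those of the row `y + 1`
      have key : ∀ k : ℕ, (s (x + 1 + k, y + 1)).1 ≤ (s (x + 1 + k, y + 1)).2 := by
        intro k
        induction k with
        | zero =>
          have hΓ : (x + 1, y + 1) ∉ Γ :=
            h.corner.notMem_of_up (by simp; omega) (by simp; omega)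
          simp only [Nat.cast_zero, add_zero]
          refine not_lt.1 fun hc => ?_
          have hj := ((h.joinsFirst_iff hΓ).2 hc).2.resolve_left (by simp; omega)
          simp only [parentMax, leftOf, belowOf, add_sub_cancel_right] at hj
          exact absurd hj (not_lt.2 (le_max_of_le_right (max_le (not_lt.1 hlt) hb)))
        | succ k ihk =>
          have hΓ : (x + 1 + ((k + 1 : ℕ) : ℤ), y + 1) ∉ Γ :=
            h.corner.notMem_of_up (by simp; omega) (by simp; omega)
          have h2 := ih2 (x + 1 + ((k : ℤ) + 1), y)
            (h.corner.notMem_of_right (by simp; omega) hnn.2) (by simp; omega) le_rfl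
          refine not_lt.1 fun hc => ?_
          have hj := ((h.joinsFirst_iff hΓ).2 hc).2.resolve_left (by simp; omega)
          simp only [parentMax, leftOf, belowOf] at hj
          rw [show x + 1 + ((k + 1 : ℕ) : ℤ) - 1 = x + 1 + (k : ℤ) by push_cast; ring] at hj
          simp only [add_sub_cancel_right, Nat.cast_add, Nat.cast_one] at hj
          exact absurd hj (not_lt.2 (max_le_max ihk h2))
      intro z hz h1 h2
      simp only at h1 h2
      by_cases hy : z.2 ≤ y
      · exact ih2 z hz h1 hy
      · have := key (z.1 - (x + 1)).toNat
        rw [show (x + 1 + ((z.1 - (x + 1)).toNat : ℤ), y + 1) = z from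
          Prod.ext (by simp; omega) (by simp; omega)] at this
        exact this

lemma competitionInterface_eq (h : IsWeightedGrowth Γ w s) (hw : ∀ z, 0 ≤ w z) (n : ℕ) :
    competitionInterface Γ w n = minPath (totalTime s) n := by
  induction n with
  | zero => rfl
  | succ n ih =>
    have hnn := minPath_nonneg (totalTime s) n
    have hcl := h.cluster_of_minPath (n + 1)
    simp only [competitionInterface, ih]
    have hΓ : minPath (totalTime s) n + (1, 1) ∉ Γ :=
      h.corner.notMem_of_up (by simp; omega) (by simp; omega)
    have hG := h.eq_G hw (minPath (totalTime s) n + (1, 1))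
    simp only [minPath] at hcl ⊢
    split_ifs at hcl with hlt
    · rw [if_pos hlt, if_pos]
      refine ⟨hΓ, ?_⟩
      have := hcl.1 _ hΓ (by simp) (by simp)
      rwa [hG] at this
    · rw [if_neg hlt, if_neg]
      rintro ⟨-, hc⟩
      have := hcl.2 _ hΓ (by simp) (by simp)
      rw [hG] at this
      exact absurd hc (not_lt.2 this)

end IsWeightedGrowth

/-! ### Particle configurations along the boundary of a growing set -/

/-- The step of the boundary of the down-set `L` that crosses from the diagonal `x - 1` to the
diagonal `x` goes down (there is a particle at `x`). -/
def IsDownStep (L : Set (ℤ × ℤ)) (x : ℤ) : Prop :=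
  ∃ z : ℤ × ℤ, z.1 - z.2 = x ∧ leftOf z ∈ L ∧ z ∉ L

/-- The configuration with a site of type `b` at `X` that stands for the pair of the sites `X`
and `X + 1` of the configuration `B`. -/
def mergePair (B : ℤ → Bool) (X : ℤ) (b : Bool) : Config := fun x =>
  if x < X then B x else if x = X then b else B (x + 1)

/-- The particle configuration of the boundary of `L`, with a site of type `b` in place of the
pair of steps around the corner on the diagonal `X`. -/
def boundaryConfig (L : Set (ℤ × ℤ)) (X : ℤ) (b : Bool) : Config :=
  mergePair (fun x => decide (IsDownStep L x)) X b

/-- Sites that can be added to the down-set `L`. -/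
def IsAddable (L : Set (ℤ × ℤ)) (z : ℤ × ℤ) : Prop := z ∉ L ∧ leftOf z ∈ L ∧ belowOf z ∈ L

section Boundary

variable {L : Set (ℤ × ℤ)}

lemma not_isDownStep_corner (hL : IsLowerSet L) {p : ℤ × ℤ} (hp : p ∈ L)
    (hp2 : p + (0, 1) ∉ L) : ¬ IsDownStep L (p.1 - p.2) := by
  rintro ⟨z, hz, h1, h2⟩
  rcases le_or_gt z.1 p.1 with h | h
  · exact h2 (hL (a := p) (Prod.le_def.2 ⟨h, by omega⟩) hp)
  · refine hp2 (hL (Prod.le_def.2 ⟨?_, ?_⟩) h1) <;> simp [leftOf] <;> omega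

lemma isDownStep_corner {p : ℤ × ℤ} (hp : p ∈ L) (hp1 : p + (1, 0) ∉ L) :
    IsDownStep L (p.1 - p.2 + 1) :=
  ⟨p + (1, 0), by simp; ring, by simpa [leftOf] using hp, hp1⟩

lemma IsAddable.isDownStep {z : ℤ × ℤ} (h : IsAddable L z) : IsDownStep L (z.1 - z.2) :=
  ⟨z, rfl, h.2.1, h.1⟩

lemma IsAddable.not_isDownStep (hL : IsLowerSet L) {z : ℤ × ℤ} (h : IsAddable L z) :
    ¬ IsDownStep L (z.1 - z.2 + 1) := by
  rintro ⟨z', hz', h1, h2⟩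
  rcases le_or_gt z'.1 z.1 with h3 | h3
  · refine h2 (hL (Prod.le_def.2 ⟨?_, ?_⟩) h.2.2) <;> simp [belowOf] <;> omega
  · refine h.1 (hL (Prod.le_def.2 ⟨?_, ?_⟩) h1) <;> simp [leftOf] <;> omega

/-- A particle followed by a hole is an inner corner of the boundary. -/
lemma exists_isAddable (hL : IsLowerSet L) {d : ℤ} (h1 : IsDownStep L d)
    (h2 : ¬ IsDownStep L (d + 1)) : ∃ z : ℤ × ℤ, z.1 - z.2 = d ∧ IsAddable L z := by
  obtain ⟨z, hz, h3, h4⟩ := h1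
  refine ⟨z, hz, h4, h3, ?_⟩
  by_contra h5
  refine h2 ⟨belowOf z, by simp [belowOf]; omega, hL ?_ h3, h5⟩
  simp [leftOf, belowOf, Prod.le_def]

lemma IsAddable.eq_of_diagonal (hL : IsLowerSet L) {z z' : ℤ × ℤ} (h : IsAddable L z)
    (h' : IsAddable L z') (hd : z.1 - z.2 = z'.1 - z'.2) : z = z' := by
  rcases lt_trichotomy z.1 z'.1 with h1 | h1 | h1
  · exact absurd (hL (Prod.le_def.2 ⟨by simp [leftOf]; omega, by simp [leftOf]; omega⟩) h'.2.1) h.1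
  · exact Prod.ext h1 (by omega)
  · exact absurd (hL (Prod.le_def.2 ⟨by simp [leftOf]; omega, by simp [leftOf]; omega⟩) h.2.1) h'.1

/-- Adding a site exchanges a particle with the hole on its right. -/
lemma IsAddable.isDownStep_insert (hL : IsLowerSet L) {z : ℤ × ℤ} (h : IsAddable L z) (x : ℤ) :
    IsDownStep (insert z L) x ↔
      x = z.1 - z.2 + 1 ∨ (x ≠ z.1 - z.2 ∧ IsDownStep L x) := by
  constructor
  · rintro ⟨z', hz', h1, h2⟩
    rw [Set.mem_insert_iff, not_or] at h2
    rcases h1 with h1 | h1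
    · left
      rw [← h1]
      simp [leftOf]
      omega
    · refine Or.inr ⟨fun hx => ?_, z', hz', h1, h2.2⟩
      rcases lt_trichotomy z'.1 z.1 with h3 | h3 | h3
      · refine h2.2 (hL (Prod.le_def.2 ⟨?_, ?_⟩) h.2.1) <;> simp [leftOf] <;> omega
      · exact h2.1 (Prod.ext h3 (by omega))
      · refine h.1 (hL (Prod.le_def.2 ⟨?_, ?_⟩) h1) <;> simp [leftOf] <;> omega
  · rintro (rfl | ⟨hx, z', hz', h1, h2⟩)
    · refine ⟨z + (1, 0), by simp; ring, Or.inl (by simp [leftOf]), ?_⟩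
      rintro (h1 | h1)
      · have := congrArg Prod.fst h1
        simp at this
      · exact h.1 (hL (Prod.le_def.2 ⟨by simp, by simp⟩) h1)
    · refine ⟨z', hz', Or.inr h1, ?_⟩
      rintro (rfl | h3)
      · exact hx hz'.symm
      · exact h2 h3

end Boundary

/-- An exchange on the left of the pair, or of a particle with the pair. -/
lemma mergePair_exchange_left {B B' : ℤ → Bool} {X X' d : ℤ} (b : Bool) (hd : d < X)
    (hB : B d = true) (hB1 : B (d + 1) = false) (hX1 : B (X + 1) = true)
    (hB' : ∀ x, B' x = if x = d + 1 then true else if x = d then false else B x)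
    (hX' : X' = if d = X - 1 then X - 1 else X) :
    mergePair B' X' b = afterRing {d} (mergePair B X b) := by
  funext y
  simp only [mergePair, afterRing, Set.mem_singleton_iff, hB']
  by_cases hdX : d = X - 1
  · rw [if_pos hdX] at hX'
    subst hX' hdX
    rcases lt_trichotomy y (X - 1) with h | h | h
    · grind
    · subst h; cases b <;> grind
    · rcases eq_or_ne y X with rfl | h'
      · cases b <;> grind
      · grind
  · rw [if_neg hdX] at hX'
    subst hX'
    rcases lt_trichotomy y X' with h | h | h
    · grind
    · grind
    · rcases eq_or_ne y (X' + 1) with rfl | h' <;> grind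

/-- An exchange on the right of the pair, or of the pair with a hole. -/
lemma mergePair_exchange_right {B B' : ℤ → Bool} {X X' d : ℤ} (b : Bool) (hd : X < d)
    (hB : B d = true) (hB1 : B (d + 1) = false) (hX0 : B X = false)
    (hB' : ∀ x, B' x = if x = d + 1 then true else if x = d then false else B x)
    (hX' : X' = if d = X + 1 then X + 1 else X) :
    mergePair B' X' b = afterRing {d - 1} (mergePair B X b) := by
  funext y
  simp only [mergePair, afterRing, Set.mem_singleton_iff, hB']
  by_cases hdX : d = X + 1
  · rw [if_pos hdX] at hX'
    subst hX' hdX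
    rcases lt_trichotomy y X with h | h | h
    · grind
    · subst h; cases b <;> grind
    · rcases eq_or_ne y (X + 1) with rfl | h'
      · cases b <;> grind
      · grind
  · rw [if_neg hdX] at hX'
    subst hX'
    rcases lt_trichotomy y X' with h | h | h
    · grind
    · grind
    · rcases eq_or_ne y (X' + 1) with rfl | h' <;> grind

/-! ### The exclusion process of a growth process driven by clocks -/

/-- A growth process with weights `w` in which every site off `Γ` is added at the first epoch of
its clock after the time at which its parents are present. -/
structure IsRingGrowth (Γ : Set (ℤ × ℤ)) (w : ℤ × ℤ → ℝ) (E : ℤ → Set ℝ)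
    (s : ℤ × ℤ → ℝ × ℝ) : Prop extends IsWeightedGrowth Γ w s where
  ring : ∀ z ∉ Γ, totalTime s z ∈ E (siteClock s z)
  first : ∀ z ∉ Γ, ∀ t ∈ E (siteClock s z), startTime s z < t → totalTime s z ≤ t
  disjoint : ∀ x y t, t ∈ E x → t ∈ E y → x = y
  diverge_right : Tendsto (fun n : ℕ => ∑ i ∈ Finset.range n, w ((i : ℤ) + 1, 0)) atTop atTop
  diverge_up : Tendsto (fun n : ℕ => ∑ i ∈ Finset.range n, w (0, (i : ℤ) + 1)) atTop atTop

/-- The diagonal of the `n`-th site of `minPath G`. This is the position of the second-class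
particle while that site is the last one of the path that has been added. -/
def pathDiagonal (G : ℤ × ℤ → ℝ) (n : ℕ) : ℤ := (minPath G n).1 - (minPath G n).2

/-- The configuration at time `t` if the second-class particle is replaced by a site of
type `b`. -/
def growthConfig (G : ℤ × ℤ → ℝ) (b : Bool) (t : ℝ) : Config := fun x =>
  decide (∃ n, G (minPath G n) ≤ t ∧ t < G (minPath G (n + 1)) ∧
    boundaryConfig {z | G z ≤ t} (pathDiagonal G n) b x = true)

namespace IsRingGrowth

variable {Γ : Set (ℤ × ℤ)} {w : ℤ × ℤ → ℝ} {E : ℤ → Set ℝ} {s : ℤ × ℤ → ℝ × ℝ}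

lemma exists_right (h : IsRingGrowth Γ w E s) (T : ℝ) :
    ∃ N : ℕ, T < totalTime s ((N : ℤ), 0) ∧ T < totalTime s (0, (N : ℤ)) := by
  have h1 : ∀ n : ℕ, ∑ i ∈ Finset.range n, w ((i : ℤ) + 1, 0) ≤ totalTime s ((n : ℤ), 0) := by
    intro n
    induction n with
    | zero => simpa using h.totalTime_nonneg _
    | succ n ih =>
      rw [Finset.sum_range_succ, Nat.cast_succ,
        h.totalTime_eq (h.corner.notMem_of_right (by dsimp only; omega) le_rfl)]
      refine add_le_add_left (ih.trans ?_) _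
      exact h.le_startTime (by simp) (by simp)
  have h2 : ∀ n : ℕ, ∑ i ∈ Finset.range n, w (0, (i : ℤ) + 1) ≤ totalTime s (0, (n : ℤ)) := by
    intro n
    induction n with
    | zero => simpa using h.totalTime_nonneg _
    | succ n ih =>
      rw [Finset.sum_range_succ, Nat.cast_succ,
        h.totalTime_eq (h.corner.notMem_of_up le_rfl (by dsimp only; omega))]
      refine add_le_add_left (ih.trans ?_) _
      exact h.le_startTime (by simp) (by simp)
  obtain ⟨N, hN1, hN2⟩ := ((h.diverge_right.eventually_gt_atTop T).and
    (h.diverge_up.eventually_gt_atTop T)).exists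
  exact ⟨N, hN1.trans_le (h1 N), hN2.trans_le (h2 N)⟩

lemma path_notMem (h : IsRingGrowth Γ w E s) (n : ℕ) :
    minPath (totalTime s) (n + 1) ∉ Γ := by
  have h1 := minPath_nonneg (totalTime s) (n + 1)
  have h2 := minPath_sum (totalTime s) (n + 1)
  push_cast at h2
  rcases h1.1.lt_or_eq with h3 | h3
  · exact h.corner.notMem_of_right h3 h1.2
  · exact h.corner.notMem_of_up h1.1 (by omega)

lemma path_time_strictMono (h : IsRingGrowth Γ w E s) :
    StrictMono fun n => totalTime s (minPath (totalTime s) n) := by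
  refine strictMono_nat_of_lt_succ fun n => ?_
  refine lt_of_le_of_lt (h.le_startTime ?_ ?_) (h.startTime_lt (h.path_notMem n))
  · simp only [minPath]
    split_ifs <;> simp [Prod.le_def]
  · simp only [minPath]
    split_ifs <;> simp [Prod.ext_iff]

lemma path_time_zero (h : IsRingGrowth Γ w E s) :
    totalTime s (minPath (totalTime s) 0) = 0 := h.totalTime_mem h.corner.zero_mem

lemma exists_path_time_gt (h : IsRingGrowth Γ w E s) (T : ℝ) :
    ∃ n, T < totalTime s (minPath (totalTime s) n) := by
  obtain ⟨N, hN1, hN2⟩ := h.exists_right T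
  refine ⟨2 * N, ?_⟩
  have h1 := minPath_nonneg (totalTime s) (2 * N)
  have h2 := minPath_sum (totalTime s) (2 * N)
  push_cast at h2
  rcases le_or_gt (N : ℤ) (minPath (totalTime s) (2 * N)).1 with h3 | h3
  · exact hN1.trans_le (h.mono (Prod.le_def.2 ⟨h3, h1.2⟩))
  · exact hN2.trans_le (h.mono (Prod.le_def.2 ⟨h1.1, by simp; omega⟩))

lemma exists_index (h : IsRingGrowth Γ w E s) {t : ℝ} (ht : 0 ≤ t) :
    ∃ n, totalTime s (minPath (totalTime s) n) ≤ t ∧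
      t < totalTime s (minPath (totalTime s) (n + 1)) := by
  have hex := h.exists_path_time_gt t
  have h1 := Nat.find_spec hex
  have h0 : Nat.find hex ≠ 0 := fun h0 => by
    rw [h0, h.path_time_zero] at h1
    linarith
  obtain ⟨n, hn⟩ := Nat.exists_eq_succ_of_ne_zero h0
  refine ⟨n, not_lt.1 (Nat.find_min hex (by omega)), ?_⟩
  rwa [hn] at h1

lemma exists_left_index (h : IsRingGrowth Γ w E s) {t : ℝ} (ht : 0 < t) :
    ∃ n, totalTime s (minPath (totalTime s) n) < t ∧
      t ≤ totalTime s (minPath (totalTime s) (n + 1)) := by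
  obtain ⟨n, h1, h2⟩ := h.exists_index ht.le
  rcases h1.lt_or_eq with h3 | h3
  · exact ⟨n, h3, h2.le⟩
  · cases n with
    | zero => rw [h.path_time_zero] at h3; linarith
    | succ n => exact ⟨n, h3 ▸ h.path_time_strictMono (Nat.lt_succ_self n), h3.ge⟩

lemma index_unique (h : IsRingGrowth Γ w E s) {t : ℝ} {n m : ℕ}
    (hn : totalTime s (minPath (totalTime s) n) ≤ t)
    (hn' : t < totalTime s (minPath (totalTime s) (n + 1)))
    (hm : totalTime s (minPath (totalTime s) m) ≤ t)
    (hm' : t < totalTime s (minPath (totalTime s) (m + 1))) : n = m := by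
  have h1 := h.path_time_strictMono.lt_iff_lt.1 (hn.trans_lt hm')
  have h2 := h.path_time_strictMono.lt_iff_lt.1 (hm.trans_lt hn')
  omega

lemma growthConfig_eq (h : IsRingGrowth Γ w E s) (b : Bool) {t : ℝ} {n : ℕ}
    (hn : totalTime s (minPath (totalTime s) n) ≤ t)
    (hn' : t < totalTime s (minPath (totalTime s) (n + 1))) :
    growthConfig (totalTime s) b t =
      boundaryConfig {z | totalTime s z ≤ t} (pathDiagonal (totalTime s) n) b := by
  funext x
  rw [Bool.eq_iff_iff]
  simp only [growthConfig, decide_eq_true_eq]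
  constructor
  · rintro ⟨m, h1, h2, h3⟩
    rwa [h.index_unique hn hn' h1 h2]
  · exact fun h3 => ⟨n, hn, hn', h3⟩

lemma finite_diagonal (h : IsRingGrowth Γ w E s) (d : ℤ) (T : ℝ) :
    {z : ℤ × ℤ | z.1 - z.2 = d ∧ z ∉ Γ ∧ totalTime s z ≤ T}.Finite := by
  obtain ⟨x, hx⟩ := h.corner.row 0
  obtain ⟨N, -, hN⟩ := h.exists_right T
  refine ((Set.finite_Icc (min (x - d) 0) (N + |d|)).image fun y => (y + d, y)).subset ?_
  rintro z ⟨h1, h2, h3⟩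
  refine ⟨z.2, ⟨?_, ?_⟩, Prod.ext (by simp; omega) rfl⟩
  · by_contra hlt
    rw [not_le, lt_min_iff] at hlt
    exact h2 (h.corner.down (Prod.le_def.2 ⟨by simp; omega, hlt.2.le⟩) hx)
  · by_contra hlt
    have := neg_abs_le d
    have := abs_nonneg d
    refine absurd (hN.trans_le (h.mono (Prod.le_def.2 ⟨?_, ?_⟩))) (not_lt.2 h3) <;> simp <;> omega

lemma eventually_left (h : IsRingGrowth Γ w E s) (d : ℤ) {t : ℝ} (ht : 0 < t) :
    ∀ᶠ r in 𝓝[<] t, ∀ z : ℤ × ℤ, z.1 - z.2 = d → (totalTime s z ≤ r ↔ totalTime s z < t) := by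
  have h1 : ∀ᶠ r in 𝓝[<] t, ∀ z ∈ {z : ℤ × ℤ | z.1 - z.2 = d ∧ z ∉ Γ ∧ totalTime s z ≤ t},
      totalTime s z < t → totalTime s z ≤ r := by
    refine (Filter.eventually_all_finite (h.finite_diagonal d t)).2 fun z _ => ?_
    by_cases hz : totalTime s z < t
    · filter_upwards [Ioo_mem_nhdsLT hz] with r hr _ using hr.1.le
    · exact Eventually.of_forall fun r h => absurd h hz
  filter_upwards [h1, Ioo_mem_nhdsLT ht] with r hr1 hr2 z hz
  refine ⟨fun h2 => h2.trans_lt hr2.2, fun h2 => ?_⟩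
  by_cases hΓ : z ∈ Γ
  · rw [h.totalTime_mem hΓ]; exact hr2.1.le
  · exact hr1 z ⟨hz, hΓ, h2.le⟩ h2

lemma eventually_right (h : IsRingGrowth Γ w E s) (d : ℤ) {t : ℝ} (ht : 0 ≤ t) :
    ∀ᶠ r in 𝓝[>] t, ∀ z : ℤ × ℤ, z.1 - z.2 = d → (totalTime s z ≤ r ↔ totalTime s z ≤ t) := by
  have h1 : ∀ᶠ r in 𝓝[>] t, ∀ z ∈ {z : ℤ × ℤ | z.1 - z.2 = d ∧ z ∉ Γ ∧ totalTime s z ≤ t + 1},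
      t < totalTime s z → r < totalTime s z := by
    refine (Filter.eventually_all_finite (h.finite_diagonal d (t + 1))).2 fun z _ => ?_
    by_cases hz : t < totalTime s z
    · filter_upwards [Ioo_mem_nhdsGT hz] with r hr _ using hr.2
    · exact Eventually.of_forall fun r h => absurd h hz
  filter_upwards [h1, Ioo_mem_nhdsGT (lt_add_one t)] with r hr1 hr2 z hz
  refine ⟨fun h2 => ?_, fun h2 => h2.trans hr2.1.le⟩
  by_contra h3
  rw [not_le] at h3
  have hΓ : z ∉ Γ := fun hΓ => by rw [h.totalTime_mem hΓ] at h3; linarith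
  exact absurd (hr1 z ⟨hz, hΓ, h2.trans hr2.2.le⟩ h3) (not_lt.2 h2)

lemma isDownStep_congr {L L' : Set (ℤ × ℤ)} {x : ℤ}
    (h : ∀ z : ℤ × ℤ, z.1 - z.2 = x → (z ∈ L ↔ z ∈ L'))
    (h' : ∀ z : ℤ × ℤ, z.1 - z.2 = x - 1 → (z ∈ L ↔ z ∈ L')) :
    IsDownStep L x ↔ IsDownStep L' x := by
  refine exists_congr fun z => and_congr_right fun hz => ?_
  rw [h z hz, h' (leftOf z) (by simp [leftOf]; omega)]

lemma boundaryConfig_congr {L L' : Set (ℤ × ℤ)} {X x : ℤ} (b : Bool)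
    (h : ∀ y, y = x ∨ y = x + 1 → (IsDownStep L y ↔ IsDownStep L' y)) :
    boundaryConfig L X b x = boundaryConfig L' X b x := by
  simp only [boundaryConfig, mergePair, h x (Or.inl rfl), h (x + 1) (Or.inr rfl)]

lemma eventually_right_growthConfig (h : IsRingGrowth Γ w E s) (b : Bool) {t : ℝ} (ht : 0 ≤ t)
    (x : ℤ) : ∀ᶠ r in 𝓝[>] t,
      growthConfig (totalTime s) b r x = growthConfig (totalTime s) b t x := by
  obtain ⟨n, h1, h2⟩ := h.exists_index ht
  filter_upwards [h.eventually_right (x - 1) ht, h.eventually_right x ht,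
    h.eventually_right (x + 1) ht, Ioo_mem_nhdsGT h2] with r hr0 hr1 hr2 hr
  rw [h.growthConfig_eq b h1 h2, h.growthConfig_eq b (h1.trans hr.1.le) hr.2]
  refine boundaryConfig_congr b ?_
  rintro y (rfl | rfl)
  · exact isDownStep_congr hr1 hr0
  · exact isDownStep_congr hr2 (by simpa using hr1)

lemma eventually_left_growthConfig (h : IsRingGrowth Γ w E s) (b : Bool) {t : ℝ} (ht : 0 < t)
    {n : ℕ} (h1 : totalTime s (minPath (totalTime s) n) < t)
    (h2 : t ≤ totalTime s (minPath (totalTime s) (n + 1))) (x : ℤ) :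
    ∀ᶠ r in 𝓝[<] t, growthConfig (totalTime s) b r x =
      boundaryConfig {z | totalTime s z < t} (pathDiagonal (totalTime s) n) b x := by
  filter_upwards [h.eventually_left (x - 1) ht, h.eventually_left x ht,
    h.eventually_left (x + 1) ht, Ioo_mem_nhdsLT h1] with r hr0 hr1 hr2 hr
  rw [h.growthConfig_eq b hr.1.le (hr.2.trans_le h2)]
  refine boundaryConfig_congr b ?_
  rintro y (rfl | rfl)
  · exact isDownStep_congr hr1 hr0
  · exact isDownStep_congr hr2 (by simpa using hr1)

lemma isLowerSet_lt (h : IsRingGrowth Γ w E s) (t : ℝ) : IsLowerSet {z | totalTime s z < t} :=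
  fun _ _ hle hz => (h.mono hle).trans_lt hz

/-- The clock of an addable site, on either side of the second-class particle. -/
lemma siteClock_of_isAddable (h : IsRingGrowth Γ w E s) {t : ℝ} (ht : 0 < t) {n : ℕ}
    (h1 : totalTime s (minPath (totalTime s) n) < t)
    (h2 : t ≤ totalTime s (minPath (totalTime s) (n + 1))) {z : ℤ × ℤ}
    (hz : IsAddable {z | totalTime s z < t} z) :
    (z.1 - z.2 < pathDiagonal (totalTime s) n ∧ siteClock s z = z.1 - z.2) ∨
      (pathDiagonal (totalTime s) n < z.1 - z.2 ∧ siteClock s z = z.1 - z.2 - 1) := by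
  have hL := h.isLowerSet_lt t
  rw [minPath_succ_time (totalTime s), le_min_iff] at h2
  have hcl := h.cluster_of_minPath n
  simp only [pathDiagonal]
  set p := minPath (totalTime s) n
  have hzt : t ≤ totalTime s z := not_lt.1 hz.1
  have hΓ : z ∉ Γ := fun hΓ => by rw [h.totalTime_mem hΓ] at hzt; linarith
  have hj := h.joinsFirst_iff hΓ
  -- `z` is not below `p`, and it is not strictly above and to the right of `p`, as the parent
  -- `leftOf z` would come after `p + (0, 1)`, which is not yet present
  have e1 : ¬ (z.1 ≤ p.1 ∧ z.2 ≤ p.2) := fun hle =>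
    absurd (h.mono (Prod.le_def.2 hle)) (not_le.2 (h1.trans_le hzt))
  have e2 : ¬ (p.1 < z.1 ∧ p.2 < z.2) := fun hlt =>
    absurd (h.mono (show p + (0, 1) ≤ leftOf z from Prod.le_def.2
      ⟨by simp [leftOf]; omega, by simp [leftOf]; omega⟩)) (not_le.2 (lt_of_lt_of_le hz.2.1 h2.2))
  by_cases hx : z.1 ≤ p.1
  · refine Or.inl ⟨by omega, ?_⟩
    rw [siteClock, clockOf, if_pos (hj.2 (hcl.1 z hΓ hx (by omega)))]
  · refine Or.inr ⟨by omega, ?_⟩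
    rw [siteClock, clockOf, if_neg]
    exact fun hc => absurd (hj.1 hc) (not_lt.2 (hcl.2 z hΓ (by omega) (by omega)))

/-- The configuration at time `t` arises from its left limit by the exclusion dynamics. A site that
is added off the corner is an exchange on one side of the pair (`mergePair_exchange_left`,
`mergePair_exchange_right`), one that is added next to the corner is an exchange with the pair, and
a ring at which no site is added finds no particle that could move. -/
lemma jump (h : IsRingGrowth Γ w E s) (b : Bool) {t : ℝ} (ht : 0 < t)
    {n : ℕ} (h1 : totalTime s (minPath (totalTime s) n) < t)
    (h2 : t ≤ totalTime s (minPath (totalTime s) (n + 1))) :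
    growthConfig (totalTime s) b t = afterRing {x | t ∈ E x}
      (boundaryConfig {z | totalTime s z < t} (pathDiagonal (totalTime s) n) b) := by
  have hL := h.isLowerSet_lt t
  have hclock := fun z => h.siteClock_of_isAddable ht h1 h2 (z := z)
  have h2' := h2
  rw [minPath_succ_time (totalTime s), le_min_iff] at h2'
  set L : Set (ℤ × ℤ) := {z | totalTime s z < t} with hLdef
  set p := minPath (totalTime s) n with hp
  have hpL : p ∈ L := h1
  have hX0 : ¬ IsDownStep L (pathDiagonal (totalTime s) n) :=
    not_isDownStep_corner hL hpL (not_lt.2 h2'.2)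
  have hX1 : IsDownStep L (pathDiagonal (totalTime s) n + 1) :=
    isDownStep_corner hpL (not_lt.2 h2'.1)
  have hnotΓ : ∀ z, totalTime s z = t → z ∉ Γ := fun z hz hΓ => by
    rw [h.totalTime_mem hΓ] at hz; linarith
  have hadd : ∀ z, totalTime s z = t → IsAddable L z := fun z hz =>
    ⟨hz.not_lt, (h.left_lt (hnotΓ z hz)).trans_eq hz, (h.below_lt (hnotΓ z hz)).trans_eq hz⟩
  by_cases hex : ∃ z, totalTime s z = t
  · -- a site `z` is added, by the only clock that rings
    obtain ⟨z, hz⟩ := hex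
    have hzadd := hadd z hz
    have hringz : t ∈ E (siteClock s z) := hz ▸ h.ring z (hnotΓ z hz)
    have hA : {x | t ∈ E x} = {siteClock s z} := by
      ext x
      exact ⟨fun hx => h.disjoint _ _ t hx hringz, fun hx => by rw [hx]; exact hringz⟩
    have huniq : ∀ z', totalTime s z' = t → z' = z := by
      intro z' hz'
      have hc := h.disjoint _ _ t hringz (hz' ▸ h.ring z' (hnotΓ z' hz'))
      refine (hadd z' hz').eq_of_diagonal hL hzadd ?_
      rcases hclock z hzadd with ⟨h3, h4⟩ | ⟨h3, h4⟩ <;>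
        rcases hclock z' (hadd z' hz') with ⟨h5, h6⟩ | ⟨h5, h6⟩ <;> omega
    have hset : {z' | totalTime s z' ≤ t} = insert z L := by
      ext z'
      simp only [Set.mem_insert_iff, hLdef, Set.mem_ofPred_eq]
      rw [le_iff_lt_or_eq]
      exact ⟨fun h => h.elim Or.inr fun h => Or.inl (huniq z' h),
        fun h => h.elim (fun h => Or.inr (h ▸ hz)) Or.inl⟩
    have hB' : ∀ x, decide (IsDownStep (insert z L) x) = if x = z.1 - z.2 + 1 then true else
        if x = z.1 - z.2 then false else decide (IsDownStep L x) := by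
      intro x
      rw [Bool.eq_iff_iff, decide_eq_true_eq, hzadd.isDownStep_insert hL]
      split_ifs <;> simp [*]
    have hnext : t = totalTime s (minPath (totalTime s) (n + 1)) →
        z = minPath (totalTime s) (n + 1) := fun h => (huniq _ h.symm).symm
    rw [hA]
    -- the index `m` of the path after the jump
    obtain ⟨m, hm1, hm2, hm⟩ : ∃ m, totalTime s (minPath (totalTime s) m) ≤ t ∧
        t < totalTime s (minPath (totalTime s) (m + 1)) ∧
        ((m = n + 1 ∧ z = minPath (totalTime s) (n + 1)) ∨
          (m = n ∧ z ≠ minPath (totalTime s) (n + 1))) := by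
      rcases h2.lt_or_eq with h3 | h3
      · exact ⟨n, h1.le, h3, Or.inr ⟨rfl, fun hc => by rw [← hc, hz] at h3; exact lt_irrefl _ h3⟩⟩
      · exact ⟨n + 1, h3.ge, h3 ▸ h.path_time_strictMono (Nat.lt_succ_self _),
          Or.inl ⟨rfl, hnext h3⟩⟩
    rw [h.growthConfig_eq b hm1 hm2, hset]
    have hstep : minPath (totalTime s) (n + 1) =
        if totalTime s (p + (1, 0)) < totalTime s (p + (0, 1)) then p + (1, 0) else p + (0, 1) :=
      rfl
    have hpr : totalTime s (p + (1, 0)) = t → z = minPath (totalTime s) (n + 1) := fun h3 => by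
      refine hnext ?_
      rw [minPath_succ_time (totalTime s), ← hp, h3, min_eq_left h2'.2]
    have hpu : totalTime s (p + (0, 1)) = t → z = minPath (totalTime s) (n + 1) := fun h3 => by
      refine hnext ?_
      rw [minPath_succ_time (totalTime s), ← hp, h3, min_eq_right h2'.1]
    -- hence `z` is a neighbour of `p` if its diagonal is next to that of `p`
    have hzt : t ≤ totalTime s z := hz.ge
    have e1 : ¬ (z.1 ≤ p.1 ∧ z.2 ≤ p.2) := fun hle =>
      absurd (h.mono (Prod.le_def.2 hle)) (not_le.2 (h1.trans_le hzt))
    have e2 : ¬ (p.1 < z.1 ∧ p.2 < z.2) := fun hlt =>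
      absurd (h.mono (show p + (0, 1) ≤ leftOf z from Prod.le_def.2
        ⟨by simp [leftOf]; omega, by simp [leftOf]; omega⟩))
        (not_le.2 (lt_of_lt_of_le hzadd.2.1 h2'.2))
    have hpd1 : pathDiagonal (totalTime s) n = p.1 - p.2 := rfl
    have hzpath : z = minPath (totalTime s) (n + 1) → z = p + (1, 0) ∨ z = p + (0, 1) := by
      rw [hstep]
      split_ifs
      exacts [Or.inl, Or.inr]
    have hmX : pathDiagonal (totalTime s) m =
        if z = p + (1, 0) then p.1 - p.2 + 1 else if z = p + (0, 1) then p.1 - p.2 - 1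
        else p.1 - p.2 := by
      rcases hm with ⟨rfl, h3⟩ | ⟨rfl, h3⟩
      · rw [pathDiagonal, ← h3]
        rcases hzpath h3 with h4 | h4
        · rw [if_pos h4, h4]; simp; ring
        · rw [if_neg, if_pos h4, h4]
          · simp; ring
          · rw [h4]; simp [Prod.ext_iff]
      · rw [if_neg, if_neg, hpd1]
        · rintro rfl; exact h3 (hpu hz)
        · rintro rfl; exact h3 (hpr hz)
    rcases hclock z hzadd with ⟨h3, h4⟩ | ⟨h3, h4⟩
    · rw [h4]
      refine mergePair_exchange_left b h3 (by simpa using hzadd.isDownStep)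
        (by simpa using hzadd.not_isDownStep hL) (by simpa using hX1) hB' ?_
      rw [hmX, hpd1, if_neg (by rintro rfl; simp at h3; omega)]
      refine if_congr ⟨?_, fun h5 => ?_⟩ rfl rfl
      · rintro rfl; simp; ring
      · exact Prod.ext (by simp; omega) (by simp; omega)
    · rw [h4]
      refine mergePair_exchange_right b h3 (by simpa using hzadd.isDownStep)
        (by simpa using hzadd.not_isDownStep hL) (by simpa using hX0) hB' ?_
      rw [hmX, hpd1]
      have : z ≠ p + (0, 1) := by rintro rfl; simp [hpd1] at h3
      rw [if_neg this]
      refine if_congr ⟨?_, fun h5 => ?_⟩ rfl rfl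
      · rintro rfl; simp; ring
      · exact Prod.ext (by simp; omega) (by simp; omega)
  · -- no site is added, and a clock that rings has no particle to move
    have hset : {z' | totalTime s z' ≤ t} = L := by
      ext z'
      exact ⟨fun h3 => lt_of_le_of_ne h3 fun h4 => hex ⟨z', h4⟩, fun h3 =>
        (show totalTime s z' < t from h3).le⟩
    have h3 : t < totalTime s (minPath (totalTime s) (n + 1)) :=
      lt_of_le_of_ne h2 fun h4 => hex ⟨_, h4.symm⟩
    rw [h.growthConfig_eq b h1.le h3, hset]
    have hno : ∀ z, IsAddable L z → t ∉ E (siteClock s z) := by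
      intro z hz htE
      have hzt : t ≤ totalTime s z := not_lt.1 hz.1
      have hΓ : z ∉ Γ := fun hΓ => by rw [h.totalTime_mem hΓ] at hzt; linarith
      refine hex ⟨z, le_antisymm (h.first z hΓ t htE ?_) hzt⟩
      rw [startTime_eq]
      exact max_lt hz.2.1 hz.2.2
    have key : ∀ x, t ∈ E x → ¬ (boundaryConfig L (pathDiagonal (totalTime s) n) b x = true ∧
        boundaryConfig L (pathDiagonal (totalTime s) n) b (x + 1) = false) := by
      rintro x hx ⟨hb1, hb2⟩
      simp only [boundaryConfig, mergePair] at hb1 hb2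
      set X := pathDiagonal (totalTime s) n
      -- the diagonal of the addable site that a jump from `x` would need
      have hd : ∃ d, IsDownStep L d ∧ ¬ IsDownStep L (d + 1) ∧
          ((d < X ∧ d = x) ∨ (X ≤ d ∧ d = x + 1)) := by
        rcases lt_trichotomy x X with h4 | h4 | h4
        · refine ⟨x, by simpa [h4] using hb1, ?_, Or.inl ⟨h4, rfl⟩⟩
          by_cases h5 : x + 1 < X
          · simpa [h5] using hb2
          · rwa [show x + 1 = X by omega]
        · refine ⟨x + 1, by rwa [h4], ?_, Or.inr ⟨by omega, rfl⟩⟩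
          rw [if_neg (by omega), if_neg (by omega)] at hb2
          simpa using hb2
        · rw [if_neg (by omega), if_neg (by omega)] at hb1 hb2
          exact ⟨x + 1, by simpa using hb1, by simpa using hb2, Or.inr ⟨by omega, rfl⟩⟩
      obtain ⟨d, hd1, hd2, hd3⟩ := hd
      obtain ⟨z, hzd, hz⟩ := exists_isAddable hL hd1 hd2
      refine hno z hz ?_
      have : siteClock s z = x := by
        rcases hclock z hz with ⟨h5, h6⟩ | ⟨h5, h6⟩ <;> omega
      rwa [this]
    funext x
    simp only [afterRing]
    rw [if_neg (fun h4 => key x h4.1 h4.2), if_neg]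
    rintro ⟨h4, h5, h6⟩
    exact key (x - 1) h4 ⟨h5, by simpa using h6⟩

end IsRingGrowth

/-! ### The initial set of a configuration -/

lemma interface_zero (ζ : Config) : interface ζ 0 = (0, 0) := by
  simp [interface]
  rfl

lemma interface_succ (ζ : Config) (j : ℤ) :
    interface ζ (j + 1) = interface ζ j + interfaceStep (ζ (j + 1)) := by
  simp only [interface]
  rcases le_or_gt 0 j with hj | hj
  · have h1 : Finset.Ioc 0 (j + 1) = insert (j + 1) (Finset.Ioc 0 j) := by
      ext i; simp only [Finset.mem_Ioc, Finset.mem_insert]; omega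
    rw [h1, Finset.sum_insert (by simp), Finset.Ioc_eq_empty (by omega : ¬ j + 1 < 0),
      Finset.Ioc_eq_empty (by omega : ¬ j < 0)]
    simp [add_comm]
  · have h1 : Finset.Ioc j 0 = insert (j + 1) (Finset.Ioc (j + 1) 0) := by
      ext i; simp only [Finset.mem_Ioc, Finset.mem_insert]; omega
    rw [h1, Finset.sum_insert (by simp), Finset.Ioc_eq_empty (by omega : ¬ 0 < j + 1),
      Finset.Ioc_eq_empty (by omega : ¬ 0 < j)]
    simp

lemma interface_eq (ζ : Config) (j : ℤ) :
    interface ζ j = interface ζ (j - 1) + interfaceStep (ζ j) := by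
  have := interface_succ ζ (j - 1)
  rwa [sub_add_cancel] at this

lemma interface_diagonal (ζ : Config) (j : ℤ) : (interface ζ j).1 - (interface ζ j).2 = j := by
  have hstep : ∀ b, (interfaceStep b).1 - (interfaceStep b).2 = 1 := by
    intro b; cases b <;> simp [interfaceStep]
  induction j using Int.induction_on with
  | zero => simp [interface_zero]
  | succ j ih =>
    have := hstep (ζ (j + 1))
    rw [interface_succ, Prod.fst_add, Prod.snd_add]
    omega
  | pred j ih =>
    have := hstep (ζ (-j))
    rw [interface_eq, Prod.fst_add, Prod.snd_add] at ih
    omega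

lemma monotone_interface_fst (ζ : Config) : Monotone fun j => (interface ζ j).1 := by
  refine monotone_int_of_le_succ fun j => ?_
  rw [interface_succ]
  cases ζ (j + 1) <;> simp [interfaceStep]

lemma antitone_interface_snd (ζ : Config) : Antitone fun j => (interface ζ j).2 := by
  refine antitone_int_of_succ_le fun j => ?_
  rw [interface_succ]
  cases ζ (j + 1) <;> simp [interfaceStep]

/-- A site lies in the initial set if it lies below the point of the interface on its diagonal. -/
lemma mem_initialSet_iff (η : Config) (z : ℤ × ℤ) :
    z ∈ initialSet η ↔ z.2 ≤ (interface (splitOrigin η) (z.1 - z.2)).2 := by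
  set γ := interface (splitOrigin η) with hγ
  have hdiag : ∀ j, (γ j).1 - (γ j).2 = j := interface_diagonal _
  constructor
  · rintro ⟨j, hj⟩
    obtain ⟨h1, h2⟩ := Prod.le_def.1 hj
    rcases le_total j (z.1 - z.2) with h | h
    · have h3 : (γ j).1 ≤ (γ (z.1 - z.2)).1 := monotone_interface_fst _ h
      have := hdiag (z.1 - z.2)
      rw [← hγ] at h1
      omega
    · exact h2.trans (antitone_interface_snd _ h)
  · intro h
    have := hdiag (z.1 - z.2)
    exact ⟨z.1 - z.2, Prod.le_def.2 ⟨by rw [← hγ]; omega, h⟩⟩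

lemma exists_le_interface_snd {η : Config} (h : Admissible η) (n : ℕ) :
    ∃ j, (n : ℤ) ≤ (interface (splitOrigin η) j).2 := by
  induction n with
  | zero => exact ⟨0, by simp [interface_zero]⟩
  | succ n ih =>
    obtain ⟨j, hj⟩ := ih
    obtain ⟨x, hx, hη⟩ := h.1 (min j 0)
    have h1 : splitOrigin η x = true := by
      rw [splitOrigin, if_pos (hx.trans_le (min_le_right _ _)), hη]
    have h2 : (interface (splitOrigin η) j).2 ≤ (interface (splitOrigin η) x).2 :=
      antitone_interface_snd _ (hx.le.trans (min_le_left _ _))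
    rw [interface_eq (splitOrigin η) x, h1] at h2
    refine ⟨x - 1, ?_⟩
    simp [interfaceStep] at h2
    push_cast
    omega

lemma exists_le_interface_fst {η : Config} (h : Admissible η) (n : ℕ) :
    ∃ j, (n : ℤ) ≤ (interface (splitOrigin η) j).1 := by
  induction n with
  | zero => exact ⟨0, by simp [interface_zero]⟩
  | succ n ih =>
    obtain ⟨j, hj⟩ := ih
    obtain ⟨x, hx, hη⟩ := h.2 (max j 0)
    have hx0 : 0 < x := (le_max_right _ _).trans_lt hx
    have h1 : splitOrigin η (x + 1) = false := by
      rw [splitOrigin, if_neg (by omega), if_neg (by omega), if_neg (by omega)]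
      simpa using hη
    have h2 : (interface (splitOrigin η) j).1 ≤ (interface (splitOrigin η) x).1 :=
      monotone_interface_fst _ ((le_max_left _ _).trans hx.le)
    refine ⟨x + 1, ?_⟩
    rw [interface_succ, h1]
    simp [interfaceStep]
    omega

lemma isCornerSet_initialSet {η : Config} (h : Admissible η) : IsCornerSet (initialSet η) where
  down := fun hle ⟨j, hj⟩ => ⟨j, hle.trans hj⟩
  zero_mem := ⟨0, by simp [interface_zero]⟩
  right_notMem := by
    have := interface_succ (splitOrigin η) 0
    rw [mem_initialSet_iff]
    simp only [zero_add, sub_zero] at this ⊢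
    rw [this, interface_zero]
    simp [splitOrigin, interfaceStep]
  up_notMem := by
    have := interface_eq (splitOrigin η) 0
    rw [interface_zero] at this
    have h2 := congrArg Prod.snd this
    simp [splitOrigin, interfaceStep] at h2
    rw [mem_initialSet_iff]
    simp only [zero_sub]
    omega
  row y := by
    obtain ⟨j, hj⟩ := exists_le_interface_snd h y.toNat
    exact ⟨_, j, Prod.le_def.2 ⟨le_refl (interface (splitOrigin η) j).1, by dsimp only; omega⟩⟩
  col x := by
    obtain ⟨j, hj⟩ := exists_le_interface_fst h x.toNat
    exact ⟨_, j, Prod.le_def.2 ⟨by dsimp only; omega, le_refl (interface (splitOrigin η) j).2⟩⟩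

/-- The boundary of the initial set is the configuration that defines it. -/
lemma isDownStep_initialSet (η : Config) (x : ℤ) :
    IsDownStep (initialSet η) x ↔ splitOrigin η x = true := by
  have h1 := interface_eq (splitOrigin η) x
  have key : IsDownStep (initialSet η) x ↔ ∃ y, (interface (splitOrigin η) x).2 < y ∧
      y ≤ (interface (splitOrigin η) (x - 1)).2 := by
    constructor
    · rintro ⟨z, hz, h2, h3⟩
      rw [mem_initialSet_iff] at h2 h3
      simp only [leftOf] at h2
      rw [hz] at h3
      rw [show z.1 - 1 - z.2 = x - 1 by omega] at h2
      exact ⟨z.2, not_le.1 h3, h2⟩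
    · rintro ⟨y, h2, h3⟩
      refine ⟨(y + x, y), by simp, ?_, ?_⟩
      · rw [mem_initialSet_iff]
        simp only [leftOf]
        rwa [show y + x - 1 - y = x - 1 by omega]
      · rw [mem_initialSet_iff]
        simp only [add_sub_cancel_left]
        exact not_le.2 h2
  rw [key, h1]
  cases splitOrigin η x
  · simp only [interfaceStep, Prod.snd_add]
    simp
  · simp only [interfaceStep, Prod.snd_add, if_true, iff_true]
    exact ⟨(interface (splitOrigin η) (x - 1)).2, by omega, le_rfl⟩

lemma boundaryConfig_initialSet (η : Config) (b : Bool) :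
    boundaryConfig (initialSet η) 0 b = Function.update η 0 b := by
  funext x
  have hd : ∀ y, decide (IsDownStep (initialSet η) y) = splitOrigin η y := fun y => by
    rw [Bool.eq_iff_iff, decide_eq_true_eq, isDownStep_initialSet]
  simp only [boundaryConfig, mergePair, hd]
  rcases lt_trichotomy x 0 with h | rfl | h
  · rw [if_pos h, Function.update_of_ne h.ne, splitOrigin, if_pos h]
  · simp
  · rw [if_neg (by omega), if_neg (by omega), Function.update_of_ne h.ne', splitOrigin,
      if_neg (by omega), if_neg (by omega), if_neg (by omega), add_sub_cancel_right]

/-! ### The second-class particle -/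

/-- The jump times of a step function `X` that takes the value `x n` on `[τ n, τ (n + 1))`. -/
lemma jumpTimes_eq {τ : ℕ → ℝ} (hτ : StrictMono τ) (h0 : τ 0 = 0)
    (hleft : ∀ t, 0 < t → ∃ m, τ m < t ∧ t ≤ τ (m + 1)) {X : ℝ → ℤ} {x : ℕ → ℤ}
    (hX : ∀ n r, τ n ≤ r → r < τ (n + 1) → X r = x n) (R : ℤ → ℤ → Prop) (hR : ∀ y, ¬ R y y)
    {t : ℝ} {n : ℕ} (hn : τ n ≤ t) (hn' : t < τ (n + 1)) :
    {s | 0 < s ∧ s ≤ t ∧ ∃ y, R y (X s) ∧ ∀ᶠ r in 𝓝[<] s, X r = y} =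
      (((Finset.range n).filter fun m => R (x m) (x (m + 1))).image fun m => τ (m + 1) :
        Finset ℝ) := by
  have hlim : ∀ s m, τ m < s → s ≤ τ (m + 1) → ∀ᶠ r in 𝓝[<] s, X r = x m := by
    intro s m h1 h2
    filter_upwards [Ioo_mem_nhdsLT h1] with r hr
    exact hX m r hr.1.le (hr.2.trans_le h2)
  ext s
  simp only [Finset.coe_image, Finset.coe_filter, Finset.mem_range, Set.mem_image,
    Set.mem_ofPred_eq]
  constructor
  · rintro ⟨hs0, hst, y, hy, hyX⟩
    obtain ⟨m, h1, h2⟩ := hleft s hs0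
    obtain ⟨r, hr1, hr2⟩ := (hyX.and (hlim s m h1 h2)).exists
    obtain rfl : y = x m := hr1.symm.trans hr2
    rcases h2.lt_or_eq with h3 | h3
    · rw [hX m s h1.le h3] at hy
      exact absurd hy (hR _)
    · have h4 : τ (m + 1) < τ (n + 1) := h3 ▸ hst.trans_lt hn'
      rw [h3, hX (m + 1) _ le_rfl (hτ (Nat.lt_succ_self _))] at hy
      exact ⟨m, ⟨by have := hτ.lt_iff_lt.1 h4; omega, hy⟩, h3.symm⟩
  · rintro ⟨m, ⟨hm, hmR⟩, rfl⟩
    refine ⟨h0 ▸ hτ (Nat.succ_pos m), (hτ.monotone hm).trans hn, x m, ?_,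
      hlim _ m (hτ (Nat.lt_succ_self _)) le_rfl⟩
    rwa [hX (m + 1) _ le_rfl (hτ (Nat.lt_succ_self _))]

/-- The coordinates of the path count the steps at which the diagonal goes up and down. -/
lemma minPath_eq_card (G : ℤ × ℤ → ℝ) (n : ℕ) :
    (minPath G n).1 =
      ((Finset.range n).filter fun m => pathDiagonal G m < pathDiagonal G (m + 1)).card ∧
    (minPath G n).2 =
      ((Finset.range n).filter fun m => pathDiagonal G m > pathDiagonal G (m + 1)).card := by
  induction n with
  | zero => simp [minPath]
  | succ n ih =>
    have hX : pathDiagonal G (n + 1) = if G (minPath G n + (1, 0)) < G (minPath G n + (0, 1)) then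
        pathDiagonal G n + 1 else pathDiagonal G n - 1 := by
      simp only [pathDiagonal, minPath]
      split_ifs <;> simp <;> ring
    rw [Finset.range_add_one, Finset.filter_insert, Finset.filter_insert, hX]
    simp only [minPath]
    split_ifs with h1 h2 h3 h2 h3 <;> try omega
    · rw [Finset.card_insert_of_notMem (by simp)]
      simpa using ih
    · rw [Finset.card_insert_of_notMem (by simp)]
      simpa using ih

namespace IsRingGrowth

variable {Γ : Set (ℤ × ℤ)} {w : ℤ × ℤ → ℝ} {E : ℤ → Set ℝ} {s : ℤ × ℤ → ℝ × ℝ}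

/-- With the corner replaced by a site of either type, the boundary of the growing set is an
exclusion process driven by the clocks. -/
lemma isTASEP (h : IsRingGrowth Γ w E s) (b : Bool) :
    IsTASEP E (boundaryConfig Γ 0 b) (growthConfig (totalTime s) b) where
  init := by
    have h0 := h.path_time_zero
    have h1 := h.path_time_strictMono Nat.zero_lt_one
    simp only [h0] at h1
    rw [h.growthConfig_eq b h0.le h1]
    have : {z | totalTime s z ≤ 0} = Γ := by
      ext z
      refine ⟨fun hz => ?_, fun hz => (h.totalTime_mem hz).le⟩
      by_contra hΓ
      have h2 : 0 ≤ startTime s z := by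
        rw [startTime_eq]; exact le_max_of_le_left (h.totalTime_nonneg _)
      exact absurd (h2.trans_lt (h.startTime_lt hΓ)) (not_lt.2 hz)
    rw [this]
    rfl
  right_continuous t ht x := h.eventually_right_growthConfig b ht x
  jump t ht := by
    obtain ⟨n, h1, h2⟩ := h.exists_left_index ht
    exact ⟨_, h.eventually_left_growthConfig b ht h1 h2, h.jump b ht h1 h2⟩

lemma growthConfig_ne_iff (h : IsRingGrowth Γ w E s) (b : Bool) {t : ℝ} {n : ℕ}
    (hn : totalTime s (minPath (totalTime s) n) ≤ t)
    (hn' : t < totalTime s (minPath (totalTime s) (n + 1))) (x : ℤ) :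
    growthConfig (totalTime s) b t x ≠ growthConfig (totalTime s) (!b) t x ↔
      x = pathDiagonal (totalTime s) n := by
  rw [h.growthConfig_eq b hn hn', h.growthConfig_eq (!b) hn hn']
  simp only [boundaryConfig, mergePair]
  rcases lt_trichotomy x (pathDiagonal (totalTime s) n) with h1 | h1 | h1
  · simp [h1, h1.ne]
  · simp [h1]
  · simp [h1.not_gt, h1.ne']

lemma discrepancy_eq (h : IsRingGrowth Γ w E s) (b : Bool) {t : ℝ} {n : ℕ}
    (hn : totalTime s (minPath (totalTime s) n) ≤ t)
    (hn' : t < totalTime s (minPath (totalTime s) (n + 1))) :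
    discrepancy (growthConfig (totalTime s) b) (growthConfig (totalTime s) (!b)) t =
      pathDiagonal (totalTime s) n := by
  simp only [discrepancy, h.growthConfig_ne_iff b hn hn']
  rw [finsum_eq_single _ (pathDiagonal (totalTime s) n)]
  · simp
  · intro x hx; simp [hx]

lemma isIndexAt_iff (h : IsRingGrowth Γ w E s) (hw : ∀ z, 0 ≤ w z) (t : ℝ) (n : ℕ) :
    IsIndexAt Γ w t n ↔ totalTime s (minPath (totalTime s) n) ≤ t ∧
      t < totalTime s (minPath (totalTime s) (n + 1)) := by
  simp only [IsIndexAt, Set.mem_Ico, h.occupationTime_eq hw, h.competitionInterface_eq hw]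

/-- The second-class particle moves along the diagonals of the competition interface. -/
lemma second_class_particle (h : IsRingGrowth Γ w E s) (hw : ∀ z, 0 ≤ w z) (b : Bool) {t : ℝ}
    (ht : 0 ≤ t) {η η' : ℝ → Config} (hη : η = growthConfig (totalTime s) b)
    (hη' : η' = growthConfig (totalTime s) (!b)) :
    (∀ x : ℤ, η t x ≠ η' t x ↔ x = discrepancy η η' t) ∧
      (∃! n : ℕ, IsIndexAt Γ w t n) ∧
      (rightJumps (discrepancy η η') t).Finite ∧
      (psi Γ w t).1 = ((rightJumps (discrepancy η η') t).ncard : ℤ) ∧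
      (leftJumps (discrepancy η η') t).Finite ∧
      (psi Γ w t).2 = ((leftJumps (discrepancy η η') t).ncard : ℤ) ∧
      discrepancy η η' t = (psi Γ w t).1 - (psi Γ w t).2 := by
  subst hη hη'
  obtain ⟨n, hn, hn'⟩ := h.exists_index ht
  have hidx := fun m => h.isIndexAt_iff hw t m
  have hex : ∃ m, IsIndexAt Γ w t m := ⟨n, (hidx n).2 ⟨hn, hn'⟩⟩
  have huniq : ∀ m, IsIndexAt Γ w t m → m = n := fun m hm =>
    h.index_unique ((hidx m).1 hm).1 ((hidx m).1 hm).2 hn hn'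
  have hpsi : psi Γ w t = minPath (totalTime s) n := by
    rw [psi, dif_pos hex, huniq _ hex.choose_spec, h.competitionInterface_eq hw]
  have hX := h.discrepancy_eq b hn hn'
  have hjump := jumpTimes_eq h.path_time_strictMono h.path_time_zero
    (fun t ht => h.exists_left_index ht) (fun m r h1 h2 => h.discrepancy_eq b h1 h2)
  have hinj : Function.Injective fun m => totalTime s (minPath (totalTime s) (m + 1)) :=
    fun m m' hm => Nat.succ_injective (h.path_time_strictMono.injective hm)
  have hright : rightJumps (discrepancy (growthConfig (totalTime s) b)
      (growthConfig (totalTime s) (!b))) t = _ :=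
    hjump (fun y x => y < x) (fun y => lt_irrefl y) hn hn'
  have hleft : leftJumps (discrepancy (growthConfig (totalTime s) b)
      (growthConfig (totalTime s) (!b))) t = _ :=
    hjump (fun y x => y > x) (fun y => lt_irrefl y) hn hn'
  obtain ⟨hc1, hc2⟩ := minPath_eq_card (totalTime s) n
  refine ⟨fun x => by rw [hX]; exact h.growthConfig_ne_iff b hn hn' x,
    ⟨n, hex.choose_spec |> fun h1 => huniq _ h1 ▸ h1, huniq⟩, ?_, ?_, ?_, ?_, ?_⟩
  · rw [hright]; exact Finset.finite_toSet _
  · rw [hright, Set.ncard_coe_finset, Finset.card_image_of_injective _ hinj, hpsi, hc1]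
    congr!
  · rw [hleft]; exact Finset.finite_toSet _
  · rw [hleft, Set.ncard_coe_finset, Finset.card_image_of_injective _ hinj, hpsi, hc2]
    congr!
  · rw [hX, hpsi]; rfl

end IsRingGrowth

/-! ### Measurability of the exclusion process -/

section Measurability

variable {Ω : Type*} [MeasurableSpace Ω]

lemma measurable_minPath {G : Ω → ℤ × ℤ → ℝ} (hG : Measurable G) (n : ℕ) :
    Measurable fun ω => minPath (G ω) n := by
  induction n with
  | zero => exact measurable_const
  | succ n ih =>
    have h1 : ∀ c : ℤ × ℤ, Measurable fun ω => minPath (G ω) n + c := fun c =>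
      (measurable_of_countable fun z : ℤ × ℤ => z + c).comp ih
    exact Measurable.ite (measurableSet_lt (measurable_eval_countable hG (h1 _))
      (measurable_eval_countable hG (h1 _))) (h1 _) (h1 _)

lemma measurable_decide {p : Ω → Prop} (hp : MeasurableSet {ω | p ω}) :
    Measurable fun ω => decide (p ω) := by
  refine measurable_to_bool ?_
  convert hp using 1
  ext ω
  simp

lemma measurable_growthConfig {G : Ω → ℤ × ℤ → ℝ} (hG : Measurable G) {b : Ω → Bool}
    (hb : Measurable b) (t : ℝ) (x : ℤ) : Measurable fun ω => growthConfig (G ω) (b ω) t x := by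
  have hGz : ∀ z, Measurable fun ω => G ω z := fun z => (measurable_pi_apply z).comp hG
  have hφ := measurable_minPath hG
  have hX : ∀ n, Measurable fun ω => pathDiagonal (G ω) n := fun n =>
    (measurable_of_countable fun z : ℤ × ℤ => z.1 - z.2).comp (hφ n)
  have hτ : ∀ n, Measurable fun ω => G ω (minPath (G ω) n) := fun n =>
    measurable_eval_countable hG (hφ n)
  have hstep : ∀ y : ℤ, Measurable fun ω => decide (IsDownStep {z | G ω z ≤ t} y) := by
    intro y
    refine measurable_decide ?_
    have : {ω | IsDownStep {z | G ω z ≤ t} y} = ⋃ z : ℤ × ℤ, {ω | z.1 - z.2 = y} ∩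
        ({ω | G ω (leftOf z) ≤ t} ∩ {ω | G ω z ≤ t}ᶜ) := by
      ext ω
      simp [IsDownStep]
    rw [this]
    exact MeasurableSet.iUnion fun z => (MeasurableSet.const _).inter
      ((measurableSet_le (hGz _) measurable_const).inter
        (measurableSet_le (hGz _) measurable_const).compl)
  have hconf : ∀ n, Measurable fun ω =>
      boundaryConfig {z | G ω z ≤ t} (pathDiagonal (G ω) n) (b ω) x := fun n =>
    Measurable.ite (measurableSet_lt measurable_const (hX n)) (hstep x)
      (Measurable.ite (measurableSet_eq_fun measurable_const (hX n)) hb (hstep (x + 1)))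
  refine measurable_decide ?_
  rw [Set.ofPred_exists]
  exact MeasurableSet.iUnion fun n => (measurableSet_le (hτ n) measurable_const).inter
    ((measurableSet_lt measurable_const (hτ (n + 1))).inter (hconf n (measurableSet_singleton true)))

lemma measurableSet_mem_initialSet (z : ℤ × ℤ) : MeasurableSet {η : Config | z ∈ initialSet η} := by
  have hsplit : ∀ i : ℤ, Measurable fun η : Config => splitOrigin η i := by
    intro i
    simp only [splitOrigin]
    split_ifs
    exacts [measurable_pi_apply _, measurable_const, measurable_const, measurable_pi_apply _]
  have hstep : ∀ i : ℤ, Measurable fun η : Config => interfaceStep (splitOrigin η i) := fun i =>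
    (measurable_of_countable interfaceStep).comp (hsplit i)
  have hint : ∀ j : ℤ, Measurable fun η : Config => interface (splitOrigin η) j := fun j =>
    (Finset.measurable_sum _ fun i _ => hstep i).sub (Finset.measurable_sum _ fun i _ => hstep i)
  simp only [initialSet]
  have : {η : Config | z ∈ {z | ∃ j : ℤ, z ≤ interface (splitOrigin η) j}} =
      ⋃ j : ℤ, (fun η : Config => interface (splitOrigin η) j) ⁻¹' Set.Ici z := by
    ext η
    simp
  rw [this]
  exact MeasurableSet.iUnion fun j => hint j (Set.to_countable _).measurableSet

end Measurability

/-! ### The coupling -/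

lemma isIIDExp_of_measurePreserving {Ω ι : Type} [MeasurableSpace Ω] {P : Measure Ω}
    [IsProbabilityMeasure P] {V : Ω → ι → ℝ} (hV : MeasurePreserving V P (expProduct ι)) :
    IsIIDExp P fun i ω => V ω i := by
  have hlaw : ∀ i, HasLaw (fun ω => V ω i) (expMeasure 1) P := fun i =>
    ((measurePreserving_eval_infinitePi _ i).comp hV).hasLaw
  refine ⟨hlaw, ?_⟩
  have hmeas : ∀ i, Measurable fun ω => V ω i := fun i =>
    (measurable_pi_apply i).comp hV.measurable
  rw [iIndepFun_iff_map_fun_eq_infinitePi_map hmeas]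
  simp only [fun i => (hlaw i).map_eq]
  exact hV.map_eq

lemma ae_pos_of_measurePreserving {Ω ι : Type*} [Countable ι] [MeasurableSpace Ω] {P : Measure Ω}
    {V : Ω → ι → ℝ} (hV : MeasurePreserving V P (expProduct ι)) : ∀ᵐ ω ∂P, ∀ i, 0 < V ω i :=
  ae_all_iff.2 fun i =>
    ((measurePreserving_eval_infinitePi (fun _ : ι => expMeasure 1) i).comp
      hV).quasiMeasurePreserving.ae ae_pos_expMeasure

lemma isRingGrowth_clockTimes {Γ : Set (ℤ × ℤ)} (hΓ : IsCornerSet Γ) {h : ℤ × ℤ → ℝ}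
    {a : ℤ → ℕ → ℝ} (ha : ∀ x, IsRegular (a x))
    (ha' : ∀ x y, x ≠ y → ∀ n m, arrival (a x) n ≠ arrival (a y) m)
    (hr : Tendsto (fun n : ℕ => ∑ i ∈ Finset.range n, clockWeight Γ h a ((i : ℤ) + 1, 0))
      atTop atTop)
    (hu : Tendsto (fun n : ℕ => ∑ i ∈ Finset.range n, clockWeight Γ h a (0, (i : ℤ) + 1))
      atTop atTop) :
    IsRingGrowth Γ (clockWeight Γ h a) (epochs fun i => a i.1 i.2) (clockTimes Γ a) := by
  have hg := isWeightedGrowth_clockTimes hΓ h ha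
  have htime : ∀ z ∉ Γ, totalTime (clockTimes Γ a) z =
      arrival (a (siteClock (clockTimes Γ a) z))
        (passIndex (startTime (clockTimes Γ a) z) (a (siteClock (clockTimes Γ a) z))) := by
    intro z hz
    rw [hg.totalTime_eq hz, clockWeight, if_neg hz, residual_zero]
    ring
  refine ⟨hg, fun z hz => ⟨_, (htime z hz).symm⟩, ?_, ?_, hr, hu⟩
  · rintro z hz _ ⟨n, rfl⟩ hlt
    rw [htime z hz]
    exact (ha _).strictMono.monotone (passIndex_le hlt)
  · rintro x y t ⟨n, rfl⟩ ⟨m, hm⟩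
    by_contra hxy
    exact ha' x y hxy n m hm.symm

/-- The probability space of the coupling: initial configuration, auxiliary weights, clocks. -/
abbrev CouplingSpace : Type := Config × ((ℤ × ℤ → ℝ) × (ℤ → ℕ → ℝ))

/-- The initial configuration, the auxiliary weights and the clocks are independent. -/
def couplingMeasure (μ : Measure Config) : Measure CouplingSpace :=
  μ.prod ((expProduct (ℤ × ℤ)).prod clockMeasure)

instance (μ : Measure Config) [IsProbabilityMeasure μ] :
    IsProbabilityMeasure (couplingMeasure μ) := by
  unfold couplingMeasure; infer_instance

/-- The weights of the growth process that the clocks induce. The auxiliary weights are used only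
on the initial set. -/
def couplingWeight (ω : CouplingSpace) : ℤ × ℤ → ℝ := clockWeight (initialSet ω.1) ω.2.1 ω.2.2

/-- The waiting times of the clocks. -/
def couplingWait (ω : CouplingSpace) : ℤ × ℕ → ℝ := fun i => ω.2.2 i.1 i.2

/-- The times at which the sites are added in the growth process that the clocks induce. -/
def couplingTime (ω : CouplingSpace) : ℤ × ℤ → ℝ :=
  totalTime (clockTimes (initialSet ω.1) ω.2.2)

lemma measurableSet_mem_initialSet_fst (z : ℤ × ℤ) :
    MeasurableSet {ω : CouplingSpace | z ∈ initialSet ω.1} :=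
  measurable_fst (measurableSet_mem_initialSet z)

lemma measurable_couplingTime : Measurable couplingTime :=
  measurable_pi_lambda _ fun z =>
    measurable_totalTime (measurable_clockTimes measurableSet_mem_initialSet_fst
      measurable_snd.snd) z

lemma measurable_couplingWeight : Measurable couplingWeight :=
  measurable_pi_lambda _ fun z =>
    measurable_clockWeight measurableSet_mem_initialSet_fst measurable_snd.snd measurable_snd.fst z

section Coupling

variable (μ : Measure Config)

/-- Conditionally on the initial configuration, the induced weights are i.i.d. exponential. -/
lemma measurePreserving_couplingWeight [IsProbabilityMeasure μ] (hμ : ∀ᵐ ζ ∂μ, Admissible ζ) :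
    MeasurePreserving (fun ω : CouplingSpace => (ω.1, couplingWeight ω)) (couplingMeasure μ)
      (μ.prod (expProduct (ℤ × ℤ))) := by
  have hmap : ∀ᵐ ζ ∂μ, ((expProduct (ℤ × ℤ)).prod clockMeasure).map
      (fun p => couplingWeight (ζ, p)) = expProduct (ℤ × ℤ) := by
    filter_upwards [hμ] with ζ hζ
    exact map_clockWeight (isCornerSet_initialSet hζ)
  have hmeas : Measurable (Function.uncurry fun ζ p => couplingWeight (ζ, p)) :=
    measurable_couplingWeight
  exact (MeasurePreserving.id μ).skew_product hmeas hmap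

lemma measurePreserving_curry_symm :
    MeasurePreserving (fun (a : ℤ → ℕ → ℝ) (i : ℤ × ℕ) => a i.1 i.2) clockMeasure
      (expProduct (ℤ × ℕ)) where
  measurable := measurable_pi_lambda _ fun i =>
    (measurable_pi_apply i.2).comp (measurable_pi_apply i.1)
  map_eq := Measure.infinitePi_map_curry_symm fun (_ : ℤ) (_ : ℕ) => expMeasure 1

lemma measurePreserving_couplingWait [IsProbabilityMeasure μ] :
    MeasurePreserving (fun ω : CouplingSpace => (ω.1, couplingWait ω)) (couplingMeasure μ)
      (μ.prod (expProduct (ℤ × ℕ))) := by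
  exact (MeasurePreserving.id μ).prod (measurePreserving_curry_symm.comp measurePreserving_snd)

lemma measurePreserving_couplingClocks [IsProbabilityMeasure μ] :
    MeasurePreserving (fun ω : CouplingSpace => ω.2.2) (couplingMeasure μ) clockMeasure :=
  measurePreserving_snd.comp measurePreserving_snd

lemma measurePreserving_couplingInit :
    MeasurePreserving (fun ω : CouplingSpace => ω.1) (couplingMeasure μ) μ :=
  measurePreserving_fst

lemma ae_isRingGrowth [IsProbabilityMeasure μ] (hμ : ∀ᵐ ζ ∂μ, Admissible ζ) :
    ∀ᵐ ω ∂couplingMeasure μ, (∀ z, 0 ≤ couplingWeight ω z) ∧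
      IsRingGrowth (initialSet ω.1) (couplingWeight ω) (epochs (couplingWait ω))
        (clockTimes (initialSet ω.1) ω.2.2) := by
  have hW : MeasurePreserving couplingWeight (couplingMeasure μ) (expProduct (ℤ × ℤ)) :=
    measurePreserving_snd.comp (measurePreserving_couplingWeight μ hμ)
  have hinjr : Function.Injective fun i : ℕ => ((i : ℤ) + 1, (0 : ℤ)) := fun i j h => by
    simpa using h
  have hinju : Function.Injective fun i : ℕ => ((0 : ℤ), (i : ℤ) + 1) := fun i j h => by
    simpa using h
  have hclocks := (measurePreserving_couplingClocks μ).quasiMeasurePreserving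
  filter_upwards [(measurePreserving_couplingInit μ).quasiMeasurePreserving.ae hμ,
    ae_pos_of_measurePreserving hW, hclocks.ae ae_clock_isRegular, hclocks.ae ae_clock_distinct,
    hW.quasiMeasurePreserving.ae (ae_tendsto_sum hinjr),
    hW.quasiMeasurePreserving.ae (ae_tendsto_sum hinju)] with ω h1 h2 h3 h4 h5 h6
  exact ⟨fun z => (h2 z).le, isRingGrowth_clockTimes (isCornerSet_initialSet h1) h3 h4 h5 h6⟩

end Coupling

end

end ExclusionGrowth

open ExclusionGrowth

/-- For every law `μ` of the initial configuration, there are a probability space and, on it, a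
growth process and an exclusion process with a second-class particle (with corresponding initial
data) such that almost surely, for all `t ≥ 0`: `X(t)` is the only discrepancy, `ψ(t)` is well defined,
`I(t)` and `J(t)` are the numbers of rightward and leftward jumps of the second-class particle in
`[0, t]`, and `X(t) = I(t) - J(t)`. -/
theorem proposition2p2 (μ : Measure Config) [IsProbabilityMeasure μ]
    (hμ : ∀ᵐ ζ ∂μ, Admissible ζ) :
    ∃ (Ω : Type) (_ : MeasurableSpace Ω) (P : Measure Ω) (_ : IsProbabilityMeasure P)
      (η₀ : Ω → Config) (w : ℤ × ℤ → Ω → ℝ) (e : ℤ × ℕ → Ω → ℝ) (η η' : Ω → ℝ → Config),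
      IsGrowthModel P μ η₀ w ∧
      IsSecondClassExclusion P μ η₀ e η η' ∧
      ∀ᵐ ω ∂P, ∀ t : ℝ, 0 ≤ t →
        (∀ x : ℤ, η ω t x ≠ η' ω t x ↔ x = discrepancy (η ω) (η' ω) t) ∧
        (∃! n : ℕ, IsIndexAt (initialSet (η₀ ω)) (fun z => w z ω) t n) ∧
        (rightJumps (discrepancy (η ω) (η' ω)) t).Finite ∧
        (psi (initialSet (η₀ ω)) (fun z => w z ω) t).1 =
          ((rightJumps (discrepancy (η ω) (η' ω)) t).ncard : ℤ) ∧
        (leftJumps (discrepancy (η ω) (η' ω)) t).Finite ∧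
        (psi (initialSet (η₀ ω)) (fun z => w z ω) t).2 =
          ((leftJumps (discrepancy (η ω) (η' ω)) t).ncard : ℤ) ∧
        discrepancy (η ω) (η' ω) t =
          (psi (initialSet (η₀ ω)) (fun z => w z ω) t).1 -
            (psi (initialSet (η₀ ω)) (fun z => w z ω) t).2 := by
  have hW2 := measurePreserving_couplingWeight μ hμ
  have hV2 := measurePreserving_couplingWait μ
  have hW : MeasurePreserving couplingWeight (couplingMeasure μ) (expProduct (ℤ × ℤ)) :=
    measurePreserving_snd.comp hW2
  have hV : MeasurePreserving couplingWait (couplingMeasure μ) (expProduct (ℤ × ℕ)) :=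
    measurePreserving_snd.comp hV2
  have hfst := measurePreserving_couplingInit μ
  have hgood := ae_isRingGrowth μ hμ
  have hb : Measurable fun ω : CouplingSpace => ω.1 0 :=
    (measurable_pi_apply 0).comp measurable_fst
  refine ⟨CouplingSpace, inferInstance, couplingMeasure μ, inferInstance, fun ω => ω.1,
    fun z ω => couplingWeight ω z, fun i ω => couplingWait ω i,
    fun ω => growthConfig (couplingTime ω) (ω.1 0),
    fun ω => growthConfig (couplingTime ω) (!ω.1 0), ?_, ?_, ?_⟩
  · refine ⟨hfst.hasLaw, isIIDExp_of_measurePreserving hW, ?_⟩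
    rw [indepFun_iff_map_prod_eq_prod_map_map hfst.measurable.aemeasurable
      hW.measurable.aemeasurable, hfst.map_eq]
    exact hW2.map_eq.trans (congrArg _ hW.map_eq.symm)
  · refine ⟨hfst.hasLaw, isIIDExp_of_measurePreserving hV, ?_,
      measurable_growthConfig measurable_couplingTime hb,
      measurable_growthConfig measurable_couplingTime ((measurable_of_countable not).comp hb),
      ?_, ?_⟩
    · rw [indepFun_iff_map_prod_eq_prod_map_map hfst.measurable.aemeasurable
        hV.measurable.aemeasurable, hfst.map_eq]
      exact hV2.map_eq.trans (congrArg _ hV.map_eq.symm)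
    · filter_upwards [hgood] with ω hω
      have := hω.2.isTASEP (ω.1 0)
      rwa [boundaryConfig_initialSet, Function.update_eq_self] at this
    · filter_upwards [hgood] with ω hω
      have := hω.2.isTASEP (!ω.1 0)
      rwa [boundaryConfig_initialSet] at this
  · filter_upwards [hgood] with ω hω t ht
    exact hω.2.second_class_particle hω.1 (ω.1 0) ht rfl rfl
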